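/- **Setting.** Let $N\ge 1$, $n_i\ge 1$, and let $X_i\subseteq\mathbb R^{n_i}$ be closed and convex with $X=\prod_{i=1}^N X_i$ compact of diameter $D_X>0$ (Euclidean norms throughout). Let $\xi$ be a random variable, and consider the $N$-player game in which player $i$ minimizes over $x_i\in X_i$ the function $h_i(x_i)+m_i(x)$, where $h_i(x_i)=\mathbb E[\tilde h_i(x_i,\xi)]$ and $m_i(x)=\mathbb E[\tilde m_i(x_i,x_{-i},\xi)]$ (integrands measurable and integrable). For $\eta>0$, each $\tilde h_i(\cdot,\xi)$ is $L_i$-Lipschitz on a neighbourhood (independent of $\xi$) of $X_i+\eta\mathbb B$, $\mathbb B$ being the closed unit ball, and each $\tilde m_i(\cdot,x_{-i},\xi)$ is $C^1$ on a neighbourhood (independent of $\xi$) of $X_i$. Put $h_i^\eta(x_i)=\mathbb E[h_i(x_i+\eta u)]$ with $u$ uniform on the unit ball of $\mathbb R^{n_i}$, $f_i^\eta(x)=h_i^\eta(x_i)+m_i(x)$, $F^\eta(x)=(\nabla_{x_i}f_i^\eta(x))_{i=1}^N$, and, for $\gamma>0$, $G^\eta_\gamma(x)=\gamma^{-1}\bigl(x-\Pi_X[x-\gamma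 F^\eta(x)]\bigr)$, where $\Pi$ is Euclidean projection. Assume that for all $x\in X$ and all $i$, $m_i$ is differentiable in $x_i$ at $x$, $\mathbb E[\nabla_{x_i}\tilde m_i(x,\xi)]=\nabla_{x_i}m_i(x)$ and $\mathbb E\|\nabla_{x_i}\tilde m_i(x,\xi)-\nabla_{x_i}m_i(x)\|^2\le\sigma_m^2$, with $\sigma_m>0$. Assume that, for some real function $P$, the function $P^\eta(x)=P_m(x)+\sum_i h_i^\eta(x_i)$ with $P_m(x)=P(x)-\sum_i h_i(x_i)$ is a potential function over $X$ of the game with objectives $f_i^\eta$, that $P_m$ is $L_m^0$-Lipschitz and $L_m^1$-smooth on $X$ (differentiable relative to $X$, with an $L_m^1$-Lipschitz gradient), and that $P^\eta$ is not constant on $X$. Let $P^\eta_{\max}$ and $P^\eta_{\min}$ be its maximum and minimum over $X$. Put $L_{\max}=\max_i L_i$, $n_{\max}=\max_i n_i$, $\sigma^2=32\sqrt{2\pi}\,L_{\max}^2n_{\max}+2\sigma_m^2$ and $\bar L(\eta)=L_m^1+L_{\max}\sqrt{n_{\max}}\sqrt N/\eta$. **Scheme (RS-RSG).** Let $L(\eta)\in(0,\bar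 L(\eta)]$ be a constant for which $P^\eta$ is $L(\eta)$-smooth on $X$, and $D(\eta)=((P^\eta_{\max}-P^\eta_{\min})/L(\eta))^{1/2}$. Given budgets of $M_0$ zeroth-order calls (values of $\tilde h_i$) and $M_1$ first-order calls (values of $\nabla_{x_i}\tilde m_i$), put $$M=\min\{M_0/2,M_1\},\quad S=\left\lceil\frac{\sigma\sqrt{6M}}{4L(\eta)D(\eta)}\right\rceil,\quad T=\min\left\{\left\lfloor\frac{M_0/2}{SN}\right\rfloor,\left\lfloor\frac{M_1}{SN}\right\rfloor\right\},\quad \gamma=\frac1{2L(\eta)}.$$ From any $x^0\in X$, iterate $$x_i^{k+1}=\Pi_{X_i}\Bigl[x_i^k-\frac{\gamma}{S}\sum_{l=1}^S\Bigl(\frac{n_i}{2\eta}\bigl(\tilde h_i(x_i^k+v_{i,l}^k,\xi_{i,l}^k)-\tilde h_i(x_i^k-v_{i,l}^k,\xi_{i,l}^k)\bigr)\frac{v_{i,l}^k}{\|v_{i,l}^k\|}+\nabla_{x_i}\tilde m_i(x^k,\xi_{i,l}^k)\Bigr)\Bigr],$$ with all $\xi_{i,l}^k$ (distributed as $\xi$)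 and $v_{i,l}^k$ (uniform on the sphere of radius $\eta$ in $\mathbb R^{n_i}$) independent, and output $x^R$ with $R$ uniform on $\{1,\dots,T\}$ and independent of the samples. **Theorem (Complexities of RS-RSG).** The function $P^\eta$ is $\bar L(\eta)$-smooth on $X$, so $L(\eta)=\bar L(\eta)$ is an admissible choice. Reaching $\mathbb E\|G^\eta_\gamma(x^R)\|\le\epsilon$ requires (i) sample complexity $\mathcal O(L_{\max}^4n_{\max}^{3/2}N^3\eta^{-1}\epsilon^{-4})$, and (ii) iteration complexity $\mathcal O(L_{\max}^3n_{\max}N\eta^{-1}\epsilon^{-2})$. Precisely: for all $L_m^0,L_m^1\ge0$ and $\sigma_m,D_X,\ell,\bar\eta,\bar\epsilon>0$ there are constants $C,K>0$, depending on these numbers only, such that for every game as above with $L_{\max}\ge\ell$ and $\eta\le\bar\eta$, and every admissible $L(\eta)$, with $B_\epsilon=L_{\max}^4n_{\max}^{3/2}N^3\eta^{-1}\epsilon^{-4}$: 1. for all $\epsilon\in(0,\bar\epsilon]$ and all budgets with $M\ge C B_\epsilon$ and $T\ge1$, every run satisfies $\mathbb E\|G^\eta_\gamma(x^R)\|\le\epsilon$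 (the expectation exists); 2. for all $\epsilon\in(0,\bar\epsilon]$, the minimal budgets $M_0=2M$, $M_1=M$ with $M=\lceil C B_\epsilon\rceil$ satisfy $2SNT\le M_0$, $SNT\le M_1$, $M_0+M_1\le K B_\epsilon$ and $T\le K L_{\max}^3n_{\max}N\eta^{-1}\epsilon^{-2}$; 3. there is $\epsilon_0>0$ (which may depend on the game and on $L(\eta)$) such that $T\ge1$ for all $\epsilon\in(0,\epsilon_0]$ and all budgets with $M\ge C B_\epsilon$. -/

import Mathlib

open MeasureTheory ProbabilityTheory Set Topology
open scoped NNReal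

noncomputable section

namespace RSRSG

/-- The strategy space `ℝ^d` with the Euclidean norm. -/
abbrev Strat (d : ℕ) : Type := EuclideanSpace ℝ (Fin d)

/-- Strategy profiles `x = (x_1, …, x_N)` with the Euclidean norm of the product. -/
abbrev Profile {N : ℕ} (n : Fin N → ℕ) : Type := PiLp 2 (fun i => Strat (n i))

/-- The profile `(y, x_{-i})`. -/
def repl {N : ℕ} {n : Fin N → ℕ} (x : Profile n) (i : Fin N) (y : Strat (n i)) : Profile n :=
  WithLp.toLp 2 (Function.update (WithLp.ofLp x) i y)

/-- The partial gradient `∇_{x_i} f (x)`. -/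
def partialGrad {N : ℕ} {n : Fin N → ℕ} (i : Fin N) (f : Profile n → ℝ) (x : Profile n) :
    Strat (n i) :=
  gradient (fun y => f (repl x i y)) (x i)

/-- `f` is `L`-smooth on `K`: it is differentiable relative to `K`, with an `L`-Lipschitz
gradient. Only the values of `f` on `K` matter. -/
def IsSmoothOn {E : Type*} [NormedAddCommGroup E] [InnerProductSpace ℝ E] [CompleteSpace E]
    (L : ℝ) (f : E → ℝ) (K : Set E) : Prop :=
  ∃ g : E → E, (∀ x ∈ K, HasGradientWithinAt f (g x) K x) ∧
    ∀ x ∈ K, ∀ y ∈ K, ‖g x - g y‖ ≤ L * ‖x - y‖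

/-- The Euclidean projection of `x` onto `K`: the nearest point of `K`, which exists and is unique
for nonempty closed convex `K`. -/
def proj {E : Type*} [NormedAddCommGroup E] (K : Set E) (x : E) : E :=
  letI : Nonempty E := ⟨0⟩
  Classical.epsilon fun y => y ∈ K ∧ ∀ z ∈ K, ‖x - y‖ ≤ ‖x - z‖

/-- Randomized smoothing `f^η(x) = 𝔼[f(x + η u)]`, `u` uniform on the closed unit ball. -/
def smoothing {d : ℕ} (η : ℝ) (f : Strat d → ℝ) (x : Strat d) : ℝ :=
  ⨍ u in Metric.closedBall (0 : Strat d) 1, f (x + η • u)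

/-- The uniform distribution on the sphere `η 𝕊` of `ℝ^d`: the image under `u ↦ η u` of the
normalized surface measure of the unit sphere. -/
def sphereUnif (d : ℕ) (η : ℝ) : Measure (Strat d) :=
  Measure.map (fun u : Metric.sphere (0 : Strat d) 1 => η • (u : Strat d))
    (((volume : Measure (Strat d)).toSphere univ)⁻¹ • (volume : Measure (Strat d)).toSphere)

/-- The data of a stochastic `N`-player game with player objectives
`f_i(x) = 𝔼[h̃_i(x_i, ξ)] + 𝔼[m̃_i(x_i, x_{-i}, ξ)]` over `x_i ∈ X_i ⊆ ℝ^{n_i}`. -/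
structure Game {N : ℕ} (n : Fin N → ℕ) (Ξ : Type*) [MeasurableSpace Ξ] where
  /-- strategy sets `X_i` -/
  X : ∀ i, Set (Strat (n i))
  /-- `h̃_i(x_i, ξ)` -/
  hS : ∀ i, Strat (n i) → Ξ → ℝ
  /-- `m̃_i(x, ξ)` -/
  mS : Fin N → Profile n → Ξ → ℝ
  /-- the distribution of `ξ` -/
  law : Measure Ξ

namespace Game

variable {N : ℕ} {n : Fin N → ℕ} {Ξ : Type*} [MeasurableSpace Ξ] (G : Game n Ξ)

/-- `X = ∏ X_i`. -/
def feas : Set (Profile n) := {x | ∀ i, x i ∈ G.X i}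

/-- `h_i(x_i) = 𝔼[h̃_i(x_i, ξ)]`. -/
def h (i : Fin N) (y : Strat (n i)) : ℝ := ∫ ξ, G.hS i y ξ ∂G.law

/-- `m_i(x) = 𝔼[m̃_i(x, ξ)]`. -/
def m (i : Fin N) (x : Profile n) : ℝ := ∫ ξ, G.mS i x ξ ∂G.law

/-- The smoothed objectives `f_i^η(x) = h_i^η(x_i) + m_i(x)`. -/
def fη (η : ℝ) (i : Fin N) (x : Profile n) : ℝ := smoothing η (G.h i) (x i) + G.m i x

/-- `P_m(x) = P(x) - ∑ h_i(x_i)`. -/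
def Pm (P : Profile n → ℝ) (x : Profile n) : ℝ := P x - ∑ i, G.h i (x i)

/-- `P^η(x) = P_m(x) + ∑ h_i^η(x_i)`. -/
def Pη (η : ℝ) (P : Profile n → ℝ) (x : Profile n) : ℝ :=
  G.Pm P x + ∑ i, smoothing η (G.h i) (x i)

/-- `Q` is a potential function, over `X`, of the game with objectives `f_i`. -/
def IsPotential (f : Fin N → Profile n → ℝ) (Q : Profile n → ℝ) : Prop :=
  ∀ i, ∀ x ∈ G.feas, ∀ y ∈ G.X i, ∀ z ∈ G.X i,
    Q (repl x i y) - Q (repl x i z) = f i (repl x i y) - f i (repl x i z)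

/-- `F^η(x) = (∇_{x_i} f_i^η(x))_i`. -/
def Fη (η : ℝ) (x : Profile n) : Profile n :=
  WithLp.toLp 2 fun i => partialGrad i (G.fη η i) x

/-- The residual `G^η_γ(x) = (x - Π_X[x - γ F^η(x)]) / γ`. -/
def residual (η γ : ℝ) (x : Profile n) : Profile n :=
  (1 / γ) • (x - proj G.feas (x - γ • G.Fη η x))

/-- The standing assumptions on the game with Lipschitz constants `L_i` and smoothing parameter
`η`. The functions `h̃_i(·, ξ)` are Lipschitz on a neighbourhood of `X_i + η 𝔹`, where smoothing
and its gradient on `X_i` evaluate them. -/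
structure Regular (L : Fin N → ℝ≥0) (η : ℝ) : Prop where
  dim_pos : ∀ i, 0 < n i
  prob : IsProbabilityMeasure G.law
  closed : ∀ i, IsClosed (G.X i)
  convex : ∀ i, Convex ℝ (G.X i)
  meas_h : ∀ i, Measurable (Function.uncurry (G.hS i))
  meas_m : ∀ i, Measurable (Function.uncurry (G.mS i))
  lipschitz_h : ∀ i, ∃ U : Set (Strat (n i)), IsOpen U ∧ Metric.cthickening η (G.X i) ⊆ U ∧
    (∀ ξ, LipschitzOnWith (L i) (fun y => G.hS i y ξ) U) ∧
    ∀ y ∈ U, Integrable (G.hS i y) G.law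
  contDiff_m : ∀ i, ∀ x ∈ G.feas, ∃ O : Set (Strat (n i)), IsOpen O ∧ G.X i ⊆ O ∧
    (∀ ξ, ContDiffOn ℝ 1 (fun y => G.mS i (repl x i y) ξ) O) ∧
    ∀ y ∈ O, Integrable (G.mS i (repl x i y)) G.law

/-- Unbiasedness of the sampled gradients: `m_i` is differentiable in `x_i` and
`𝔼[∇_{x_i} m̃_i(x, ξ)] = ∇_{x_i} m_i(x)`. -/
def Unbiased : Prop :=
  ∀ i, ∀ x ∈ G.feas,
    DifferentiableAt ℝ (fun y => G.m i (repl x i y)) (x i) ∧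
    Integrable (fun ξ => partialGrad i (fun z => G.mS i z ξ) x) G.law ∧
    ∫ ξ, partialGrad i (fun z => G.mS i z ξ) x ∂G.law = partialGrad i (G.m i) x

/-- Bounded second moment:
`𝔼[‖∇_{x_i} m̃_i(x, ξ) - ∇_{x_i} m_i(x)‖²] ≤ σ_m²`. -/
def BoundedMoment (σm : ℝ) : Prop :=
  ∀ i, ∀ x ∈ G.feas,
    Integrable (fun ξ => ‖partialGrad i (fun z => G.mS i z ξ) x - partialGrad i (G.m i) x‖ ^ 2)
      G.law ∧
    ∫ ξ, ‖partialGrad i (fun z => G.mS i z ξ) x - partialGrad i (G.m i) x‖ ^ 2 ∂G.law ≤ σm ^ 2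

/-- The sampled gradient `Δ_{i,l}^f` at `x` from a realization `s = (ξ, v)`: two zeroth-order
queries of `h̃_i` and one first-order query of `m̃_i`. -/
def sampleGrad (η : ℝ) (x : Profile n) (i : Fin N) (s : Ξ × Strat (n i)) : Strat (n i) :=
  ((n i : ℝ) / (2 * η) * (G.hS i (x i + s.2) s.1 - G.hS i (x i - s.2) s.1)) •
      ((1 / ‖s.2‖) • s.2)
    + partialGrad i (fun z => G.mS i z s.1) x

/-- The iterates `x^k` of the scheme with constant stepsize `γ` and batch size `S`, as a function
of the realizations `z (k, i, l) = (ξ_{i,l}^k, v_{i,l}^k)`. -/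
def iter (η γ : ℝ) {S : ℕ} (x₀ : Profile n)
    (z : ∀ p : ℕ × Fin N × Fin S, Ξ × Strat (n p.2.1)) : ℕ → Profile n
  | 0 => x₀
  | k + 1 => WithLp.toLp 2 fun i =>
      proj (G.X i) (iter η γ x₀ z k i -
        γ • ((1 / (S : ℝ)) • ∑ l, G.sampleGrad η (iter η γ x₀ z k) i (z (k, i, l))))

/-- The randomness of the scheme: independent realizations `ξ_{i,l}^k` of `ξ` and `v_{i,l}^k`
uniform on `η 𝕊_{n_i}`, and an independent `R` uniform on `{1, …, T}`. -/
structure IsRun (η : ℝ) (S T : ℕ) {Ω : Type*} [MeasurableSpace Ω] (μ : Measure Ω)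
    (Z : ∀ p : ℕ × Fin N × Fin S, Ω → Ξ × Strat (n p.2.1)) (R : Ω → ℕ) : Prop where
  prob : IsProbabilityMeasure μ
  meas_Z : ∀ p, Measurable (Z p)
  law_Z : ∀ p, Measure.map (Z p) μ = G.law.prod (sphereUnif (n p.2.1) η)
  indep_Z : iIndepFun Z μ
  meas_R : Measurable R
  law_R : ∀ k ∈ Finset.Icc 1 T, μ.real {ω | R ω = k} = 1 / (T : ℝ)
  indep_R : IndepFun R (fun ω p => Z p ω) μ

/-- `P^η_max - P^η_min` over `X`. -/
def gap (η : ℝ) (P : Profile n → ℝ) : ℝ :=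
  sSup (G.Pη η P '' G.feas) - sInf (G.Pη η P '' G.feas)

end Game

/-- `L_max`. -/
def Lmax {N : ℕ} (L : Fin N → ℝ≥0) : ℝ := (Finset.univ.sup L : ℝ≥0)

/-- `n_max`. -/
def nmax {N : ℕ} (n : Fin N → ℕ) : ℝ := (Finset.univ.sup n : ℕ)

/-- The smoothness constant `L_m^1 + L_max √n_max √N / η` of the smoothed potential. -/
def smoothConst {N : ℕ} (n : Fin N → ℕ) (L : Fin N → ℝ≥0) (Lm1 : ℝ≥0) (η : ℝ) : ℝ :=
  Lm1 + Lmax L * √(nmax n) * √(N : ℝ) / η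

/-- `σ`, with `σ² = 32 √(2π) L_max² n_max + 2 σ_m²`. -/
def sigma {N : ℕ} (n : Fin N → ℕ) (L : Fin N → ℝ≥0) (σm : ℝ) : ℝ :=
  √(32 * √(2 * Real.pi) * Lmax L ^ 2 * nmax n + 2 * σm ^ 2)

/-- `M = min {M₀ / 2, M₁}`, for budgets of `M₀` zeroth-order and `M₁` first-order oracle calls. -/
def budget (M₀ M₁ : ℕ) : ℝ := min ((M₀ : ℝ) / 2) (M₁ : ℝ)

/-- The batch size `⌈σ √(6M) / (4 L(η) D(η))⌉`, where `D(η) = √(gap / L(η))`. -/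
def batchSize (σ Lη gap : ℝ) (M₀ M₁ : ℕ) : ℕ :=
  ⌈σ * √(6 * budget M₀ M₁) / (4 * Lη * √(gap / Lη))⌉₊

/-- The iteration limit `T = min {⌊(M₀/2)/(SN)⌋, ⌊M₁/(SN)⌋}`: each iteration takes `2SN`
zeroth-order and `SN` first-order oracle calls. -/
def iterLimit (N S M₀ M₁ : ℕ) : ℕ :=
  min ⌊((M₀ : ℝ) / 2) / ((S : ℝ) * N)⌋₊ ⌊(M₁ : ℝ) / ((S : ℝ) * N)⌋₊

/-- The sample complexity rate `L_max⁴ n_max^{3/2} N³ η⁻¹ ε⁻⁴`. -/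
def sampleRate {N : ℕ} (n : Fin N → ℕ) (L : Fin N → ℝ≥0) (η ε : ℝ) : ℝ :=
  Lmax L ^ 4 * nmax n ^ (3 / 2 : ℝ) * (N : ℝ) ^ 3 * η⁻¹ * (ε ^ 4)⁻¹

/-- The iteration complexity rate `L_max³ n_max N η⁻¹ ε⁻²`. -/
def iterRate {N : ℕ} (n : Fin N → ℕ) (L : Fin N → ℝ≥0) (η ε : ℝ) : ℝ :=
  Lmax L ^ 3 * nmax n * (N : ℝ) * η⁻¹ * (ε ^ 2)⁻¹

end RSRSG

end

/-! RS-RSG is a projected stochastic gradient method for one smooth function. Since `P^η` is a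
potential, differentiating along single-player segments shows that any gradient of `P^η` relative to
`X` pairs with feasible directions exactly as `F^η` does (`Admissible.inner_gradient_eq`). The
projection onto `X` splits over players, so one simultaneous update is one projected step in `X`.
With step size `1/(2L)`, the descent lemma bounds `‖G^η_γ(x^k)‖²` by `16 L (P^η(x^k) -
P^η(x^{k+1}))` plus six times the squared error of the sampled direction. Summing over the indices
from which `R` is drawn telescopes the first term to at most the gap of `P^η`. Independence makes
the mean square error of a batch at most `N σ²/S`. By Jensen, `(𝔼‖G‖)² ≤ 16 L gap / T + 6 N σ²/S`
(`Admissible.integral_norm_residual_iter_le`).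

The analytic input concerns smoothing of a Lipschitz `h` on `ℝ^d`. Rademacher's theorem and a
divergence theorem on the ball give `∇h^η(x) = (d/η) 𝔼[h(x + η v) v]`, `v` uniform on the unit
sphere. As `𝔼⟨v, z⟩² = ‖z‖²/d`, this gradient is `L √d / η`-Lipschitz. By symmetry of the sphere the
two-point estimate is unbiased. Its second moment must be `O(L² d)`, whereas the pointwise bound
only gives `L² d²`; the missing factor is concentration on the sphere, used in the form that odd
`K`-Lipschitz functions have second moment `O(K²/d)`. This is transferred from the Gaussian, where
rotating `x` into `-x` through an independent copy yields a Poincaré inequality for odd functions.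

For the rates put `b² = L gap`. The prescribed batch size is about `σ √M / b`, which makes both
error terms of order `N σ b / √M`, so `M` of order `N² σ² b² / ε⁴` suffices. Since `b² = O(L_max²
√n_max N / η)` and `σ² = O(L_max² n_max)`, this is the stated sample rate. The number of iterations
is about `b √M / (σ N)`, which stays below the stated iteration rate. The bounds `ℓ ≤ L_max`, `η ≤
ηbar` and `ε ≤ εbar` absorb the lower-order terms and the effects of rounding. -/

open scoped ENNReal

namespace RSRSG

/-! ### The uniform distribution on the sphere, via polar coordinates and the Gaussian -/

section Sphere

variable {d : ℕ}

/-- In polar coordinates Lebesgue measure is a product of surface measure and a radial measure, so a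
radial density changes only the second factor and the direction stays uniform. Indicator densities
give balls and annuli; a weighted Gaussian density links the sphere to Gaussian moments. -/
lemma map_normalize_withDensity (hd : 0 < d) (w : ℝ → ℝ≥0∞) (hw : Measurable w) :
    Measure.map (fun x : Strat d => ‖x‖⁻¹ • x) (volume.withDensity fun x : Strat d => w ‖x‖) =
      (∫⁻ x : Strat d, w ‖x‖) • sphereUnif d 1 := by
  have : Nonempty (Fin d) := ⟨⟨0, hd⟩⟩
  have hnt : Nontrivial (Strat d) := inferInstance
  let τ := (volume : Measure (Strat d)).toSphere
  let ρ := Measure.volumeIoiPow (Module.finrank ℝ (Strat d) - 1)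
  have key : ∀ A : Set (Strat d), MeasurableSet A →
      Measure.map (fun x : Strat d => ‖x‖⁻¹ • x) (volume.withDensity fun x => w ‖x‖) A =
        τ ((↑) ⁻¹' A) * ∫⁻ r, w r ∂ρ := by
    intro A hA
    have hm : Measurable (fun x : Strat d => ‖x‖⁻¹ • x) := by fun_prop
    have hwn : Measurable (fun x : Strat d => w ‖x‖) := hw.comp measurable_norm
    rw [Measure.map_apply hm hA, withDensity_apply _ (hm hA), ← lintegral_indicator (hm hA)]
    have h1 : ∫⁻ x : Strat d, ((fun x : Strat d => ‖x‖⁻¹ • x) ⁻¹' A).indicator (fun x => w ‖x‖) x =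
        ∫⁻ x : ({0}ᶜ : Set (Strat d)), ((fun x : Strat d => ‖x‖⁻¹ • x) ⁻¹' A).indicator
          (fun x => w ‖x‖) x.1 ∂(volume.comap Subtype.val) := by
      rw [lintegral_subtype_comap (measurableSet_singleton _).compl, restrict_compl_singleton]
    rw [h1]
    have h2 := (volume : Measure (Strat d)).measurePreserving_homeomorphUnitSphereProd.lintegral_comp_emb
      (Homeomorph.measurableEmbedding _)
      (fun p => (((↑) : Metric.sphere (0 : Strat d) 1 → Strat d) ⁻¹' A).indicator 1 p.1 * w p.2)
    have h3 : ∀ x : ({0}ᶜ : Set (Strat d)), ((fun x : Strat d => ‖x‖⁻¹ • x) ⁻¹' A).indicator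
          (fun x => w ‖x‖) x.1 = (((↑) : Metric.sphere (0 : Strat d) 1 → Strat d) ⁻¹' A).indicator
            (1 : Metric.sphere (0 : Strat d) 1 → ℝ≥0∞) (homeomorphUnitSphereProd (Strat d) x).1 *
              w ((homeomorphUnitSphereProd (Strat d) x).2 : ℝ) := by
      intro x
      by_cases hx : (‖x.1‖⁻¹ • x.1) ∈ A
      · rw [indicator_of_mem (by exact hx), indicator_of_mem (by simpa using hx)]; simp
      · rw [indicator_of_notMem (by exact hx), indicator_of_notMem (by simpa using hx)]; simp
    rw [lintegral_congr h3, h2, lintegral_prod_mul (g := fun r : Ioi (0 : ℝ) => w r),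
      lintegral_indicator_one]
    · exact measurable_subtype_coe hA
    · exact (measurable_one.indicator (measurable_subtype_coe hA)).aemeasurable
    · exact (hw.comp measurable_subtype_coe).aemeasurable
  -- The whole space as test set expresses the radial integral through the total mass, so no
  -- explicit surface area is needed.
  have htot := key univ .univ
  rw [Measure.map_apply (by fun_prop) .univ, preimage_univ, withDensity_apply _ .univ,
    Measure.restrict_univ, preimage_univ] at htot
  have hτ : τ univ ≠ 0 :=
    Measure.measure_univ_ne_zero.2 (volume : Measure (Strat d)).toSphere_ne_zero
  have hτ' : τ univ ≠ ⊤ := measure_ne_top _ _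
  ext A hA
  rw [key A hA, htot, Measure.smul_apply, sphereUnif, Measure.map_apply (by fun_prop) hA]
  simp only [one_smul, Measure.smul_apply, smul_eq_mul]
  change _ = τ univ * _ * ((τ univ)⁻¹ * τ _)
  rw [mul_comm (τ univ) _, mul_assoc, ← mul_assoc (τ univ), ENNReal.mul_inv_cancel hτ hτ', one_mul,
    mul_comm]

lemma sphereUnif_eq_map (d : ℕ) (η : ℝ) :
    sphereUnif d η = Measure.map (fun v => η • v) (sphereUnif d 1) := by
  rw [sphereUnif, sphereUnif, Measure.map_map (by fun_prop) (by fun_prop)]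
  congr 1
  ext u
  simp

lemma isProbabilityMeasure_sphereUnif (hd : 0 < d) (η : ℝ) :
    IsProbabilityMeasure (sphereUnif d η) := by
  have : Nonempty (Fin d) := ⟨⟨0, hd⟩⟩
  have hnt : Nontrivial (Strat d) := inferInstance
  constructor
  rw [sphereUnif, Measure.map_apply (by fun_prop) .univ, preimage_univ, Measure.smul_apply,
    smul_eq_mul]
  exact ENNReal.inv_mul_cancel (Measure.measure_univ_ne_zero.2
    (volume : Measure (Strat d)).toSphere_ne_zero) (measure_ne_top _ _)

lemma ae_norm_sphereUnif (d : ℕ) (η : ℝ) : ∀ᵐ v ∂sphereUnif d η, ‖v‖ = |η| := by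
  rw [sphereUnif, ae_map_iff (by fun_prop) (measurableSet_eq_fun (by fun_prop) (by fun_prop))]
  exact Filter.Eventually.of_forall fun u => by simp [norm_smul]

/-- The uniform distribution on the unit sphere is the direction of the uniform distribution on
the unit ball. -/
lemma smul_sphereUnif_eq_map_ball (hd : 0 < d) :
    volume (Metric.ball (0 : Strat d) 1) • sphereUnif d 1 =
      Measure.map (fun x : Strat d => ‖x‖⁻¹ • x) (volume.restrict (Metric.ball (0 : Strat d) 1)) := by
  have h := map_normalize_withDensity hd ((Iio 1).indicator 1) (measurable_one.indicator measurableSet_Iio)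
  have h1 : (fun x : Strat d => (Iio (1 : ℝ)).indicator (1 : ℝ → ℝ≥0∞) ‖x‖) =
      (Metric.ball (0 : Strat d) 1).indicator 1 := by
    ext x
    by_cases hx : ‖x‖ < 1
    · rw [indicator_of_mem (by exact hx), indicator_of_mem (by simpa using hx)]; rfl
    · rw [indicator_of_notMem (by exact hx), indicator_of_notMem (by simpa using hx)]
  rw [h1, withDensity_indicator_one measurableSet_ball, lintegral_indicator_one measurableSet_ball] at h
  exact h.symm

/-- The symmetry is inherited from the ball, whose volume is finite and nonzero and can be
cancelled. -/
lemma map_neg_sphereUnif_one (hd : 0 < d) :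
    Measure.map (fun v => -v) (sphereUnif d 1) = sphereUnif d 1 := by
  have h0 : volume (Metric.ball (0 : Strat d) 1) ≠ 0 := (Metric.measure_ball_pos _ _ one_pos).ne'
  have h1 : volume (Metric.ball (0 : Strat d) 1) ≠ ⊤ := measure_ball_lt_top.ne
  have hneg : MeasurePreserving (fun x : Strat d => -x)
      (volume.restrict (Metric.ball (0 : Strat d) 1)) (volume.restrict (Metric.ball (0 : Strat d) 1)) := by
    have := (Measure.measurePreserving_neg (volume : Measure (Strat d))).restrict_preimage
      (s := Metric.ball (0 : Strat d) 1) measurableSet_ball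
    simpa using this
  have h2 : volume (Metric.ball (0 : Strat d) 1) • Measure.map (fun v => -v) (sphereUnif d 1) =
      volume (Metric.ball (0 : Strat d) 1) • sphereUnif d 1 := by
    rw [← Measure.map_smul, smul_sphereUnif_eq_map_ball hd, Measure.map_map (by fun_prop) (by fun_prop)]
    conv_rhs => rw [← hneg.map_eq, Measure.map_map (by fun_prop) (by fun_prop)]
    congr 1
    ext x
    simp
  calc _ = (volume (Metric.ball (0 : Strat d) 1))⁻¹ • volume (Metric.ball (0 : Strat d) 1) •
        Measure.map (fun v => -v) (sphereUnif d 1) := by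
        rw [smul_smul, ENNReal.inv_mul_cancel h0 h1, one_smul]
    _ = _ := by rw [h2, smul_smul, ENNReal.inv_mul_cancel h0 h1, one_smul]

/-- The standard Gaussian density on `ℝ^d`. -/
lemma stdGaussian_eq_withDensity (d : ℕ) :
    stdGaussian (Strat d) = volume.withDensity (fun x : Strat d =>
      ENNReal.ofReal (((2 * Real.pi) ^ ((d : ℝ) / 2))⁻¹ * Real.exp (-(‖x‖ ^ 2) / 2))) := by
  set c : ℝ := ((2 * Real.pi) ^ ((d : ℝ) / 2))⁻¹ with hc
  have hc0 : 0 < c := by positivity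
  have hint : ∀ t : Strat d, ∫ x : Strat d, ((c * Real.exp (-(‖x‖ ^ 2) / 2) : ℝ) : ℂ) *
      Complex.exp (inner ℝ x t * Complex.I) = Complex.exp (-‖t‖ ^ 2 / 2) := by
    intro t
    have h := GaussianFourier.integral_cexp_neg_mul_sq_norm_add (V := Strat d) (b := 1 / 2)
      (by norm_num) Complex.I t
    have h2 : ((Real.pi : ℂ) / (1 / 2)) ^ ((Module.finrank ℝ (Strat d) : ℂ) / 2) = ((c⁻¹ : ℝ) : ℂ) := by
      rw [hc, inv_inv, Complex.ofReal_cpow (by positivity)]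
      congr 1
      · push_cast; ring
      · simp
    rw [h2] at h
    have h3 : ∀ x : Strat d, ((c * Real.exp (-(‖x‖ ^ 2) / 2) : ℝ) : ℂ) *
      Complex.exp (inner ℝ x t * Complex.I) =
        (c : ℂ) * Complex.exp (-(1 / 2) * ‖x‖ ^ 2 + Complex.I * inner ℝ t x) := by
      intro x
      rw [Complex.exp_add, real_inner_comm]
      push_cast
      ring_nf
    simp_rw [h3]
    rw [integral_const_mul, h, ← mul_assoc, ← Complex.ofReal_mul, mul_inv_cancel₀ hc0.ne']
    simp only [Complex.I_sq, Complex.ofReal_one, one_mul]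
    congr 1
    ring
  -- The characteristic function at `0` is `1`, whereas a non-integrable density would have Bochner
  -- integral `0`.
  have hI : Integrable (fun x : Strat d => c * Real.exp (-(‖x‖ ^ 2) / 2)) := by
    by_contra hcon
    have h0 := hint 0
    simp only [inner_zero_right, Complex.ofReal_zero, zero_mul, Complex.exp_zero, mul_one] at h0
    rw [integral_complex_ofReal, integral_undef hcon] at h0
    simp at h0
  have hfin : IsFiniteMeasure (volume.withDensity (fun x : Strat d =>
      ENNReal.ofReal (c * Real.exp (-(‖x‖ ^ 2) / 2)))) :=
    isFiniteMeasure_withDensity_ofReal hI.2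
  refine Measure.ext_of_charFun ?_
  ext t
  rw [charFun_stdGaussian, charFun_apply, ← hint t,
    integral_withDensity_eq_integral_toReal_smul (by fun_prop) (by simp)]
  refine integral_congr_ae (Filter.Eventually.of_forall fun x => ?_)
  simp only
  rw [ENNReal.toReal_ofReal (by positivity)]
  simp

lemma integrable_sq_norm_stdGaussian (d : ℕ) :
    Integrable (fun x : Strat d => ‖x‖ ^ 2) (stdGaussian (Strat d)) :=
  (IsGaussian.memLp_two_id (μ := stdGaussian (Strat d))).integrable_norm_pow two_ne_zero

lemma integral_inner_sq_stdGaussian (e : Strat d) :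
    ∫ x, inner ℝ e x ^ 2 ∂stdGaussian (Strat d) = ‖e‖ ^ 2 := by
  have h := variance_dual_stdGaussian (E := Strat d) (innerSL ℝ e)
  rw [variance_eq_integral (by fun_prop), integral_strongDual_stdGaussian] at h
  simpa using h

lemma integral_sq_norm_stdGaussian (d : ℕ) :
    ∫ x, ‖x‖ ^ 2 ∂stdGaussian (Strat d) = d := by
  have h : ∀ x : Strat d, ‖x‖ ^ 2 =
      ∑ j, inner ℝ (EuclideanSpace.basisFun (Fin d) ℝ j) x ^ 2 := by
    intro x
    rw [EuclideanSpace.real_norm_sq_eq]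
    simp [EuclideanSpace.inner_single_left]
  simp_rw [h]
  rw [integral_finsetSum]
  · simp_rw [integral_inner_sq_stdGaussian]
    simp
  · intro j _
    refine (integrable_sq_norm_stdGaussian d).mono' (by fun_prop) (Filter.Eventually.of_forall fun x => ?_)
    rw [Real.norm_eq_abs, abs_pow]
    gcongr
    simpa using abs_real_inner_le_norm (EuclideanSpace.basisFun (Fin d) ℝ j) x

/-- Polar decomposition of the Gaussian second moment. -/
lemma integral_sq_norm_mul_stdGaussian (hd : 0 < d) {φ : Strat d → ℝ} (hφ : Measurable φ) :
    ∫ x, ‖x‖ ^ 2 * φ (‖x‖⁻¹ • x) ∂stdGaussian (Strat d) = d * ∫ v, φ v ∂sphereUnif d 1 := by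
  set c : ℝ := ((2 * Real.pi) ^ ((d : ℝ) / 2))⁻¹ with hc
  have hc0 : 0 < c := by positivity
  have hm : Measurable (fun x : Strat d => ‖x‖⁻¹ • x) := by fun_prop
  have hw : Measurable fun r : ℝ => ENNReal.ofReal (r ^ 2 * (c * Real.exp (-(r ^ 2) / 2))) := by
    fun_prop
  have h := map_normalize_withDensity hd _ hw
  have key : ∀ ψ : Strat d → ℝ, ∫ x, ‖x‖ ^ 2 * ψ x ∂stdGaussian (Strat d) =
      ∫ x, ψ x ∂(volume.withDensity fun x : Strat d =>
        ENNReal.ofReal (‖x‖ ^ 2 * (c * Real.exp (-(‖x‖ ^ 2) / 2)))) := by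
    intro ψ
    rw [stdGaussian_eq_withDensity, integral_withDensity_eq_integral_toReal_smul (by fun_prop) (by simp),
      integral_withDensity_eq_integral_toReal_smul (by fun_prop)
        (Filter.Eventually.of_forall fun _ => ENNReal.ofReal_lt_top)]
    refine integral_congr_ae (Filter.Eventually.of_forall fun x => ?_)
    simp only
    rw [ENNReal.toReal_ofReal (by positivity), ENNReal.toReal_ofReal (by positivity)]
    simp only [smul_eq_mul, ← hc]
    ring
  have key2 : ∀ ψ : Strat d → ℝ, Measurable ψ → ∫ x, ‖x‖ ^ 2 * ψ (‖x‖⁻¹ • x) ∂stdGaussian (Strat d) =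
      (∫⁻ x : Strat d, ENNReal.ofReal (‖x‖ ^ 2 * (c * Real.exp (-(‖x‖ ^ 2) / 2)))).toReal *
        ∫ v, ψ v ∂sphereUnif d 1 := by
    intro ψ hψ
    rw [key, ← integral_map (f := ψ) hm.aemeasurable hψ.aestronglyMeasurable, h, integral_smul_measure,
      smul_eq_mul]
  have := isProbabilityMeasure_sphereUnif hd 1
  have h1 := key2 (fun _ => 1) measurable_const
  simp only [mul_one, integral_sq_norm_stdGaussian, integral_const, probReal_univ, smul_eq_mul] at h1
  rw [key2 φ hφ, ← h1]

/-- The function `⟨e, ·⟩²` is homogeneous of degree two, so polar decomposition makes `d` times its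
spherical mean equal to its Gaussian mean `‖e‖²`. -/
lemma integral_inner_sq_sphereUnif (hd : 0 < d) (e : Strat d) :
    ∫ v, inner ℝ e v ^ 2 ∂sphereUnif d 1 = ‖e‖ ^ 2 / d := by
  have h := integral_sq_norm_mul_stdGaussian hd (φ := fun v => inner ℝ e v ^ 2) (by fun_prop)
  have hd' : (d : ℝ) ≠ 0 := by positivity
  rw [eq_div_iff hd', mul_comm, ← h, ← integral_inner_sq_stdGaussian]
  refine integral_congr_ae (Filter.Eventually.of_forall fun x => ?_)
  simp only
  rw [inner_smul_right]
  by_cases hx : x = 0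
  · simp [hx]
  · have : ‖x‖ ≠ 0 := by simpa using hx
    field_simp

end Sphere

/-! ### Second moments of odd Lipschitz functions, Gaussian and spherical -/

section GaussianPoincare

variable {d : ℕ}

/-- The characteristic function of a pair of independent standard Gaussians depends only on the
Euclidean norm of its argument, which a rotation preserves. The passage through `WithLp 2` supplies
the inner product that the plain product lacks. -/
lemma map_rotation_stdGaussian_prod (θ : ℝ) :
    Measure.map (fun p : Strat d × Strat d =>
        (Real.cos θ • p.1 + Real.sin θ • p.2, -Real.sin θ • p.1 + Real.cos θ • p.2))
      ((stdGaussian (Strat d)).prod (stdGaussian (Strat d))) =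
      (stdGaussian (Strat d)).prod (stdGaussian (Strat d)) := by
  set γ := stdGaussian (Strat d)
  set r : Strat d × Strat d → Strat d × Strat d := fun p =>
        (Real.cos θ • p.1 + Real.sin θ • p.2, -Real.sin θ • p.1 + Real.cos θ • p.2) with hr
  have hrm : Measurable r := by fun_prop
  have hlp : Measurable (WithLp.toLp 2 : Strat d × Strat d → WithLp 2 (Strat d × Strat d)) := by
    fun_prop
  have hch : ∀ t, charFun ((γ.prod γ).map (WithLp.toLp 2)) t =
      Complex.exp (-(‖t.fst‖ ^ 2 + ‖t.snd‖ ^ 2 : ℝ) / 2) := by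
    intro t
    rw [charFun_prod, charFun_stdGaussian, charFun_stdGaussian, ← Complex.exp_add]
    congr 1
    push_cast
    simp
    ring
  have hmain : ((γ.prod γ).map r).map (WithLp.toLp 2) = (γ.prod γ).map (WithLp.toLp 2) := by
    have : IsProbabilityMeasure ((γ.prod γ).map r) := Measure.isProbabilityMeasure_map hrm.aemeasurable
    have : IsProbabilityMeasure (((γ.prod γ).map r).map (WithLp.toLp 2)) :=
      Measure.isProbabilityMeasure_map hlp.aemeasurable
    have : IsProbabilityMeasure ((γ.prod γ).map (WithLp.toLp 2)) :=
      Measure.isProbabilityMeasure_map hlp.aemeasurable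
    refine Measure.ext_of_charFun ?_
    ext t
    -- The transposed rotation applied to `t`: moving the rotation across the inner product reduces
    -- the claim to `‖s‖ = ‖t‖`.
    let s : WithLp 2 (Strat d × Strat d) := WithLp.toLp 2
      (Real.cos θ • t.fst - Real.sin θ • t.snd, Real.sin θ • t.fst + Real.cos θ • t.snd)
    have h1 : charFun (((γ.prod γ).map r).map (WithLp.toLp 2)) t =
        charFun ((γ.prod γ).map (WithLp.toLp 2)) s := by
      rw [charFun_apply, charFun_apply, Measure.map_map hlp hrm, integral_map (by fun_prop) (by fun_prop),
        integral_map (by fun_prop) (by fun_prop)]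
      refine integral_congr_ae (Filter.Eventually.of_forall fun p => ?_)
      simp only [Function.comp]
      congr 3
      simp only [WithLp.prod_inner_apply, hr, s, inner_add_left, inner_add_right, inner_sub_right,
        inner_smul_left, inner_smul_right]
      simp
      ring
    rw [h1, hch, hch]
    congr 4
    change ‖Real.cos θ • t.fst - Real.sin θ • t.snd‖ ^ 2 +
      ‖Real.sin θ • t.fst + Real.cos θ • t.snd‖ ^ 2 = _
    rw [norm_sub_sq_real, norm_add_sq_real]
    simp only [norm_smul, inner_smul_left, inner_smul_right, mul_pow, Real.norm_eq_abs, sq_abs]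
    simp
    linear_combination (‖t.fst‖ ^ 2 + ‖t.snd‖ ^ 2) * Real.sin_sq_add_cos_sq θ
  have h2 := congrArg (Measure.map (WithLp.ofLp : WithLp 2 (Strat d × Strat d) → Strat d × Strat d)) hmain
  have hof : Measurable (WithLp.ofLp : WithLp 2 (Strat d × Strat d) → Strat d × Strat d) := by
    fun_prop
  rw [Measure.map_map hof hlp, Measure.map_map hof hlp] at h2
  simpa [Function.comp_def] using h2

lemma stdGaussian_absolutelyContinuous : stdGaussian (Strat d) ≪ volume := by
  rw [stdGaussian_eq_withDensity]
  exact withDensity_absolutelyContinuous _ _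

/-- A Poincaré-type inequality: odd `K`-Lipschitz functions have Gaussian second moment at most
`π² K² / 4`. -/
lemma integral_sq_stdGaussian_le_of_odd {F : Strat d → ℝ} {K : ℝ≥0} (hF : LipschitzWith K F)
    (hodd : ∀ x, F (-x) = -F x) :
    ∫ x, F x ^ 2 ∂stdGaussian (Strat d) ≤ Real.pi ^ 2 / 4 * K ^ 2 := by
  set γ := stdGaussian (Strat d) with hγ
  have hFc : Continuous F := hF.continuous
  have hF0 : F 0 = 0 := by
    have := hodd 0
    rw [neg_zero] at this
    linarith
  have hFb : ∀ x y, |F x - F y| ≤ K * ‖x - y‖ := fun x y => by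
    simpa [Real.norm_eq_abs] using hF.norm_sub_le x y
  have hI1 : Integrable (fun p : Strat d × Strat d => ‖p.1‖ ^ 2) (γ.prod γ) :=
    (integrable_sq_norm_stdGaussian d).comp_fst γ
  have hI2 : Integrable (fun p : Strat d × Strat d => ‖p.2‖ ^ 2) (γ.prod γ) :=
    (integrable_sq_norm_stdGaussian d).comp_snd γ
  have hI : Integrable (fun p : Strat d × Strat d => 2 * (K : ℝ) ^ 2 * (‖p.1‖ ^ 2 + ‖p.2‖ ^ 2))
      (γ.prod γ) := (hI1.add hI2).const_mul _
  -- one step of the rotation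
  let a : ℝ → ℝ := fun δ => ∫ p : Strat d × Strat d,
    (F (Real.cos δ • p.1 + Real.sin δ • p.2) - F p.1) ^ 2 ∂(γ.prod γ)
  have hcos : ∀ δ : ℝ, |Real.cos δ - 1| ≤ |δ| := fun δ => by
    simpa using Real.abs_cos_sub_cos_le δ 0
  have hsin : ∀ δ : ℝ, |Real.sin δ| ≤ |δ| := fun δ => Real.abs_sin_le_abs
  have hstep : ∀ (δ : ℝ) (p : Strat d × Strat d),
      (F (Real.cos δ • p.1 + Real.sin δ • p.2) - F p.1) ^ 2 ≤
        δ ^ 2 * (2 * (K : ℝ) ^ 2 * (‖p.1‖ ^ 2 + ‖p.2‖ ^ 2)) := by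
    intro δ p
    have h1 : |F (Real.cos δ • p.1 + Real.sin δ • p.2) - F p.1| ≤ K * (|δ| * (‖p.1‖ + ‖p.2‖)) := by
      refine (hFb _ _).trans ?_
      gcongr
      have : Real.cos δ • p.1 + Real.sin δ • p.2 - p.1 = (Real.cos δ - 1) • p.1 + Real.sin δ • p.2 := by
        module
      rw [this]
      refine (norm_add_le _ _).trans ?_
      rw [norm_smul, norm_smul, mul_add, Real.norm_eq_abs, Real.norm_eq_abs]
      exact add_le_add (mul_le_mul_of_nonneg_right (hcos δ) (norm_nonneg _))
        (mul_le_mul_of_nonneg_right (hsin δ) (norm_nonneg _))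
    calc _ = |F (Real.cos δ • p.1 + Real.sin δ • p.2) - F p.1| ^ 2 := (sq_abs _).symm
      _ ≤ (K * (|δ| * (‖p.1‖ + ‖p.2‖))) ^ 2 := by gcongr
      _ = δ ^ 2 * (K ^ 2 * (‖p.1‖ + ‖p.2‖) ^ 2) := by rw [mul_pow, mul_pow, sq_abs]; ring
      _ ≤ _ := by
        rw [mul_comm (2 : ℝ), mul_assoc ((K : ℝ) ^ 2)]
        gcongr
        nlinarith [sq_nonneg (‖p.1‖ - ‖p.2‖)]
  have hstepI : ∀ δ : ℝ, Integrable (fun p : Strat d × Strat d =>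
      (F (Real.cos δ • p.1 + Real.sin δ • p.2) - F p.1) ^ 2) (γ.prod γ) := fun δ =>
    (hI.const_mul (δ ^ 2)).mono' (by fun_prop) (Filter.Eventually.of_forall fun p => by
      rw [Real.norm_of_nonneg (sq_nonneg _)]; exact hstep δ p)
  -- telescoping along the path from `x` to `-x`
  have htel : ∀ m : ℕ, 0 < m → 4 * ∫ x, F x ^ 2 ∂γ ≤ (m : ℝ) ^ 2 * a (Real.pi / m) := by
    intro m hm
    set δ := Real.pi / m with hδ
    have hm' : (m : ℝ) ≠ 0 := by positivity
    let r : ℝ → Strat d × Strat d → Strat d × Strat d := fun θ p =>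
      (Real.cos θ • p.1 + Real.sin θ • p.2, -Real.sin θ • p.1 + Real.cos θ • p.2)
    let X : ℕ → Strat d × Strat d → Strat d := fun k p => (r (k * δ) p).1
    have hX : ∀ k p, X (k + 1) p = Real.cos δ • (r (k * δ) p).1 + Real.sin δ • (r (k * δ) p).2 := by
      intro k p
      simp only [X, r]
      have : ((k + 1 : ℕ) : ℝ) * δ = k * δ + δ := by push_cast; ring
      rw [this, Real.cos_add, Real.sin_add]
      module
    have hrm : ∀ θ, Measurable (r θ) := fun θ => by fun_prop
    have hmeas : ∀ δ : ℝ, Measurable (fun p : Strat d × Strat d =>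
        (F (Real.cos δ • p.1 + Real.sin δ • p.2) - F p.1) ^ 2) := fun δ => by fun_prop
    have hk : ∀ k, ∫ p, (F (X (k + 1) p) - F (X k p)) ^ 2 ∂(γ.prod γ) = a δ := by
      intro k
      simp_rw [hX]
      have := integral_map (μ := γ.prod γ) (hrm (k * δ)).aemeasurable
        (hmeas δ).aestronglyMeasurable
      rw [map_rotation_stdGaussian_prod] at this
      exact this.symm
    have hkI : ∀ k, Integrable (fun p => (F (X (k + 1) p) - F (X k p)) ^ 2) (γ.prod γ) := by
      intro k
      simp_rw [hX]
      have h := hstepI δ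
      rw [← map_rotation_stdGaussian_prod (k * δ)] at h
      exact h.comp_measurable (hrm _)
    -- The path starts at `x` and after `m` steps of angle `π/m` ends at `-x`, so by oddness the
    -- increments of `F` sum to `-2 F(x)`. Cauchy–Schwarz over the `m` steps gives the bound; each
    -- increment has the same law by rotation invariance.
    have hpt : ∀ p : Strat d × Strat d, 4 * F p.1 ^ 2 ≤
        m * ∑ k ∈ Finset.range m, (F (X (k + 1) p) - F (X k p)) ^ 2 := by
      intro p
      have h1 : ∑ k ∈ Finset.range m, (F (X (k + 1) p) - F (X k p)) = -2 * F p.1 := by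
        rw [Finset.sum_range_sub (fun k => F (X k p))]
        have : (m : ℝ) * δ = Real.pi := by rw [hδ]; field_simp
        simp only [X, r, this]
        simp [hodd]
        ring
      have h2 := sq_sum_le_card_mul_sum_sq (s := Finset.range m)
        (f := fun k => F (X (k + 1) p) - F (X k p))
      rw [h1, Finset.card_range] at h2
      linarith
    have hfst : ∫ x, F x ^ 2 ∂γ = ∫ p : Strat d × Strat d, F p.1 ^ 2 ∂(γ.prod γ) := by
      rw [integral_fun_fst (fun x => F x ^ 2)]; simp
    rw [hfst, ← integral_const_mul]
    calc _ ≤ ∫ p, m * ∑ k ∈ Finset.range m, (F (X (k + 1) p) - F (X k p)) ^ 2 ∂(γ.prod γ) := by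
          refine integral_mono_of_nonneg (Filter.Eventually.of_forall fun p => by positivity) ?_
            (Filter.Eventually.of_forall hpt)
          exact (integrable_finsetSum _ fun k _ => hkI k).const_mul _
      _ = m * ∑ k ∈ Finset.range m, a δ := by
          rw [integral_const_mul, integral_finsetSum _ fun k _ => hkI k]
          simp_rw [hk]
      _ = _ := by simp; ring
  -- the limit of small angles
  let b : Strat d × Strat d → ℝ := fun p => (fderiv ℝ F p.1 p.2) ^ 2
  have hlim : Filter.Tendsto (fun m : ℕ => ∫ p : Strat d × Strat d,
      ((Real.pi / m)⁻¹ * (F (Real.cos (Real.pi / m) • p.1 + Real.sin (Real.pi / m) • p.2) - F p.1)) ^ 2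
        ∂(γ.prod γ)) Filter.atTop (𝓝 (∫ p, b p ∂(γ.prod γ))) := by
    refine tendsto_integral_of_dominated_convergence _ (fun m => by fun_prop) hI ?_ ?_
    · intro m
      refine Filter.Eventually.of_forall fun p => ?_
      rw [Real.norm_of_nonneg (sq_nonneg _), mul_pow]
      -- This covers `m = 0`, where division by zero gives angle `0`.
      by_cases h0 : Real.pi / m = 0
      · rw [h0]; simp; positivity
      · rw [inv_pow, inv_mul_le_iff₀ (by positivity)]
        exact hstep _ p
    -- Rademacher's theorem holds Gaussian-almost everywhere by absolute continuity. At such points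
    -- the rescaled increments converge to `DF(x) y`, because the rotation moves `x` with initial
    -- velocity `y`.
    · have hae : ∀ᵐ x ∂γ, DifferentiableAt ℝ F x :=
        stdGaussian_absolutelyContinuous.ae_le hF.ae_differentiableAt_of_real
      have hae2 : ∀ᵐ p : Strat d × Strat d ∂(γ.prod γ), DifferentiableAt ℝ F p.1 :=
        Measure.quasiMeasurePreserving_fst.ae hae
      filter_upwards [hae2] with p hp
      have hcurve : HasDerivAt (fun δ : ℝ => Real.cos δ • p.1 + Real.sin δ • p.2) p.2 0 := by
        have h := ((Real.hasDerivAt_cos 0).smul_const p.1).fun_add ((Real.hasDerivAt_sin 0).smul_const p.2)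
        simpa using h
      have hp' : HasFDerivAt F (fderiv ℝ F p.1) (Real.cos 0 • p.1 + Real.sin 0 • p.2) := by
        simpa using hp.hasFDerivAt
      have hcomp := hp'.comp_hasDerivAt (0 : ℝ) hcurve
      have hslope := hcomp.tendsto_slope_zero
      have hseq : Filter.Tendsto (fun m : ℕ => Real.pi / m) Filter.atTop (𝓝[≠] 0) := by
        refine tendsto_nhdsWithin_iff.2 ⟨tendsto_const_div_atTop_nhds_zero_nat _, ?_⟩
        filter_upwards [Filter.eventually_gt_atTop 0] with m hm
        have : (0 : ℝ) < m := by exact_mod_cast hm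
        exact (by positivity : Real.pi / (m : ℝ) ≠ 0)
      have := (hslope.comp hseq).pow 2
      simpa [Function.comp_def, b] using this
  have hbI : ∫ p, b p ∂(γ.prod γ) ≤ K ^ 2 := by
    have hbm : Measurable b := by
      have h1 : Measurable fun p : Strat d × Strat d => (fderiv ℝ F p.1, p.2) :=
        ((measurable_fderiv ℝ F).comp measurable_fst).prodMk measurable_snd
      have h2 : Continuous fun q : (Strat d →L[ℝ] ℝ) × Strat d => q.1 q.2 :=
        isBoundedBilinearMap_apply.continuous
      exact (h2.measurable.comp h1).pow_const 2
    have hfd : ∀ x, ‖fderiv ℝ F x‖ ≤ K := fun x => norm_fderiv_le_of_lipschitz ℝ hF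
    have hble : ∀ p, b p ≤ 2 * (K : ℝ) ^ 2 * (‖p.1‖ ^ 2 + ‖p.2‖ ^ 2) := by
      intro p
      have h1 : |fderiv ℝ F p.1 p.2| ≤ K * ‖p.2‖ :=
        ((fderiv ℝ F p.1).le_opNorm p.2).trans (by gcongr; exact hfd _)
      calc b p = |fderiv ℝ F p.1 p.2| ^ 2 := (sq_abs _).symm
        _ ≤ (K * ‖p.2‖) ^ 2 := by gcongr
        _ ≤ _ := by nlinarith [mul_nonneg (sq_nonneg (K : ℝ)) (sq_nonneg ‖p.1‖),
            mul_nonneg (sq_nonneg (K : ℝ)) (sq_nonneg ‖p.2‖)]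
    have hbInt : Integrable b (γ.prod γ) := hI.mono' hbm.aestronglyMeasurable
      (Filter.Eventually.of_forall fun p => by
        rw [Real.norm_of_nonneg (sq_nonneg _)]; exact hble p)
    rw [integral_prod _ hbInt]
    -- For fixed `x`, `DF(x) y` is a centered Gaussian variable of variance `‖DF(x)‖²`. Integrating
    -- over the independent copy first is what keeps the bound free of the dimension.
    have hin : ∀ x, ∫ y, b (x, y) ∂γ ≤ K ^ 2 := by
      intro x
      have h := variance_dual_stdGaussian (E := Strat d) (fderiv ℝ F x)
      rw [variance_eq_integral (by fun_prop), integral_strongDual_stdGaussian] at h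
      simp only [sub_zero] at h
      simp only [b]
      rw [h]
      gcongr
      exact hfd x
    calc _ ≤ ∫ _x : Strat d, (K : ℝ) ^ 2 ∂γ := integral_mono_of_nonneg
          (Filter.Eventually.of_forall fun x => integral_nonneg fun y => sq_nonneg _)
          (integrable_const _) (Filter.Eventually.of_forall hin)
      _ = _ := by simp
  have hfin : 4 * ∫ x, F x ^ 2 ∂γ ≤ Real.pi ^ 2 * ∫ p, b p ∂(γ.prod γ) := by
    refine ge_of_tendsto (hlim.const_mul (Real.pi ^ 2)) ?_
    filter_upwards [Filter.eventually_gt_atTop 0] with m hm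
    refine (htel m hm).trans (le_of_eq ?_)
    have hm' : (m : ℝ) ≠ 0 := by positivity
    simp_rw [mul_pow]
    rw [integral_const_mul]
    have : Real.pi ≠ 0 := Real.pi_ne_zero
    simp only [a]
    field_simp
  nlinarith [Real.pi_pos, sq_nonneg Real.pi]

/-- An odd `K`-Lipschitz function on the unit sphere of `ℝ^d` has second moment `O(K²/d)`. -/
lemma integral_sq_sphereUnif_le_of_odd (hd : 0 < d) {g : Strat d → ℝ} {K : ℝ≥0}
    (hg : LipschitzWith K g) (hodd : ∀ x, g (-x) = -g x) :
    ∫ v, g v ^ 2 ∂sphereUnif d 1 ≤ 9 * Real.pi ^ 2 / 4 * K ^ 2 / d := by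
  -- The 1-homogeneous extension of `g`: its Gaussian second moment is `d` times the spherical one.
  -- Its Lipschitz constant `3K` (one `K` from the norm, two from the direction) accounts for the
  -- factor `9`.
  let F : Strat d → ℝ := fun x => ‖x‖ * g (‖x‖⁻¹ • x)
  have hgb : ∀ x y, |g x - g y| ≤ K * ‖x - y‖ := fun x y => by
    simpa [Real.norm_eq_abs] using hg.norm_sub_le x y
  have hg0 : g 0 = 0 := by
    have := hodd 0
    rw [neg_zero] at this
    linarith
  have hsup : ∀ x : Strat d, |g (‖x‖⁻¹ • x)| ≤ K := by
    intro x
    have h := hgb (‖x‖⁻¹ • x) 0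
    rw [hg0, sub_zero, sub_zero, norm_smul, norm_inv, norm_norm] at h
    refine h.trans ?_
    refine mul_le_of_le_one_right K.2 ?_
    exact inv_mul_le_one
  have hFlip : LipschitzWith (3 * K) F := by
    refine LipschitzWith.of_dist_le_mul fun x y => ?_
    rw [Real.dist_eq, dist_eq_norm]
    have h1 : F x - F y = (‖x‖ - ‖y‖) * g (‖x‖⁻¹ • x) + ‖y‖ * (g (‖x‖⁻¹ • x) - g (‖y‖⁻¹ • y)) := by
      simp only [F]; ring
    have h2 : ‖y‖ * ‖‖x‖⁻¹ • x - ‖y‖⁻¹ • y‖ ≤ 2 * ‖x - y‖ := by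
      by_cases hy : y = 0
      · simp [hy]
      by_cases hx : x = 0
      · have : ‖y‖ ≠ 0 := by simpa using hy
        rw [hx]
        simp only [smul_zero, zero_sub, norm_neg, norm_smul, norm_inv, norm_norm]
        rw [inv_mul_cancel₀ this]
        linarith [norm_nonneg y]
      have hx' : ‖x‖ ≠ 0 := by simpa using hx
      have hy' : ‖y‖ ≠ 0 := by simpa using hy
      have e : ‖y‖ • (‖x‖⁻¹ • x - ‖y‖⁻¹ • y) = ((‖y‖ - ‖x‖) * ‖x‖⁻¹) • x + (x - y) := by
        rw [smul_sub, smul_smul, smul_smul, mul_inv_cancel₀ hy', sub_mul, mul_inv_cancel₀ hx']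
        module
      calc _ = ‖‖y‖ • (‖x‖⁻¹ • x - ‖y‖⁻¹ • y)‖ := by rw [norm_smul, norm_norm]
        _ ≤ |‖y‖ - ‖x‖| * ‖x‖⁻¹ * ‖x‖ + ‖x - y‖ := by
          rw [e]
          refine (norm_add_le _ _).trans ?_
          rw [norm_smul, norm_mul, norm_inv, norm_norm, Real.norm_eq_abs]
        _ = |‖y‖ - ‖x‖| + ‖x - y‖ := by rw [mul_assoc, inv_mul_cancel₀ hx', mul_one]
        _ ≤ _ := by
          have := abs_norm_sub_norm_le y x
          rw [norm_sub_rev] at this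
          linarith
    rw [h1]
    calc _ ≤ |‖x‖ - ‖y‖| * |g (‖x‖⁻¹ • x)| + ‖y‖ * |g (‖x‖⁻¹ • x) - g (‖y‖⁻¹ • y)| := by
          refine (abs_add_le _ _).trans ?_
          rw [abs_mul, abs_mul, abs_norm]
      _ ≤ ‖x - y‖ * K + ‖y‖ * (K * ‖‖x‖⁻¹ • x - ‖y‖⁻¹ • y‖) := by
          gcongr
          exacts [abs_norm_sub_norm_le x y, hsup x, hgb _ _]
      _ = ‖x - y‖ * K + K * (‖y‖ * ‖‖x‖⁻¹ • x - ‖y‖⁻¹ • y‖) := by ring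
      _ ≤ ‖x - y‖ * K + K * (2 * ‖x - y‖) := by gcongr
      _ = _ := by push_cast; ring
  have hFodd : ∀ x, F (-x) = -F x := fun x => by simp [F, hodd]
  have h := integral_sq_stdGaussian_le_of_odd hFlip hFodd
  have h2 := integral_sq_norm_mul_stdGaussian hd (φ := fun v => g v ^ 2)
    (hg.continuous.measurable.pow_const 2)
  simp only [F, mul_pow] at h
  rw [h2] at h
  rw [le_div_iff₀ (by positivity)]
  push_cast at h
  linarith

end GaussianPoincare

/-! ### Divergence theorem on the ball and the gradient of a randomized smoothing -/

section SmoothingGradient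

variable {d : ℕ}

lemma setIntegral_normalize (hd : 0 < d) {s : Set ℝ} (hs : MeasurableSet s) {ψ : Strat d → ℝ}
    (hψ : Measurable ψ) :
    ∫ x in {x : Strat d | ‖x‖ ∈ s}, ψ (‖x‖⁻¹ • x) =
      (volume : Measure (Strat d)).real {x | ‖x‖ ∈ s} * ∫ v, ψ v ∂sphereUnif d 1 := by
  have hA : MeasurableSet {x : Strat d | ‖x‖ ∈ s} := measurable_norm hs
  have h := map_normalize_withDensity hd (s.indicator 1) (measurable_one.indicator hs)
  have h1 : (fun x : Strat d => s.indicator (1 : ℝ → ℝ≥0∞) ‖x‖) =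
      {x : Strat d | ‖x‖ ∈ s}.indicator 1 := rfl
  rw [h1, withDensity_indicator_one hA, lintegral_indicator_one hA] at h
  rw [← integral_map (f := ψ) (φ := fun x : Strat d => ‖x‖⁻¹ • x)
    (by fun_prop) hψ.aestronglyMeasurable, h, integral_smul_measure]
  rfl

lemma hasDerivAt_norm_line {E : Type*} [NormedAddCommGroup E] [InnerProductSpace ℝ E] {u : E}
    (hu : u ≠ 0) (w : E) :
    HasDerivAt (fun t : ℝ => ‖u + t • w‖) (inner ℝ (‖u‖⁻¹ • u) w) 0 := by
  have h1 : HasDerivAt (fun t : ℝ => u + t • w) w 0 := by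
    simpa using ((hasDerivAt_id (0 : ℝ)).smul_const w).const_add u
  have h2 := h1.norm_sq
  have hne : ‖u + (0 : ℝ) • w‖ ^ 2 ≠ 0 := by simpa using hu
  have h3 := h2.sqrt hne
  have hu' : ‖u‖ ≠ 0 := by simpa using hu
  simp only [Real.sqrt_sq (norm_nonneg _), zero_smul, add_zero] at h3
  convert h3 using 1
  rw [inner_smul_left]
  simp
  field_simp

/-- The radial cutoff function equal to `1` on the unit ball and to `0` outside the ball of
radius `1 + ε`. -/
noncomputable def cutoff (d : ℕ) (ε : ℝ) (u : Strat d) : ℝ := max 0 (min 1 (ε⁻¹ * (1 + ε - ‖u‖)))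

lemma cutoff_nonneg (ε : ℝ) (u : Strat d) : 0 ≤ cutoff d ε u := le_max_left _ _

lemma cutoff_le_one (ε : ℝ) (u : Strat d) : cutoff d ε u ≤ 1 :=
  max_le zero_le_one (min_le_left _ _)

lemma cutoff_eq_one {ε : ℝ} (hε : 0 < ε) {u : Strat d} (hu : ‖u‖ ≤ 1) : cutoff d ε u = 1 := by
  have h : 1 ≤ ε⁻¹ * (1 + ε - ‖u‖) := by
    rw [le_inv_mul_iff₀ hε]
    linarith
  rw [cutoff, min_eq_left h, max_eq_right zero_le_one]

lemma cutoff_eq_zero {ε : ℝ} (hε : 0 < ε) {u : Strat d} (hu : 1 + ε ≤ ‖u‖) : cutoff d ε u = 0 := by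
  have h : ε⁻¹ * (1 + ε - ‖u‖) ≤ 0 :=
    mul_nonpos_of_nonneg_of_nonpos (by positivity) (by linarith)
  rw [cutoff, max_eq_left ((min_le_right _ _).trans h)]

lemma cutoff_eq_of_mem {ε : ℝ} (hε : 0 < ε) {u : Strat d} (h1 : 1 ≤ ‖u‖) (h2 : ‖u‖ ≤ 1 + ε) :
    cutoff d ε u = ε⁻¹ * (1 + ε - ‖u‖) := by
  have h : ε⁻¹ * (1 + ε - ‖u‖) ≤ 1 := by
    rw [inv_mul_le_iff₀ hε]
    linarith
  rw [cutoff, min_eq_right h, max_eq_right (mul_nonneg (by positivity) (by linarith))]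

lemma lipschitzWith_cutoff (ε : ℝ) : LipschitzWith (Real.toNNReal |ε⁻¹|) (cutoff d ε) := by
  have h1 : LipschitzWith (Real.toNNReal |ε⁻¹|) fun u : Strat d => ε⁻¹ * (1 + ε - ‖u‖) := by
    refine LipschitzWith.of_dist_le_mul fun x y => ?_
    rw [Real.dist_eq, dist_eq_norm, Real.coe_toNNReal _ (abs_nonneg _), ← mul_sub, abs_mul]
    gcongr
    have : 1 + ε - ‖x‖ - (1 + ε - ‖y‖) = ‖y‖ - ‖x‖ := by ring
    rw [this, norm_sub_rev]
    exact abs_norm_sub_norm_le y x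
  exact (h1.const_min 1).const_max 0

lemma hasCompactSupport_cutoff {ε : ℝ} (hε : 0 < ε) : HasCompactSupport (cutoff d ε) := by
  refine HasCompactSupport.intro (isCompact_closedBall (0 : Strat d) (1 + ε)) fun u hu => ?_
  refine cutoff_eq_zero hε ?_
  simp only [Metric.mem_closedBall, dist_zero_right, not_le] at hu
  exact hu.le

/-- The cutoff has kinks only on two spheres, which are null sets. Its derivative is the radial unit
vector scaled by `1/ε` on a thin shell, which becomes surface integration as `ε → 0`. -/
lemma lineDeriv_cutoff_ae {ε : ℝ} (hε : 0 < ε) (e : Strat d) :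
    ∀ᵐ u : Strat d, lineDeriv ℝ (cutoff d ε) u (-e) =
      {u : Strat d | ‖u‖ ∈ Ioo 1 (1 + ε)}.indicator
        (fun u => ε⁻¹ * inner ℝ (‖u‖⁻¹ • u) e) u := by
  have hs1 : ∀ᵐ u : Strat d, u ∉ Metric.sphere (0 : Strat d) 1 :=
    measure_eq_zero_iff_ae_notMem.1 (Measure.addHaar_sphere_of_ne_zero _ _ one_ne_zero)
  have hs2 : ∀ᵐ u : Strat d, u ∉ Metric.sphere (0 : Strat d) (1 + ε) :=
    measure_eq_zero_iff_ae_notMem.1 (Measure.addHaar_sphere_of_ne_zero _ _ (by positivity))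
  filter_upwards [hs1, hs2] with u h1 h2
  simp only [mem_sphere_iff_norm, sub_zero] at h1 h2
  have hcont : Filter.Tendsto (fun t : ℝ => ‖u + t • (-e)‖) (𝓝 0) (𝓝 ‖u‖) := by
    have : Continuous fun t : ℝ => ‖u + t • (-e)‖ := by fun_prop
    simpa using this.tendsto 0
  by_cases hin : ‖u‖ ∈ Ioo 1 (1 + ε)
  · rw [indicator_of_mem (by exact hin)]
    have hu : u ≠ 0 := by
      rintro rfl
      simp at hin
      linarith [hin.1]
    have hd := (((hasDerivAt_norm_line hu (-e)).const_sub (1 + ε)).const_mul ε⁻¹)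
    have he : (fun t : ℝ => cutoff d ε (u + t • (-e))) =ᶠ[𝓝 0]
        fun t => ε⁻¹ * (1 + ε - ‖u + t • (-e)‖) := by
      filter_upwards [hcont.eventually (Ioo_mem_nhds hin.1 hin.2)] with t ht
      exact cutoff_eq_of_mem hε ht.1.le ht.2.le
    rw [lineDeriv, he.deriv_eq, hd.deriv, inner_neg_right]
    ring
  · rw [indicator_of_notMem (by exact hin)]
    rcases lt_or_gt_of_ne h1 with h | h
    · have he : (fun t : ℝ => cutoff d ε (u + t • (-e))) =ᶠ[𝓝 0] fun _ => 1 := by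
        filter_upwards [hcont.eventually (gt_mem_nhds h)] with t ht
        exact cutoff_eq_one hε ht.le
      rw [lineDeriv, he.deriv_eq, deriv_const]
    · have h3 : 1 + ε < ‖u‖ := lt_of_le_of_ne (not_lt.1 fun h' => hin ⟨h, h'⟩) (Ne.symm h2)
      have he : (fun t : ℝ => cutoff d ε (u + t • (-e))) =ᶠ[𝓝 0] fun _ => 0 := by
        filter_upwards [hcont.eventually (lt_mem_nhds h3)] with t ht
        exact cutoff_eq_zero hε ht.le
      rw [lineDeriv, he.deriv_eq, deriv_const]

lemma volume_real_annulus {ε : ℝ} (hε : 0 < ε) :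
    (volume : Measure (Strat d)).real {u | ‖u‖ ∈ Ioo 1 (1 + ε)} =
      ((1 + ε) ^ d - 1) * (volume : Measure (Strat d)).real (Metric.closedBall 0 1) := by
  have h : {u : Strat d | ‖u‖ ∈ Ioo 1 (1 + ε)} =
      Metric.ball 0 (1 + ε) \ Metric.closedBall 0 1 := by
    ext u
    simp [and_comm]
  have hsub : Metric.closedBall (0 : Strat d) 1 ⊆ Metric.ball 0 (1 + ε) :=
    Metric.closedBall_subset_ball (by linarith)
  rw [h, measureReal_sdiff hsub measurableSet_closedBall, Measure.real, Measure.real,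
    Measure.addHaar_ball_of_pos _ _ (by positivity), Measure.addHaar_unitClosedBall_eq_addHaar_unitBall,
    ENNReal.toReal_mul, ENNReal.toReal_ofReal (by positivity), finrank_euclideanSpace_fin]
  ring

/-- The divergence theorem for Lipschitz functions on the unit ball. -/
lemma integral_lineDeriv_closedBall (hd : 0 < d) {f : Strat d → ℝ} {K : ℝ≥0}
    (hf : LipschitzWith K f) (e : Strat d) :
    ∫ u in Metric.closedBall (0 : Strat d) 1, lineDeriv ℝ f u e =
      (volume : Measure (Strat d)).real (Metric.closedBall 0 1) *
        (d * ∫ v, f v * inner ℝ v e ∂sphereUnif d 1) := by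
  set V := (volume : Measure (Strat d)).real (Metric.closedBall 0 1)
  set I := ∫ v, f v * inner ℝ v e ∂sphereUnif d 1
  let ε : ℕ → ℝ := fun n => 1 / ((n : ℝ) + 1)
  have hε : ∀ n, 0 < ε n := fun n => by positivity
  have hε1 : ∀ n, ε n ≤ 1 := fun n => by
    simp only [ε]
    rw [div_le_one (by positivity)]
    linarith [(Nat.cast_nonneg n : (0 : ℝ) ≤ n)]
  have hε0 : Filter.Tendsto ε Filter.atTop (𝓝 0) := tendsto_one_div_add_atTop_nhds_zero_nat
  have hfb : ∀ x y, |f x - f y| ≤ K * ‖x - y‖ := fun x y => by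
    simpa [Real.norm_eq_abs] using hf.norm_sub_le x y
  have hline : Measurable fun u => lineDeriv ℝ f u e := measurable_lineDeriv hf.continuous
  have hlineb : ∀ u, |lineDeriv ℝ f u e| ≤ K * ‖e‖ := fun u =>
    norm_lineDeriv_le_of_lipschitz ℝ hf
  -- left-hand side
  have hL : Filter.Tendsto (fun n => ∫ u, lineDeriv ℝ f u e * cutoff d (ε n) u) Filter.atTop
      (𝓝 (∫ u in Metric.closedBall (0 : Strat d) 1, lineDeriv ℝ f u e)) := by
    rw [← integral_indicator measurableSet_closedBall]
    refine tendsto_integral_of_dominated_convergence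
      ((Metric.closedBall (0 : Strat d) 2).indicator fun _ => K * ‖e‖) ?_ ?_ ?_ ?_
    · intro n
      exact (hline.mul (lipschitzWith_cutoff _).continuous.measurable).aestronglyMeasurable
    · rw [integrable_indicator_iff measurableSet_closedBall]
      exact integrableOn_const measure_closedBall_lt_top.ne
    · intro n
      refine Filter.Eventually.of_forall fun u => ?_
      by_cases hu : ‖u‖ ≤ 2
      · rw [indicator_of_mem (by simpa using hu), norm_mul, Real.norm_eq_abs,
          Real.norm_of_nonneg (cutoff_nonneg _ _)]
        exact (mul_le_of_le_one_right (abs_nonneg _) (cutoff_le_one _ _)).trans (hlineb u)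
      · rw [cutoff_eq_zero (hε n) (by linarith [hε1 n, not_le.1 hu]), mul_zero, norm_zero]
        exact indicator_nonneg (fun _ _ => by positivity) _
    · refine Filter.Eventually.of_forall fun u => ?_
      by_cases hu : ‖u‖ ≤ 1
      · rw [indicator_of_mem (by simpa using hu)]
        simp_rw [cutoff_eq_one (hε _) hu, mul_one]
        exact tendsto_const_nhds
      · rw [indicator_of_notMem (by simpa using hu)]
        refine tendsto_const_nhds.congr' ?_
        filter_upwards [hε0.eventually (gt_mem_nhds (sub_pos.2 (not_le.1 hu)))] with n hn
        rw [cutoff_eq_zero (hε n) (by linarith), mul_zero]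
  -- right-hand side
  let A : ℕ → Set (Strat d) := fun n => {u | ‖u‖ ∈ Ioo 1 (1 + ε n)}
  have hA : ∀ n, MeasurableSet (A n) := fun n => measurable_norm measurableSet_Ioo
  have hAfin : ∀ n, volume (A n) < ⊤ := fun n => by
    refine (measure_mono (t := Metric.ball 0 (1 + ε n)) fun u hu => ?_).trans_lt measure_ball_lt_top
    simpa using hu.2
  -- Integration by parts for Lipschitz functions; the derivative falls on the compactly supported
  -- cutoff.
  have hbp : ∀ n, ∫ u, lineDeriv ℝ f u e * cutoff d (ε n) u =
      (ε n)⁻¹ * ∫ u in A n, f u * inner ℝ (‖u‖⁻¹ • u) e := by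
    intro n
    rw [hf.integral_lineDeriv_mul_eq (lipschitzWith_cutoff _) (hasCompactSupport_cutoff (hε n)),
      ← integral_const_mul, ← integral_indicator (hA n)]
    refine integral_congr_ae ?_
    filter_upwards [lineDeriv_cutoff_ae (hε n) e] with u hu
    rw [hu]
    by_cases h : u ∈ A n
    · rw [indicator_of_mem (by exact h), indicator_of_mem h]; ring
    · rw [indicator_of_notMem (by exact h), indicator_of_notMem h, zero_mul]
  have hvol : ∀ n, volume.real (A n) = ((1 + ε n) ^ d - 1) * V := fun n =>
    volume_real_annulus (hε n)
  -- In the shell `u` is within `ε` of its direction, so replacing `f u` by its value on the unit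
  -- sphere costs `K ε ‖e‖`. The factor `1/ε` cancels this `ε`, and what remains vanishes with the
  -- shell volume.
  have hdiff : ∀ n, |(ε n)⁻¹ * (∫ u in A n, f u * inner ℝ (‖u‖⁻¹ • u) e) -
      (ε n)⁻¹ * (((1 + ε n) ^ d - 1) * V * I)| ≤ K * ‖e‖ * (((1 + ε n) ^ d - 1) * V) := by
    intro n
    have hm1 : Measurable fun u : Strat d => f u * inner ℝ (‖u‖⁻¹ • u) e := by
      have := hf.continuous.measurable
      fun_prop
    have hm2 : Measurable fun u : Strat d => f (‖u‖⁻¹ • u) * inner ℝ (‖u‖⁻¹ • u) e := by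
      have := hf.continuous.measurable
      fun_prop
    have hin : ∀ u : Strat d, |inner ℝ (‖u‖⁻¹ • u) e| ≤ ‖e‖ := fun u => by
      refine (abs_real_inner_le_norm _ _).trans ?_
      rw [norm_smul, norm_inv, norm_norm]
      exact mul_le_of_le_one_left (norm_nonneg _) inv_mul_le_one
    have hpt : ∀ u ∈ A n, |f u * inner ℝ (‖u‖⁻¹ • u) e - f (‖u‖⁻¹ • u) * inner ℝ (‖u‖⁻¹ • u) e| ≤
        K * ε n * ‖e‖ := by
      intro u hu
      rw [← sub_mul, abs_mul]
      gcongr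
      · refine (hfb _ _).trans ?_
        gcongr
        have hu0 : ‖u‖ ≠ 0 := by linarith [hu.1]
        have : u - ‖u‖⁻¹ • u = (1 - ‖u‖⁻¹) • u := by module
        have h1 : ‖u‖⁻¹ ≤ 1 := inv_le_one_of_one_le₀ hu.1.le
        rw [this, norm_smul, Real.norm_of_nonneg (by linarith), sub_mul, inv_mul_cancel₀ hu0]
        linarith [hu.2]
      · exact hin u
    have hi2 : IntegrableOn (fun u : Strat d => f (‖u‖⁻¹ • u) * inner ℝ (‖u‖⁻¹ • u) e) (A n) := by
      refine Measure.integrableOn_of_bounded (M := (|f 0| + K) * ‖e‖) (hAfin n).ne hm2.aestronglyMeasurable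
        (Filter.Eventually.of_forall fun u => ?_)
      rw [norm_mul]
      gcongr
      · have h1 := hfb (‖u‖⁻¹ • u) 0
        rw [sub_zero, norm_smul, norm_inv, norm_norm] at h1
        have h2 : (K : ℝ) * (‖u‖⁻¹ * ‖u‖) ≤ K := mul_le_of_le_one_right K.2 inv_mul_le_one
        rw [Real.norm_eq_abs]
        have := abs_sub_abs_le_abs_sub (f (‖u‖⁻¹ • u)) (f 0)
        linarith
      · exact hin u
    have hi1 : IntegrableOn (fun u : Strat d => f u * inner ℝ (‖u‖⁻¹ • u) e) (A n) := by
      have h3 : IntegrableOn (fun u : Strat d => f u * inner ℝ (‖u‖⁻¹ • u) e -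
          f (‖u‖⁻¹ • u) * inner ℝ (‖u‖⁻¹ • u) e) (A n) := by
        refine Measure.integrableOn_of_bounded (M := K * ε n * ‖e‖) (hAfin n).ne
          (hm1.sub hm2).aestronglyMeasurable ?_
        filter_upwards [ae_restrict_mem (hA n)] with u hu
        exact hpt u hu
      have h4 := h3.add hi2
      refine h4.congr (Filter.Eventually.of_forall fun u => ?_)
      simp
    have hrad : ((1 + ε n) ^ d - 1) * V * I =
        ∫ u in A n, f (‖u‖⁻¹ • u) * inner ℝ (‖u‖⁻¹ • u) e := by
      rw [← hvol, ← setIntegral_normalize hd measurableSet_Ioo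
        (ψ := fun v => f v * inner ℝ v e) (by have := hf.continuous.measurable; fun_prop)]
    rw [hrad, ← mul_sub, ← integral_sub hi1 hi2, abs_mul, abs_of_pos (inv_pos.2 (hε n)),
      inv_mul_le_iff₀ (hε n)]
    have := norm_setIntegral_le_of_norm_le_const (hAfin n)
      (fun u hu => (Real.norm_eq_abs _).trans_le (hpt u hu))
    rw [Real.norm_eq_abs, hvol] at this
    refine this.trans (le_of_eq ?_)
    ring
  -- The dimension factor is the derivative of `t ^ d` at `1`: volume growth of the shell per unit
  -- thickness.
  have hslope : Filter.Tendsto (fun n => (ε n)⁻¹ * ((1 + ε n) ^ d - 1)) Filter.atTop (𝓝 (d : ℝ)) := by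
    have h1 : HasDerivAt (fun t : ℝ => t ^ d) (d : ℝ) 1 := by simpa using hasDerivAt_pow d (1 : ℝ)
    have h2 := h1.tendsto_slope_zero
    have h3 : Filter.Tendsto ε Filter.atTop (𝓝[≠] 0) :=
      tendsto_nhdsWithin_iff.2 ⟨hε0, Filter.Eventually.of_forall fun n => (hε n).ne'⟩
    simpa [Function.comp_def] using h2.comp h3
  have hpow : Filter.Tendsto (fun n => K * ‖e‖ * (((1 + ε n) ^ d - 1) * V)) Filter.atTop (𝓝 0) := by
    have h1 : Filter.Tendsto (fun n => (1 + ε n) ^ d) Filter.atTop (𝓝 1) := by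
      simpa using (hε0.const_add 1).pow d
    simpa using ((h1.sub_const 1).mul_const V).const_mul (K * ‖e‖)
  have hR : Filter.Tendsto (fun n => (ε n)⁻¹ * ∫ u in A n, f u * inner ℝ (‖u‖⁻¹ • u) e) Filter.atTop
      (𝓝 (V * (d * I))) := by
    have h1 : Filter.Tendsto (fun n => (ε n)⁻¹ * (((1 + ε n) ^ d - 1) * V * I)) Filter.atTop
        (𝓝 (V * (d * I))) := by
      have := hslope.mul_const (V * I)
      refine (this.congr fun n => by ring).trans (le_of_eq ?_)
      congr 1
      ring
    have h2 := squeeze_zero_norm (fun n => (Real.norm_eq_abs _).trans_le (hdiff n)) hpow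
    simpa using h2.add h1
  simp_rw [hbp] at hL
  exact tendsto_nhds_unique hL hR

/-- The gradient of the smoothing of `f` at `x`, as an average over the sphere. -/
noncomputable def smoothingGrad {d : ℕ} (η : ℝ) (f : Strat d → ℝ) (x : Strat d) : Strat d :=
  (d / η : ℝ) • ∫ v, f (x + η • v) • v ∂sphereUnif d 1

lemma integrable_sphereUnif_one_of_continuous {F : Type*} [NormedAddCommGroup F]
    [SecondCountableTopology F] (hd : 0 < d) {φ : Strat d → F} (hφ : Continuous φ) :
    Integrable φ (sphereUnif d 1) := by
  have := isProbabilityMeasure_sphereUnif hd 1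
  obtain ⟨C, hC⟩ := (isCompact_sphere (0 : Strat d) 1).exists_bound_of_continuousOn hφ.continuousOn
  refine (integrable_const C).mono' ?_ ?_
  · borelize F
    exact hφ.aestronglyMeasurable
  · filter_upwards [ae_norm_sphereUnif d 1] with v hv
    exact hC v (by simpa using hv)

lemma inner_smoothingGrad (hd : 0 < d) {f : Strat d → ℝ} (hf : Continuous f) (η : ℝ)
    (x e : Strat d) :
    inner ℝ (smoothingGrad η f x) e =
      d / η * ∫ v, f (x + η • v) * inner ℝ v e ∂sphereUnif d 1 := by
  have hi : Integrable (fun v => f (x + η • v) • v) (sphereUnif d 1) :=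
    integrable_sphereUnif_one_of_continuous hd (by fun_prop)
  rw [smoothingGrad, inner_smul_left, real_inner_comm, ← integral_inner hi]
  congr 2
  ext v
  rw [inner_smul_right, real_inner_comm]

/-- A Lipschitz function is differentiable almost everywhere, so one may differentiate under the
integral although `h` itself need not be differentiable. The resulting average of derivatives over
the ball becomes a sphere average by the divergence theorem. -/
lemma hasGradientAt_smoothing (hd : 0 < d) {η : ℝ} (hη : 0 < η) {h : Strat d → ℝ} {L : ℝ≥0}
    (hh : LipschitzWith L h) (x : Strat d) :
    HasGradientAt (smoothing η h) (smoothingGrad η h x) x := by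
  let f : Strat d → ℝ := fun u => h (x + η • u)
  have hf : LipschitzWith (L * Real.toNNReal η) f := by
    refine LipschitzWith.of_dist_le_mul fun u w => ?_
    refine (hh.dist_le_mul _ _).trans (le_of_eq ?_)
    rw [dist_add_left, dist_smul₀, Real.norm_of_nonneg hη.le]
    push_cast
    rw [Real.coe_toNNReal _ hη.le]
    ring
  let B := Metric.closedBall (0 : Strat d) 1
  have hBfin : volume B ≠ ⊤ := measure_closedBall_lt_top.ne
  have : IsFiniteMeasure (volume.restrict B) := ⟨by simpa using hBfin.lt_top⟩
  have hfd : ∀ᵐ u ∂(volume.restrict B), DifferentiableAt ℝ f u :=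
    ae_restrict_of_ae hf.ae_differentiableAt_of_real
  have hmeas : AEStronglyMeasurable (fun u => η⁻¹ • fderiv ℝ f u) (volume.restrict B) :=
    ((measurable_fderiv ℝ f).const_smul η⁻¹).aestronglyMeasurable
  have hcont : Continuous h := hh.continuous
  have hint : Integrable (fun u => h (x + η • u)) (volume.restrict B) :=
    ContinuousOn.integrableOn_compact (isCompact_closedBall _ _) (by fun_prop)
  have key := hasFDerivAt_integral_of_dominated_loc_of_lip (𝕜 := ℝ) (μ := volume.restrict B)
    (F := fun y u => h (y + η • u)) (F' := fun u => η⁻¹ • fderiv ℝ f u) (x₀ := x)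
    (s := Metric.ball x 1) (bound := fun _ => (L : ℝ))
    (Metric.ball_mem_nhds x one_pos)
    (Filter.Eventually.of_forall fun y => by fun_prop)
    hint hmeas
    (Filter.Eventually.of_forall fun u => by
      rw [show Real.nnabs (L : ℝ) = L by simp]
      refine LipschitzWith.lipschitzOnWith (LipschitzWith.of_dist_le_mul fun y z => ?_)
      refine (hh.dist_le_mul _ _).trans (le_of_eq ?_)
      rw [dist_add_right])
    (integrable_const _)
    (by
      filter_upwards [hfd] with u hu
      -- Moving `y` at fixed `u` is the same as moving `u` at fixed `x`, with speed `η⁻¹`. Hence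
      -- differentiability of `f` at `u` suffices.
      have h1 : HasFDerivAt (fun y : Strat d => u + η⁻¹ • (y - x))
          (η⁻¹ • ContinuousLinearMap.id ℝ (Strat d)) x :=
        (((hasFDerivAt_id x).sub_const x).const_smul η⁻¹).const_add u
      have h2 : HasFDerivAt f (fderiv ℝ f u) (u + η⁻¹ • (x - x)) := by
        simpa using hu.hasFDerivAt
      have h3 := h2.comp x h1
      have h4 : (f ∘ fun y : Strat d => u + η⁻¹ • (y - x)) = fun y => h (y + η • u) := by
        ext y
        simp only [Function.comp, f]
        congr 1
        rw [smul_add, smul_smul, mul_inv_cancel₀ hη.ne', one_smul]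
        abel
      rw [h4] at h3
      convert h3 using 1
      ext w
      simp)
  have hV : 0 < volume.real B := by
    rw [Measure.real, ENNReal.toReal_pos_iff]
    exact ⟨Metric.measure_closedBall_pos _ _ one_pos, hBfin.lt_top⟩
  have hsm : smoothing η h = fun y => (volume.real B)⁻¹ * ∫ u in B, h (y + η • u) := by
    ext y
    rw [smoothing, setAverage_eq, smul_eq_mul]
  rw [hasGradientAt_iff_hasFDerivAt, hsm]
  have h5 := key.2.const_mul (volume.real B)⁻¹
  refine h5.congr_fderiv ?_
  ext e
  have hfi : Integrable (fun u => η⁻¹ • fderiv ℝ f u) (volume.restrict B) := by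
    refine (integrable_const (η⁻¹ * (L * Real.toNNReal η : ℝ≥0))).mono' hmeas
      (Filter.Eventually.of_forall fun u => ?_)
    rw [norm_smul, norm_inv, Real.norm_of_nonneg hη.le]
    gcongr
    exact norm_fderiv_le_of_lipschitz ℝ hf
  have h6 := ContinuousLinearMap.integral_apply hfi e
  have h7 : ∫ u in B, (η⁻¹ • fderiv ℝ f u) e = η⁻¹ * ∫ u in B, lineDeriv ℝ f u e := by
    rw [← integral_const_mul]
    refine integral_congr_ae ?_
    filter_upwards [hfd] with u hu
    rw [hu.lineDeriv_eq_fderiv]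
    simp
  rw [InnerProductSpace.toDual_apply_apply, inner_smoothingGrad hd hcont]
  simp only [smul_apply, smul_eq_mul]
  rw [h6, h7, integral_lineDeriv_closedBall hd hf]
  change (volume.real B)⁻¹ * (η⁻¹ * (volume.real B * (d * _))) = _
  field_simp
  rfl

/-- Pairing the difference `z` of the gradients with itself leaves the mean of `|⟨v, z⟩|`, which is
at most `‖z‖/√d` rather than `‖z‖`. This is why the constant grows like `√d` instead of `d`. -/
lemma norm_smoothingGrad_sub_le (hd : 0 < d) {η : ℝ} (hη : 0 < η) {h : Strat d → ℝ} {L : ℝ≥0}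
    (hh : LipschitzWith L h) (x y : Strat d) :
    ‖smoothingGrad η h x - smoothingGrad η h y‖ ≤ L * √d / η * ‖x - y‖ := by
  have := isProbabilityMeasure_sphereUnif hd 1
  have hc : Continuous h := hh.continuous
  set z := smoothingGrad η h x - smoothingGrad η h y with hz
  have hd' : (0 : ℝ) < d := by exact_mod_cast hd
  have hi : ∀ w : Strat d, Integrable (fun v => h (w + η • v) * inner ℝ v z) (sphereUnif d 1) :=
    fun w => integrable_sphereUnif_one_of_continuous hd (by fun_prop)
  have h1 : ‖z‖ ^ 2 = d / η * ∫ v, (h (x + η • v) - h (y + η • v)) * inner ℝ v z ∂sphereUnif d 1 := by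
    rw [← real_inner_self_eq_norm_sq]
    nth_rewrite 1 [hz]
    rw [inner_sub_left, inner_smoothingGrad hd hc, inner_smoothingGrad hd hc, ← mul_sub,
      ← integral_sub (hi x) (hi y)]
    simp_rw [sub_mul]
  have hiabs : Integrable (fun v : Strat d => |inner ℝ v z|) (sphereUnif d 1) :=
    integrable_sphereUnif_one_of_continuous hd (by fun_prop)
  have hisq : Integrable (fun v : Strat d => inner ℝ v z ^ 2) (sphereUnif d 1) :=
    integrable_sphereUnif_one_of_continuous hd (by fun_prop)
  have h2 : ∫ v, (h (x + η • v) - h (y + η • v)) * inner ℝ v z ∂sphereUnif d 1 ≤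
      L * ‖x - y‖ * ∫ v, |inner ℝ v z| ∂sphereUnif d 1 := by
    rw [← integral_const_mul]
    refine integral_mono ?_ (hiabs.const_mul _) fun v => ?_
    · exact integrable_sphereUnif_one_of_continuous hd (by fun_prop)
    · refine (le_abs_self _).trans ?_
      rw [abs_mul]
      refine mul_le_mul_of_nonneg_right ?_ (abs_nonneg _)
      have := hh.norm_sub_le (x + η • v) (y + η • v)
      simpa [Real.norm_eq_abs] using this
  have h3 : ∫ v, |inner ℝ v z| ∂sphereUnif d 1 ≤ ‖z‖ / √d := by
    have hsq : ∫ v, inner ℝ v z ^ 2 ∂sphereUnif d 1 = ‖z‖ ^ 2 / d := by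
      rw [← integral_inner_sq_sphereUnif hd]
      simp_rw [real_inner_comm]
    have hlp : MemLp (fun v : Strat d => |inner ℝ v z|) 2 (sphereUnif d 1) :=
      (memLp_two_iff_integrable_sq hiabs.aestronglyMeasurable).2 (by simpa using hisq)
    -- Jensen's inequality in the form of nonnegative variance.
    have hv := variance_nonneg (fun v : Strat d => |inner ℝ v z|) (sphereUnif d 1)
    rw [variance_eq_sub hlp] at hv
    have h4 : ∫ v, ((fun v : Strat d => |inner ℝ v z|) ^ 2) v ∂sphereUnif d 1 = ‖z‖ ^ 2 / d := by
      rw [← hsq]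
      simp
    rw [h4] at hv
    refine abs_le_of_sq_le_sq' ?_ (by positivity) |>.2
    rw [div_pow, Real.sq_sqrt hd'.le]
    linarith
  rcases (norm_nonneg z).eq_or_lt with h0 | h0
  · rw [← h0]; positivity
  have h5 : ‖z‖ ^ 2 ≤ d / η * (L * ‖x - y‖ * (‖z‖ / √d)) := by
    rw [h1]
    have := h2.trans (mul_le_mul_of_nonneg_left h3 (by positivity))
    gcongr
  have hsd : (d : ℝ) = √d * √d := (Real.mul_self_sqrt hd'.le).symm
  have hsd0 : 0 < √(d : ℝ) := Real.sqrt_pos.2 hd'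
  have h6 : (d : ℝ) / η * (L * ‖x - y‖ * (‖z‖ / √d)) = (L * √d / η * ‖x - y‖) * ‖z‖ := by
    rw [hsd]
    rw [Real.sqrt_mul_self hsd0.le]
    field_simp
  rw [h6, sq] at h5
  exact le_of_mul_le_mul_right h5 h0

end SmoothingGradient

/-! ### The two-point gradient estimate: unbiasedness and second moment -/

section TwoPoint

variable {d : ℕ}

/-- The two-point estimate of the gradient of the smoothing of `h` at `x`. -/
noncomputable def twoPointGrad (η : ℝ) (h : Strat d → ℝ) (x v : Strat d) : Strat d :=
  ((d : ℝ) / (2 * η) * (h (x + v) - h (x - v))) • ((1 / ‖v‖) • v)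

lemma integral_sphereUnif {F : Type*} [NormedAddCommGroup F] [NormedSpace ℝ F]
    {η : ℝ} (hη : 0 < η) (φ : Strat d → F) :
    ∫ v, φ v ∂sphereUnif d η = ∫ v, φ (η • v) ∂sphereUnif d 1 := by
  rw [sphereUnif_eq_map]
  exact ((Homeomorph.smulOfNeZero η hη.ne').measurableEmbedding).integral_map φ

lemma twoPointGrad_smul_ae {η : ℝ} (hη : 0 < η) (h : Strat d → ℝ) (x : Strat d) :
    ∀ᵐ v ∂sphereUnif d 1, twoPointGrad η h x (η • v) =
      ((d : ℝ) / (2 * η) * (h (x + η • v) - h (x - η • v))) • v := by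
  filter_upwards [ae_norm_sphereUnif d 1] with v hv
  rw [abs_one] at hv
  rw [twoPointGrad, norm_smul, hv, smul_smul (1 / _), Real.norm_of_nonneg hη.le, mul_one,
    one_div_mul_cancel hη.ne', one_smul]

lemma integral_comp_neg_sphereUnif {F : Type*} [NormedAddCommGroup F] [NormedSpace ℝ F]
    (hd : 0 < d) (φ : Strat d → F) :
    ∫ v, φ (-v) ∂sphereUnif d 1 = ∫ v, φ v ∂sphereUnif d 1 := by
  conv_rhs => rw [← map_neg_sphereUnif_one hd]
  exact ((Homeomorph.neg (Strat d)).measurableEmbedding.integral_map φ).symm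

/-- Under `v ↦ -v` the backward evaluation contributes the same mean as the forward one, which
compensates the factor `1/2`. -/
lemma integral_twoPointGrad_of_lipschitz (hd : 0 < d) {η : ℝ} (hη : 0 < η) {h : Strat d → ℝ}
    {L : ℝ≥0} (hh : LipschitzWith L h) (x : Strat d) :
    ∫ v, twoPointGrad η h x v ∂sphereUnif d η = smoothingGrad η h x := by
  have hc : Continuous h := hh.continuous
  rw [integral_sphereUnif hη, integral_congr_ae (twoPointGrad_smul_ae hη h x)]
  have h1 : Integrable (fun v => h (x + η • v) • v) (sphereUnif d 1) :=
    integrable_sphereUnif_one_of_continuous hd (by fun_prop)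
  have h2 : Integrable (fun v => h (x - η • v) • v) (sphereUnif d 1) :=
    integrable_sphereUnif_one_of_continuous hd (by fun_prop)
  have h3 : ∫ v, h (x - η • v) • v ∂sphereUnif d 1 = -∫ v, h (x + η • v) • v ∂sphereUnif d 1 := by
    rw [← integral_comp_neg_sphereUnif hd, ← integral_neg]
    congr 1
    ext v
    simp
  simp_rw [mul_smul, sub_smul]
  rw [integral_smul, integral_sub h1 h2, h3, smoothingGrad, sub_neg_eq_add, ← two_smul ℝ, smul_smul]
  congr 1
  field_simp

lemma norm_twoPointGrad_sq_le (η : ℝ) (h : Strat d → ℝ) (x v : Strat d) :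
    ‖twoPointGrad η h x v‖ ^ 2 ≤ ((d : ℝ) / (2 * η)) ^ 2 * (h (x + v) - h (x - v)) ^ 2 := by
  rw [twoPointGrad, norm_smul, mul_pow, Real.norm_eq_abs, sq_abs, mul_pow]
  refine mul_le_of_le_one_right (by positivity) ?_
  rw [norm_smul, norm_div, norm_one, norm_norm, one_div]
  exact pow_le_one₀ (by positivity) inv_mul_le_one

/-- The central difference is odd in the direction, so concentration on the sphere saves a factor
`d` over the pointwise bound `(d L)²`. -/
lemma integral_norm_twoPointGrad_sq_le_of_lipschitz (hd : 0 < d) {η : ℝ} (hη : 0 < η)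
    {h : Strat d → ℝ} {L : ℝ≥0} (hh : LipschitzWith L h) (x : Strat d) :
    ∫ v, ‖twoPointGrad η h x v‖ ^ 2 ∂sphereUnif d η ≤ 16 * √(2 * Real.pi) * L ^ 2 * d := by
  have hc : Continuous h := hh.continuous
  have hd' : (0 : ℝ) < d := by exact_mod_cast hd
  let g : Strat d → ℝ := fun v => (h (x + η • v) - h (x - η • v)) / 2
  have hg : LipschitzWith (L * Real.toNNReal η) g := by
    refine LipschitzWith.of_dist_le_mul fun u w => ?_
    have h1 : |h (x + η • u) - h (x + η • w)| ≤ L * (η * ‖u - w‖) := by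
      have := hh.norm_sub_le (x + η • u) (x + η • w)
      rwa [add_sub_add_left_eq_sub, ← smul_sub, norm_smul, Real.norm_of_nonneg hη.le] at this
    have h2 : |h (x - η • u) - h (x - η • w)| ≤ L * (η * ‖u - w‖) := by
      have := hh.norm_sub_le (x - η • u) (x - η • w)
      rwa [sub_sub_sub_cancel_left, ← smul_sub, norm_smul, norm_sub_rev w u,
        Real.norm_of_nonneg hη.le] at this
    rw [Real.dist_eq, dist_eq_norm]
    push_cast
    rw [Real.coe_toNNReal _ hη.le]
    simp only [g]
    rw [abs_le] at h1 h2 ⊢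
    constructor <;> linarith [h1.1, h1.2, h2.1, h2.2]
  have hodd : ∀ v, g (-v) = -g v := fun v => by
    simp only [g, smul_neg, ← sub_eq_add_neg, sub_neg_eq_add]
    ring
  have h1 := integral_sq_sphereUnif_le_of_odd hd hg hodd
  have hgc : Continuous g := hg.continuous
  have h2 : ∫ v, ‖twoPointGrad η h x v‖ ^ 2 ∂sphereUnif d η ≤
      (d / η) ^ 2 * ∫ v, g v ^ 2 ∂sphereUnif d 1 := by
    rw [integral_sphereUnif hη, ← integral_const_mul]
    refine integral_mono_of_nonneg (Filter.Eventually.of_forall fun v => sq_nonneg _) ?_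
      (Filter.Eventually.of_forall fun v => ?_)
    · exact integrable_sphereUnif_one_of_continuous hd (by fun_prop)
    · refine (norm_twoPointGrad_sq_le η h x _).trans (le_of_eq ?_)
      simp only [g]
      ring
  refine h2.trans ((mul_le_mul_of_nonneg_left h1 (sq_nonneg _)).trans ?_)
  push_cast
  rw [Real.coe_toNNReal _ hη.le]
  have e : (d / η) ^ 2 * (9 * Real.pi ^ 2 / 4 * (L * η) ^ 2 / d) =
      (9 * Real.pi ^ 2 / 4) * (L : ℝ) ^ 2 * d := by
    field_simp
  rw [e]
  gcongr
  -- It remains to compare constants: `9 π² / 4 < 23`, while `16 √(2π) ≥ 40`.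
  have h3 : (2.5 : ℝ) ≤ √(2 * Real.pi) := by
    refine Real.le_sqrt_of_sq_le ?_
    linarith [Real.pi_gt_d2]
  nlinarith [Real.pi_lt_d2, Real.pi_pos]

end TwoPoint

/-! ### Localisation to functions that are Lipschitz only near the point -/

section Local

variable {d : ℕ} {η : ℝ} {h : Strat d → ℝ} {L : ℝ≥0} {U : Set (Strat d)}

lemma add_smul_mem_closedBall (hη : 0 < η) (x : Strat d) {u : Strat d} (hu : ‖u‖ ≤ 1) :
    x + η • u ∈ Metric.closedBall x η := by
  rw [mem_closedBall_iff_norm, add_sub_cancel_left, norm_smul, Real.norm_of_nonneg hη.le]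
  exact mul_le_of_le_one_right hη.le hu

lemma smoothing_congr (hη : 0 < η) {h' : Strat d → ℝ} (hh : EqOn h h' U) {x : Strat d}
    (hx : Metric.closedBall x η ⊆ U) : smoothing η h x = smoothing η h' x := by
  rw [smoothing, smoothing, setAverage_eq, setAverage_eq]
  congr 1
  refine setIntegral_congr_fun measurableSet_closedBall fun u hu => ?_
  exact hh (hx (add_smul_mem_closedBall hη x (by simpa using hu)))

lemma smoothingGrad_congr (hη : 0 < η) {h' : Strat d → ℝ} (hh : EqOn h h' U) {x : Strat d}
    (hx : Metric.closedBall x η ⊆ U) : smoothingGrad η h x = smoothingGrad η h' x := by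
  rw [smoothingGrad, smoothingGrad]
  congr 1
  refine integral_congr_ae ?_
  filter_upwards [ae_norm_sphereUnif d 1] with v hv
  rw [hh (hx (add_smul_mem_closedBall hη x (by simp [hv])))]

lemma twoPointGrad_congr_ae (hη : 0 < η) {h' : Strat d → ℝ} (hh : EqOn h h' U) {x : Strat d}
    (hx : Metric.closedBall x η ⊆ U) :
    ∀ᵐ v ∂sphereUnif d η, twoPointGrad η h x v = twoPointGrad η h' x v := by
  filter_upwards [ae_norm_sphereUnif d η] with v hv
  rw [abs_of_pos hη] at hv
  rw [twoPointGrad, twoPointGrad, hh (hx (by simp [hv])), hh (hx (by simp [hv]))]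

/-- The smoothing at `x` sees only the ball of radius `η`, so `h` may be replaced by a global
Lipschitz extension. For a derivative the two smoothings must agree near `x`; compactness of the
ball inside the open set `U` gives that room. -/
lemma hasGradientAt_smoothing_of_lipschitzOn (hd : 0 < d) (hη : 0 < η) (hU : IsOpen U)
    (hh : LipschitzOnWith L h U) {x : Strat d} (hx : Metric.closedBall x η ⊆ U) :
    HasGradientAt (smoothing η h) (smoothingGrad η h x) x := by
  obtain ⟨h', hL', he⟩ := hh.extend_real
  obtain ⟨δ, hδ, hδU⟩ := (isCompact_closedBall x η).exists_thickening_subset_open hU hx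
  rw [smoothingGrad_congr hη he hx]
  refine (hasGradientAt_smoothing hd hη hL' x).congr_of_eventuallyEq ?_
  filter_upwards [Metric.ball_mem_nhds x hδ] with y hy
  refine smoothing_congr hη he fun z hz => hδU ?_
  rw [Metric.mem_thickening_iff]
  refine ⟨z - y + x, ?_, ?_⟩
  · rw [mem_closedBall_iff_norm, add_sub_cancel_right]
    exact mem_closedBall_iff_norm.1 hz
  · rw [dist_eq_norm]
    have : z - (z - y + x) = y - x := by abel
    rw [this]
    exact mem_ball_iff_norm.1 hy

lemma norm_smoothingGrad_sub_le_of_lipschitzOn (hd : 0 < d) (hη : 0 < η)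
    (hh : LipschitzOnWith L h U) {x y : Strat d} (hx : Metric.closedBall x η ⊆ U)
    (hy : Metric.closedBall y η ⊆ U) :
    ‖smoothingGrad η h x - smoothingGrad η h y‖ ≤ L * √d / η * ‖x - y‖ := by
  obtain ⟨h', hL', he⟩ := hh.extend_real
  rw [smoothingGrad_congr hη he hx, smoothingGrad_congr hη he hy]
  exact norm_smoothingGrad_sub_le hd hη hL' x y

lemma abs_smoothing_sub_le_of_lipschitzOn (hη : 0 < η)
    (hh : LipschitzOnWith L h U) {x y : Strat d} (hx : Metric.closedBall x η ⊆ U)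
    (hy : Metric.closedBall y η ⊆ U) :
    |smoothing η h x - smoothing η h y| ≤ L * ‖x - y‖ := by
  obtain ⟨h', hL', he⟩ := hh.extend_real
  have hc : Continuous h' := hL'.continuous
  rw [smoothing_congr hη he hx, smoothing_congr hη he hy]
  have hfin : volume (Metric.closedBall (0 : Strat d) 1) ≠ ⊤ := measure_closedBall_lt_top.ne
  have hpos : volume (Metric.closedBall (0 : Strat d) 1) ≠ 0 :=
    (Metric.measure_closedBall_pos _ _ one_pos).ne'
  have hV : 0 < volume.real (Metric.closedBall (0 : Strat d) 1) :=
    ENNReal.toReal_pos hpos hfin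
  have hi : ∀ z : Strat d, IntegrableOn (fun u => h' (z + η • u)) (Metric.closedBall (0 : Strat d) 1) :=
    fun z => ContinuousOn.integrableOn_compact (isCompact_closedBall _ _) (by fun_prop)
  rw [smoothing, smoothing, setAverage_eq, setAverage_eq, ← smul_sub, ← integral_sub (hi x) (hi y),
    smul_eq_mul, abs_mul, abs_of_pos (inv_pos.2 hV), inv_mul_le_iff₀ hV, mul_comm]
  refine norm_setIntegral_le_of_norm_le_const (f := fun u => h' (x + η • u) - h' (y + η • u))
    hfin.lt_top fun u _ => ?_
  refine (hL'.norm_sub_le _ _).trans (le_of_eq ?_)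
  rw [add_sub_add_right_eq_sub]

lemma integral_twoPointGrad (hd : 0 < d) (hη : 0 < η)
    (hh : LipschitzOnWith L h U) {x : Strat d} (hx : Metric.closedBall x η ⊆ U) :
    ∫ v, twoPointGrad η h x v ∂sphereUnif d η = smoothingGrad η h x := by
  obtain ⟨h', hL', he⟩ := hh.extend_real
  rw [integral_congr_ae (twoPointGrad_congr_ae hη he hx), smoothingGrad_congr hη he hx]
  exact integral_twoPointGrad_of_lipschitz hd hη hL' x

lemma integral_norm_twoPointGrad_sq_le (hd : 0 < d) (hη : 0 < η)
    (hh : LipschitzOnWith L h U) {x : Strat d} (hx : Metric.closedBall x η ⊆ U) :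
    ∫ v, ‖twoPointGrad η h x v‖ ^ 2 ∂sphereUnif d η ≤ 16 * √(2 * Real.pi) * L ^ 2 * d := by
  obtain ⟨h', hL', he⟩ := hh.extend_real
  have := twoPointGrad_congr_ae hη he hx
  rw [integral_congr_ae (this.mono fun v hv => by rw [hv])]
  exact integral_norm_twoPointGrad_sq_le_of_lipschitz hd hη hL' x

lemma norm_twoPointGrad_le (hη : 0 < η) (hh : LipschitzOnWith L h U) {x v : Strat d}
    (hx : Metric.closedBall x η ⊆ U) (hv : ‖v‖ = η) : ‖twoPointGrad η h x v‖ ≤ d * L := by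
  have h1 := hh.norm_sub_le (hx (by simp [hv] : x + v ∈ _)) (hx (by simp [hv] : x - v ∈ _))
  have h2 : ‖x + v - (x - v)‖ = 2 * η := by
    have : x + v - (x - v) = (2 : ℝ) • v := by rw [two_smul]; abel
    rw [this, norm_smul, hv, Real.norm_of_nonneg zero_le_two]
  rw [h2] at h1
  rw [twoPointGrad, norm_smul, norm_smul, norm_div, norm_one, norm_norm, hv, one_div_mul_cancel hη.ne',
    mul_one, norm_mul, Real.norm_of_nonneg (by positivity)]
  calc _ ≤ (d : ℝ) / (2 * η) * (L * (2 * η)) := by gcongr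
    _ = _ := by field_simp

end Local

/-! ### Projections and one inexact projected gradient step -/

section Projection

variable {E : Type*} [NormedAddCommGroup E] [InnerProductSpace ℝ E] {K : Set E}

lemma proj_spec [CompleteSpace E] (hne : K.Nonempty) (hc : IsClosed K) (hK : Convex ℝ K) (x : E) :
    proj K x ∈ K ∧ ∀ z ∈ K, ‖x - proj K x‖ ≤ ‖x - z‖ := by
  obtain ⟨p, hp, hpe⟩ := exists_norm_eq_iInf_of_complete_convex hne hc.isComplete hK x
  have h : ∃ y, y ∈ K ∧ ∀ z ∈ K, ‖x - y‖ ≤ ‖x - z‖ := by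
    refine ⟨p, hp, fun z hz => ?_⟩
    rw [hpe]
    exact ciInf_le ⟨0, by rintro _ ⟨w, rfl⟩; exact norm_nonneg _⟩ (⟨z, hz⟩ : K)
  exact Classical.epsilon_spec h

lemma proj_mem [CompleteSpace E] (hne : K.Nonempty) (hc : IsClosed K) (hK : Convex ℝ K) (x : E) :
    proj K x ∈ K := (proj_spec hne hc hK x).1

lemma inner_sub_proj_le [CompleteSpace E] (hne : K.Nonempty) (hc : IsClosed K) (hK : Convex ℝ K)
    (x : E) {z : E} (hz : z ∈ K) : inner ℝ (x - proj K x) (z - proj K x) ≤ 0 := by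
  obtain ⟨h1, h2⟩ := proj_spec hne hc hK x
  have : Nonempty K := hne.to_subtype
  have h3 : ‖x - proj K x‖ = ⨅ w : K, ‖x - w‖ :=
    le_antisymm (le_ciInf fun w => h2 w w.2)
      (ciInf_le ⟨0, by rintro _ ⟨w, rfl⟩; exact norm_nonneg _⟩ (⟨_, h1⟩ : K))
  exact (norm_eq_iInf_iff_real_inner_le_zero hK h1).1 h3 z hz

/-- Adding the variational inequalities at `p` and at the projection forces their distance to
vanish. This criterion identifies projections onto products coordinate by coordinate. -/
lemma eq_proj_of_inner_le [CompleteSpace E] (hc : IsClosed K) (hK : Convex ℝ K)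
    {x p : E} (hp : p ∈ K) (h : ∀ z ∈ K, inner ℝ (x - p) (z - p) ≤ 0) : proj K x = p := by
  have h1 := h _ (proj_mem ⟨p, hp⟩ hc hK x)
  have h2 := inner_sub_proj_le ⟨p, hp⟩ hc hK x hp
  set q := proj K x
  have h3 : ‖q - p‖ ^ 2 = inner ℝ (x - p) (q - p) + inner ℝ (x - q) (p - q) := by
    have e : x - q = (x - p) - (q - p) := by abel
    rw [e, ← neg_sub q p, inner_neg_right, inner_sub_left (x - p), real_inner_self_eq_norm_sq]
    ring
  have h4 : ‖q - p‖ = 0 := by nlinarith [norm_nonneg (q - p)]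
  exact sub_eq_zero.1 (norm_eq_zero.1 h4)

lemma norm_proj_sub_proj_le [CompleteSpace E] (hne : K.Nonempty) (hc : IsClosed K)
    (hK : Convex ℝ K) (x y : E) : ‖proj K x - proj K y‖ ≤ ‖x - y‖ := by
  have h1 := inner_sub_proj_le hne hc hK x (proj_mem hne hc hK y)
  have h2 := inner_sub_proj_le hne hc hK y (proj_mem hne hc hK x)
  set p := proj K x
  set q := proj K y
  have h3 : ‖p - q‖ ^ 2 ≤ inner ℝ (x - y) (p - q) := by
    have e : x - y = (x - p) - (y - q) + (p - q) := by abel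
    rw [e, inner_add_left, inner_sub_left, real_inner_self_eq_norm_sq]
    rw [← neg_sub p q, inner_neg_right] at h1
    linarith
  have h4 := real_inner_le_norm (x - y) (p - q)
  by_contra hcon
  push Not at hcon
  nlinarith [norm_nonneg (x - y), norm_nonneg (p - q)]

lemma continuous_proj [CompleteSpace E] (hne : K.Nonempty) (hc : IsClosed K) (hK : Convex ℝ K) :
    Continuous (proj K) :=
  (LipschitzWith.of_dist_le_mul (K := 1) fun x y => by
    simpa [dist_eq_norm] using norm_proj_sub_proj_le hne hc hK x y).continuous

/-- The descent lemma on a convex set. -/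
lemma le_add_inner_of_lipschitz_gradient [CompleteSpace E] {f : E → ℝ} {g : E → E} {L : ℝ}
    (hK : Convex ℝ K) (hg : ∀ x ∈ K, HasGradientWithinAt f (g x) K x)
    (hL : ∀ x ∈ K, ∀ y ∈ K, ‖g x - g y‖ ≤ L * ‖x - y‖) {x y : E} (hx : x ∈ K) (hy : y ∈ K) :
    f y ≤ f x + inner ℝ (g x) (y - x) + L / 2 * ‖y - x‖ ^ 2 := by
  let c : ℝ → E := fun t => x + t • (y - x)
  have hcK : ∀ t ∈ Icc (0 : ℝ) 1, c t ∈ K := fun t ht =>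
    hK.add_smul_sub_mem hx hy ht
  have hcd : ∀ t, HasDerivAt c (y - x) t := fun t => by
    have h := ((hasDerivAt_id t).smul_const (y - x)).const_add x
    rwa [one_smul] at h
  -- Quadratic upper model minus `f` along the segment; the Lipschitz gradient makes it
  -- nondecreasing. Derivatives are one-sided at the ends, as only values on `K` matter.
  let ψ : ℝ → ℝ := fun t => t * inner ℝ (g x) (y - x) + L / 2 * ‖y - x‖ ^ 2 * t ^ 2 - f (c t)
  have hψ : ∀ t ∈ Icc (0 : ℝ) 1, HasDerivWithinAt ψ
      (inner ℝ (g x) (y - x) + L * ‖y - x‖ ^ 2 * t - inner ℝ (g (c t)) (y - x)) (Icc 0 1) t := by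
    intro t ht
    have h1 := (hg (c t) (hcK t ht)).hasFDerivWithinAt.comp_hasDerivWithinAt t
      (hcd t).hasDerivWithinAt (s := Icc 0 1) (fun s hs => hcK s hs)
    have h2 : HasDerivWithinAt (fun t : ℝ => t * inner ℝ (g x) (y - x)) (inner ℝ (g x) (y - x))
        (Icc 0 1) t := by
      simpa using (hasDerivWithinAt_id t (Icc 0 1)).mul_const (inner ℝ (g x) (y - x))
    have h3 : HasDerivWithinAt (fun t : ℝ => L / 2 * ‖y - x‖ ^ 2 * t ^ 2) (L * ‖y - x‖ ^ 2 * t)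
        (Icc 0 1) t := by
      have := ((hasDerivAt_pow 2 t).const_mul (L / 2 * ‖y - x‖ ^ 2)).hasDerivWithinAt (s := Icc 0 1)
      refine this.congr_deriv ?_
      simp
      ring
    exact (h2.add h3).sub h1
  have hmono : MonotoneOn ψ (Icc 0 1) := by
    refine monotoneOn_of_hasDerivWithinAt_nonneg (convex_Icc 0 1)
      (f' := fun t => inner ℝ (g x) (y - x) + L * ‖y - x‖ ^ 2 * t - inner ℝ (g (c t)) (y - x))
      (fun t ht => (hψ t ht).continuousWithinAt)
      (fun t ht => (hψ t (interior_subset ht)).mono interior_subset) fun t ht => ?_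
    have ht' := interior_subset ht
    have h1 : inner ℝ (g (c t) - g x) (y - x) ≤ L * ‖y - x‖ ^ 2 * t := by
      refine (real_inner_le_norm _ _).trans ?_
      have h2 := hL (c t) (hcK t ht') x hx
      have h3 : c t - x = t • (y - x) := by simp [c]
      rw [h3, norm_smul, Real.norm_of_nonneg ht'.1] at h2
      calc _ ≤ L * (t * ‖y - x‖) * ‖y - x‖ := by gcongr
        _ = _ := by ring
    rw [inner_sub_left] at h1
    linarith
  have h := hmono (left_mem_Icc.2 zero_le_one) (right_mem_Icc.2 zero_le_one) zero_le_one
  simp only [ψ, c] at h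
  simp at h
  linarith

/-- One step of the projected gradient method with an inexact gradient `w` of step size
`1 / (2 L)`. -/
lemma norm_residual_sq_le [CompleteSpace E] (hne : K.Nonempty) (hc : IsClosed K) (hK : Convex ℝ K)
    {L : ℝ} (hL : 0 < L) {x : E} (hx : x ∈ K) (v w : E) {a b : ℝ}
    (hdesc : b ≤ a + inner ℝ v (proj K (x - (1 / (2 * L)) • w) - x) +
      L / 2 * ‖proj K (x - (1 / (2 * L)) • w) - x‖ ^ 2) :
    ‖(1 / (1 / (2 * L))) • (x - proj K (x - (1 / (2 * L)) • v))‖ ^ 2 ≤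
      16 * L * (a - b) + 6 * ‖w - v‖ ^ 2 := by
  set γ := 1 / (2 * L) with hγ
  have hγ0 : 0 < γ := by positivity
  have h1 := inner_sub_proj_le hne hc hK (x - γ • w) hx
  have h2 := norm_proj_sub_proj_le hne hc hK (x - γ • w) (x - γ • v)
  set p := proj K (x - γ • w)
  set q := proj K (x - γ • v)
  set D := x - p with hD
  have e1 : x - γ • w - p = D - γ • w := by rw [hD]; abel
  have e2 : x - γ • w - (x - γ • v) = -(γ • (w - v)) := by module
  have e3 : p - x = -D := by rw [hD]; abel
  rw [e1, inner_sub_left, real_inner_self_eq_norm_sq, inner_smul_left] at h1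
  simp only [RCLike.conj_to_real] at h1
  rw [e2, norm_neg, norm_smul, Real.norm_of_nonneg hγ0.le] at h2
  rw [e3, inner_neg_right, norm_neg] at hdesc
  have h3 : inner ℝ w D = inner ℝ (w - v) D + inner ℝ v D := by rw [inner_sub_left]; ring
  -- The projection inequality tested at `x`; with step `1/(2L)` it dominates the quadratic term
  -- `L/2 ‖D‖²` of the descent lemma.
  have h4 : 2 * L * ‖D‖ ^ 2 ≤ inner ℝ w D := by
    have : ‖D‖ ^ 2 ≤ γ * inner ℝ w D := by linarith
    rw [hγ] at this
    have h5 := mul_le_mul_of_nonneg_left this (by positivity : 0 ≤ 2 * L)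
    rwa [← mul_assoc, mul_one_div_cancel (by positivity), one_mul] at h5
  have h5 : inner ℝ (w - v) D ≤ ‖w - v‖ * ‖D‖ := real_inner_le_norm _ _
  have h6 : L * (‖w - v‖ * ‖D‖) ≤ L ^ 2 * ‖D‖ ^ 2 + ‖w - v‖ ^ 2 / 4 := by
    nlinarith [sq_nonneg (L * ‖D‖ - ‖w - v‖ / 2)]
  have h7 : L ^ 2 * ‖D‖ ^ 2 ≤ 2 * L * (a - b) + ‖w - v‖ ^ 2 / 2 := by
    have h8 : L * b ≤ L * (a + -inner ℝ v D + L / 2 * ‖D‖ ^ 2) := by gcongr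
    have h9 : L * (2 * L * ‖D‖ ^ 2) ≤ L * (‖w - v‖ * ‖D‖ + inner ℝ v D) := by
      gcongr
      linarith
    nlinarith
  -- The exact residual is the computed step plus a correction bounded by `‖w - v‖` through
  -- nonexpansiveness. With `‖a + b‖² ≤ 2‖a‖² + 2‖b‖²` the constants are `8 · 2 = 16` and `8/2 + 2 =
  -- 6`.
  have e4 : (1 / γ) • (x - q) = (2 * L) • D + (2 * L) • (p - q) := by
    rw [← smul_add, hγ, one_div_one_div, hD]
    congr 1
    abel
  have h10 : ‖(2 * L) • (p - q)‖ ≤ ‖w - v‖ := by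
    rw [norm_smul, Real.norm_of_nonneg (by positivity)]
    calc _ ≤ 2 * L * (γ * ‖w - v‖) := by gcongr
      _ = _ := by rw [hγ]; field_simp
  have h11 : ‖(2 * L) • D‖ ^ 2 = 4 * (L ^ 2 * ‖D‖ ^ 2) := by
    rw [norm_smul, Real.norm_of_nonneg (by positivity)]; ring
  rw [e4]
  have h12 := norm_add_le ((2 * L) • D) ((2 * L) • (p - q))
  have h13 : ‖(2 * L) • D + (2 * L) • (p - q)‖ ^ 2 ≤
      2 * ‖(2 * L) • D‖ ^ 2 + 2 * ‖(2 * L) • (p - q)‖ ^ 2 := by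
    nlinarith [norm_nonneg ((2 * L) • D + (2 * L) • (p - q)),
      sq_nonneg (‖(2 * L) • D‖ - ‖(2 * L) • (p - q)‖)]
  have h14 : ‖(2 * L) • (p - q)‖ ^ 2 ≤ ‖w - v‖ ^ 2 := by gcongr
  linarith

end Projection

/-! ### Single-player changes and product norms -/

section Replace

variable {N : ℕ} {n : Fin N → ℕ}

lemma repl_self (x : Profile n) (i : Fin N) : repl x i (x i) = x := by
  simp [repl]

lemma repl_apply_self (x : Profile n) (i : Fin N) (y : Strat (n i)) : repl x i y i = y := by
  simp [repl]

lemma repl_apply_of_ne (x : Profile n) {i j : Fin N} (h : j ≠ i) (y : Strat (n i)) :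
    repl x i y j = x j := by
  simp [repl, h]

lemma repl_sub (x : Profile n) (i : Fin N) (y : Strat (n i)) :
    repl x i y - x = WithLp.toLp 2 (Pi.single i (y - x i)) := by
  ext j : 1
  by_cases h : j = i
  · subst h
    simp [repl]
  · simp [repl, h]

lemma inner_repl_sub (x z : Profile n) (i : Fin N) (y : Strat (n i)) :
    inner ℝ z (repl x i y - x) = inner ℝ (z i) (y - x i) := by
  rw [repl_sub, PiLp.inner_apply, Finset.sum_eq_single i]
  · simp
  · intro j _ hj
    simp [hj]
  · simp

lemma lmax_nonneg (L : Fin N → ℝ≥0) : 0 ≤ Lmax L := NNReal.coe_nonneg _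

lemma le_lmax (L : Fin N → ℝ≥0) (i : Fin N) : (L i : ℝ) ≤ Lmax L :=
  NNReal.coe_le_coe.2 (Finset.le_sup (f := L) (Finset.mem_univ i))

lemma le_nmax (n : Fin N → ℕ) (i : Fin N) : (n i : ℝ) ≤ nmax n :=
  Nat.cast_le.2 (Finset.le_sup (f := n) (Finset.mem_univ i))

lemma sum_norm_le (x : Profile n) : ∑ i, ‖x i‖ ≤ √(N : ℝ) * ‖x‖ := by
  refine abs_le_of_sq_le_sq' ?_ (by positivity) |>.2
  rw [mul_pow, Real.sq_sqrt (Nat.cast_nonneg _), PiLp.norm_sq_eq_of_L2]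
  simpa using sq_sum_le_card_mul_sum_sq (s := Finset.univ) (f := fun i => ‖x i‖)

lemma norm_le_of_forall_norm_le {c : ℝ} (hc : 0 ≤ c) (x y : Profile n)
    (h : ∀ i, ‖x i‖ ≤ c * ‖y i‖) : ‖x‖ ≤ c * ‖y‖ := by
  refine abs_le_of_sq_le_sq' ?_ (by positivity) |>.2
  rw [mul_pow, PiLp.norm_sq_eq_of_L2, PiLp.norm_sq_eq_of_L2, Finset.mul_sum]
  refine Finset.sum_le_sum fun i _ => ?_
  rw [← mul_pow]
  exact pow_le_pow_left₀ (norm_nonneg _) (h i) 2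

end Replace

/-! ### The smoothed game: gradients, smooth potential, decrease per step -/

namespace Game

variable {N : ℕ} {n : Fin N → ℕ} {Ξ : Type*} [MeasurableSpace Ξ] {G : Game n Ξ}
  {L : Fin N → ℝ≥0} {η : ℝ} {P : Profile n → ℝ}

/-- A regular game with nonempty compact strategy space and positive smoothing parameter. -/
structure Admissible (G : Game n Ξ) (L : Fin N → ℝ≥0) (η : ℝ) : Prop extends G.Regular L η where
  eta_pos : 0 < η
  compact : IsCompact G.feas
  nonempty : G.feas.Nonempty

lemma convex_feas (hG : G.Regular L η) : Convex ℝ G.feas := by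
  intro x hx y hy a b ha hb hab i
  exact hG.convex i (hx i) (hy i) ha hb hab

lemma repl_mem_feas {x : Profile n} (hx : x ∈ G.feas) {i : Fin N} {y : Strat (n i)}
    (hy : y ∈ G.X i) : repl x i y ∈ G.feas := by
  intro j
  by_cases h : j = i
  · subst h
    rwa [repl_apply_self]
  · rw [repl_apply_of_ne _ h]
    exact hx j

lemma Admissible.nonempty_strategies (hG : G.Admissible L η) (i : Fin N) : (G.X i).Nonempty :=
  let ⟨x, hx⟩ := hG.nonempty
  ⟨x i, hx i⟩

/-- The projection onto `X` acts on each player separately. -/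
lemma Admissible.proj_feas (hG : G.Admissible L η) (x : Profile n) :
    proj G.feas x = WithLp.toLp 2 fun i => proj (G.X i) (x i) := by
  refine eq_proj_of_inner_le hG.compact.isClosed (convex_feas hG.toRegular) (fun i => ?_) fun z hz => ?_
  · exact proj_mem (hG.nonempty_strategies i) (hG.closed i) (hG.convex i) _
  · rw [PiLp.inner_apply]
    refine Finset.sum_nonpos fun i _ => ?_
    exact inner_sub_proj_le (hG.nonempty_strategies i) (hG.closed i) (hG.convex i) _ (hz i)

/-- A common neighbourhood on which the sampled and the expected `h_i` are Lipschitz. -/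
lemma Regular.exists_lipschitzOn (hG : G.Regular L η) (i : Fin N) :
    ∃ U : Set (Strat (n i)), IsOpen U ∧ (∀ y ∈ G.X i, Metric.closedBall y η ⊆ U) ∧
      (∀ ξ, LipschitzOnWith (L i) (fun y => G.hS i y ξ) U) ∧
      (∀ y ∈ U, Integrable (G.hS i y) G.law) ∧ LipschitzOnWith (L i) (G.h i) U := by
  obtain ⟨U, hU, hsub, hlip, hint⟩ := hG.lipschitz_h i
  have := hG.prob
  refine ⟨U, hU, fun y hy => (Metric.closedBall_subset_cthickening hy η).trans hsub, hlip, hint, ?_⟩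
  refine LipschitzOnWith.of_dist_le_mul fun y hy z hz => ?_
  rw [dist_eq_norm, dist_eq_norm, h, h, ← integral_sub (hint y hy) (hint z hz)]
  have := norm_integral_le_of_norm_le_const (μ := G.law) (f := fun ξ => G.hS i y ξ - G.hS i z ξ)
    (C := L i * ‖y - z‖) (Filter.Eventually.of_forall fun ξ => (hlip ξ).norm_sub_le hy hz)
  simpa using this

lemma Admissible.hasGradientAt_smoothing_h (hG : G.Admissible L η) (i : Fin N) {y : Strat (n i)}
    (hy : y ∈ G.X i) : HasGradientAt (smoothing η (G.h i)) (smoothingGrad η (G.h i) y) y := by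
  obtain ⟨U, hU, hsub, -, -, hlip⟩ := hG.exists_lipschitzOn i
  exact hasGradientAt_smoothing_of_lipschitzOn (hG.dim_pos i) hG.eta_pos hU hlip (hsub y hy)

lemma Admissible.hasGradientAt_fη (hG : G.Admissible L η) (hu : G.Unbiased) {x : Profile n}
    (hx : x ∈ G.feas) (i : Fin N) :
    HasGradientAt (fun y => G.fη η i (repl x i y))
      (smoothingGrad η (G.h i) (x i) + partialGrad i (G.m i) x) (x i) := by
  have h1 := hG.hasGradientAt_smoothing_h i (hx i)
  have h2 := (hu i x hx).1.hasGradientAt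
  have h3 := h1.hasFDerivAt.add h2.hasFDerivAt
  rw [hasGradientAt_iff_hasFDerivAt, map_add]
  refine h3.congr_of_eventuallyEq (Filter.Eventually.of_forall fun y => ?_)
  simp only [fη, repl_apply_self, Pi.add_apply]

lemma Admissible.Fη_apply (hG : G.Admissible L η) (hu : G.Unbiased) {x : Profile n}
    (hx : x ∈ G.feas) (i : Fin N) :
    G.Fη η x i = smoothingGrad η (G.h i) (x i) + partialGrad i (G.m i) x :=
  (hG.hasGradientAt_fη hu hx i).gradient

/-- A gradient of the potential relative to `X` agrees with `F^η` in all feasible directions. -/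
lemma Admissible.inner_gradient_eq (hG : G.Admissible L η) (hu : G.Unbiased)
    (hP : G.IsPotential (G.fη η) (G.Pη η P)) {x : Profile n} (hx : x ∈ G.feas) {g : Profile n}
    (hg : HasGradientWithinAt (G.Pη η P) g G.feas x) {y : Profile n} (hy : y ∈ G.feas) :
    inner ℝ g (y - x) = inner ℝ (G.Fη η x) (y - x) := by
  have key : ∀ i, inner ℝ (g i) (y i - x i) = inner ℝ (G.Fη η x i) (y i - x i) := by
    intro i
    let c : ℝ → Strat (n i) := fun t => x i + t • (y i - x i)
    have hc : ∀ t ∈ Icc (0 : ℝ) 1, c t ∈ G.X i := fun t ht =>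
      (hG.convex i).add_smul_sub_mem (hx i) (hy i) ht
    have hcd : HasDerivAt c (y i - x i) 0 := by
      have h := ((hasDerivAt_id (0 : ℝ)).smul_const (y i - x i)).const_add (x i)
      rwa [one_smul] at h
    have hc0 : c 0 = x i := by simp [c]
    have hrd : HasDerivAt (fun t => repl x i (c t)) (repl x i (y i) - x) 0 := by
      have he : (fun t => repl x i (c t)) = fun t : ℝ => x + t • (repl x i (y i) - x) := by
        ext t : 1
        rw [repl_sub, ← sub_eq_iff_eq_add', repl_sub]
        ext j : 1
        by_cases h : j = i
        · subst h
          simp [c]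
        · simp [h]
      rw [he]
      have h := ((hasDerivAt_id (0 : ℝ)).smul_const (repl x i (y i) - x)).const_add x
      rwa [one_smul] at h
    have h1 : HasDerivWithinAt (fun t => G.Pη η P (repl x i (c t))) (inner ℝ g (repl x i (y i) - x))
        (Icc 0 1) 0 := by
      have hg' : HasFDerivWithinAt (G.Pη η P) (InnerProductSpace.toDual ℝ _ g) G.feas
          (repl x i (c 0)) := by
        rw [hc0, repl_self]
        exact hg.hasFDerivWithinAt
      exact hg'.comp_hasDerivWithinAt (0 : ℝ) hrd.hasDerivWithinAt
        fun t ht => repl_mem_feas hx (hc t ht)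
    have h2 : HasDerivWithinAt (fun t => G.fη η i (repl x i (c t)))
        (inner ℝ (G.Fη η x i) (y i - x i)) (Icc 0 1) 0 := by
      have hf : HasFDerivAt (fun y => G.fη η i (repl x i y))
          (InnerProductSpace.toDual ℝ _ (G.Fη η x i)) (c 0) := by
        rw [hc0, hG.Fη_apply hu hx i]
        exact (hG.hasGradientAt_fη hu hx i).hasFDerivAt
      exact (hf.comp_hasDerivAt (0 : ℝ) hcd).hasDerivWithinAt
    have h3 : HasDerivWithinAt (fun t => G.Pη η P (repl x i (c t)))
        (inner ℝ (G.Fη η x i) (y i - x i)) (Icc 0 1) 0 := by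
      -- Along the segment of player `i` the potential and `f_i^η` differ by a constant. Only the
      -- feasible part `[0, 1]` is available, hence the derivative within the interval.
      have h4 := h2.add_const (G.Pη η P (repl x i (c 0)) - G.fη η i (repl x i (c 0)))
      refine h4.congr (fun t ht => ?_) ?_
      · have := hP i x hx (c t) (hc t ht) (c 0) (hc 0 ⟨le_rfl, zero_le_one⟩)
        linarith
      · ring
    have hu1 : UniqueDiffWithinAt ℝ (Icc (0 : ℝ) 1) 0 :=
      uniqueDiffOn_Icc zero_lt_one 0 ⟨le_rfl, zero_le_one⟩
    rw [← inner_repl_sub]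
    exact hu1.eq_deriv _ h1 h3
  rw [PiLp.inner_apply, PiLp.inner_apply]
  exact Finset.sum_congr rfl fun i _ => key i

lemma Admissible.isSmoothOn_Pη (hG : G.Admissible L η) (hN : 1 ≤ N) {Lm1 : ℝ≥0}
    (hPm : IsSmoothOn Lm1 (G.Pm P) G.feas) :
    IsSmoothOn (smoothConst n L Lm1 η) (G.Pη η P) G.feas := by
  obtain ⟨g, hg, hgL⟩ := hPm
  let s : Profile n → Profile n := fun x => WithLp.toLp 2 fun i => smoothingGrad η (G.h i) (x i)
  have hη := hG.eta_pos
  refine ⟨fun x => g x + s x, fun x hx => ?_, fun x hx y hy => ?_⟩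
  · have h1 : ∀ i : Fin N, HasFDerivAt (fun z : Profile n => smoothing η (G.h i) (z i))
        ((InnerProductSpace.toDual ℝ _ (smoothingGrad η (G.h i) (x i))).comp
          (PiLp.proj 2 (fun i => Strat (n i)) i : Profile n →L[ℝ] Strat (n i))) x := by
      intro i
      let p : Profile n →L[ℝ] Strat (n i) := PiLp.proj 2 (fun i => Strat (n i)) i
      have hf : HasFDerivAt (smoothing η (G.h i))
          (InnerProductSpace.toDual ℝ _ (smoothingGrad η (G.h i) (x i))) (p x) :=
        (hG.hasGradientAt_smoothing_h i (hx i)).hasFDerivAt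
      exact hf.comp x p.hasFDerivAt
    have h2 := HasFDerivAt.fun_sum (u := Finset.univ) fun i _ => h1 i
    have h3 := (hg x hx).hasFDerivWithinAt.add h2.hasFDerivWithinAt
    rw [hasGradientWithinAt_iff_hasFDerivWithinAt]
    refine h3.congr_fderiv ?_
    ext z
    rw [map_add]
    simp only [add_apply, sum_apply, InnerProductSpace.toDual_apply_apply, ContinuousLinearMap.comp_apply,
      PiLp.proj_apply]
    rw [PiLp.inner_apply (s x)]
  · have h1 := hgL x hx y hy
    have hc : 0 ≤ Lmax L * √(nmax n) / η := by
      have := lmax_nonneg L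
      positivity
    have h2 : ‖s x - s y‖ ≤ Lmax L * √(nmax n) / η * ‖x - y‖ := by
      refine norm_le_of_forall_norm_le hc _ _ fun i => ?_
      obtain ⟨U, hU, hsub, -, -, hlip⟩ := hG.exists_lipschitzOn i
      refine (norm_smoothingGrad_sub_le_of_lipschitzOn (hG.dim_pos i) hη hlip (hsub _ (hx i))
        (hsub _ (hy i))).trans ?_
      have h3 := le_lmax L i
      have h4 := le_nmax n i
      have h5 := lmax_nonneg L
      change _ ≤ _ * ‖x i - y i‖
      gcongr
    -- The gradient of the separable part acts blockwise and needs no `√N`; the factor in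
    -- `smoothConst` is slack.
    have h3 : Lmax L * √(nmax n) / η ≤ Lmax L * √(nmax n) * √(N : ℝ) / η := by
      have h5 := lmax_nonneg L
      have h6 : 1 ≤ √(N : ℝ) := Real.one_le_sqrt.2 (by exact_mod_cast hN)
      calc _ ≤ Lmax L * √(nmax n) / η * √(N : ℝ) := le_mul_of_one_le_right hc h6
        _ = _ := by ring
    have h4 : g x + s x - (g y + s y) = (g x - g y) + (s x - s y) := by abel
    rw [h4, smoothConst, add_mul]
    refine (norm_add_le _ _).trans (add_le_add h1 (h2.trans ?_))
    gcongr

/-- Smoothing preserves each Lipschitz constant; Cauchy–Schwarz over the players costs `√N`. -/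
lemma Admissible.Pη_sub_le (hG : G.Admissible L η) {Lm0 : ℝ≥0}
    (hPm : LipschitzOnWith Lm0 (G.Pm P) G.feas) {x y : Profile n} (hx : x ∈ G.feas)
    (hy : y ∈ G.feas) :
    G.Pη η P x - G.Pη η P y ≤ (Lm0 + Lmax L * √(N : ℝ)) * ‖x - y‖ := by
  have h1 : G.Pm P x - G.Pm P y ≤ Lm0 * ‖x - y‖ :=
    (le_abs_self _).trans (hPm.norm_sub_le hx hy)
  have h2 : ∑ i, smoothing η (G.h i) (x i) - ∑ i, smoothing η (G.h i) (y i) ≤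
      Lmax L * (√(N : ℝ) * ‖x - y‖) := by
    rw [← Finset.sum_sub_distrib]
    refine le_trans ?_ (mul_le_mul_of_nonneg_left (sum_norm_le (x - y)) (lmax_nonneg L))
    rw [Finset.mul_sum]
    refine Finset.sum_le_sum fun i _ => ?_
    obtain ⟨U, hU, hsub, -, -, hlip⟩ := hG.exists_lipschitzOn i
    refine (le_abs_self _).trans ((abs_smoothing_sub_le_of_lipschitzOn hG.eta_pos hlip
      (hsub _ (hx i)) (hsub _ (hy i))).trans ?_)
    change _ ≤ _ * ‖x i - y i‖
    gcongr
    exact le_lmax L i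
  simp only [Pη]
  linarith

lemma Admissible.Pη_sub_le_diam (hG : G.Admissible L η) {Lm0 : ℝ≥0}
    (hPm : LipschitzOnWith Lm0 (G.Pm P) G.feas) {x y : Profile n} (hx : x ∈ G.feas)
    (hy : y ∈ G.feas) :
    G.Pη η P x - G.Pη η P y ≤ (Lm0 + Lmax L * √(N : ℝ)) * Metric.diam G.feas := by
  refine (hG.Pη_sub_le hPm hx hy).trans ?_
  have := lmax_nonneg L
  gcongr
  rw [← dist_eq_norm]
  exact Metric.dist_le_diam_of_mem hG.compact.isBounded hx hy

lemma Admissible.gap_le (hG : G.Admissible L η) {Lm0 : ℝ≥0}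
    (hPm : LipschitzOnWith Lm0 (G.Pm P) G.feas) :
    G.gap η P ≤ (Lm0 + Lmax L * √(N : ℝ)) * Metric.diam G.feas := by
  have hne : (G.Pη η P '' G.feas).Nonempty := hG.nonempty.image _
  rw [gap, sub_le_iff_le_add]
  refine csSup_le hne ?_
  rintro _ ⟨x, hx, rfl⟩
  rw [← sub_le_iff_le_add']
  refine le_csInf hne ?_
  rintro _ ⟨y, hy, rfl⟩
  have := hG.Pη_sub_le_diam hPm hx hy
  linarith

lemma Admissible.Pη_sub_le_gap (hG : G.Admissible L η) {Lm0 : ℝ≥0}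
    (hPm : LipschitzOnWith Lm0 (G.Pm P) G.feas) {x y : Profile n} (hx : x ∈ G.feas)
    (hy : y ∈ G.feas) : G.Pη η P x - G.Pη η P y ≤ G.gap η P := by
  have hb : BddAbove (G.Pη η P '' G.feas) := by
    refine ⟨G.Pη η P y + (Lm0 + Lmax L * √(N : ℝ)) * Metric.diam G.feas, ?_⟩
    rintro _ ⟨z, hz, rfl⟩
    linarith [hG.Pη_sub_le_diam hPm hz hy]
  have hb' : BddBelow (G.Pη η P '' G.feas) := by
    refine ⟨G.Pη η P y - (Lm0 + Lmax L * √(N : ℝ)) * Metric.diam G.feas, ?_⟩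
    rintro _ ⟨z, hz, rfl⟩
    linarith [hG.Pη_sub_le_diam hPm hy hz]
  exact sub_le_sub (le_csSup hb ⟨x, hx, rfl⟩) (csInf_le hb' ⟨y, hy, rfl⟩)

/-- The projected step of all players from `x` along the directions `w_i`. -/
noncomputable def step (G : Game n Ξ) (γ : ℝ) (x w : Profile n) : Profile n :=
  WithLp.toLp 2 fun i => proj (G.X i) (x i - γ • w i)

lemma Admissible.step_eq (hG : G.Admissible L η) (γ : ℝ) (x w : Profile n) :
    G.step γ x w = proj G.feas (x - γ • w) := by
  rw [hG.proj_feas]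
  rfl

lemma Admissible.step_mem (hG : G.Admissible L η) (γ : ℝ) (x w : Profile n) :
    G.step γ x w ∈ G.feas := by
  rw [hG.step_eq]
  exact proj_mem hG.nonempty hG.compact.isClosed (convex_feas hG.toRegular) _

/-- Decrease of the potential along one inexact step. -/
lemma Admissible.norm_residual_sq_le (hG : G.Admissible L η) (hu : G.Unbiased)
    (hP : G.IsPotential (G.fη η) (G.Pη η P)) {Lη : ℝ} (hLη : 0 < Lη)
    (hs : IsSmoothOn Lη (G.Pη η P) G.feas) {x : Profile n} (hx : x ∈ G.feas) (w : Profile n) :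
    ‖G.residual η (1 / (2 * Lη)) x‖ ^ 2 ≤
      16 * Lη * (G.Pη η P x - G.Pη η P (G.step (1 / (2 * Lη)) x w)) +
        6 * ‖w - G.Fη η x‖ ^ 2 := by
  obtain ⟨g, hg, hgL⟩ := hs
  have hK := convex_feas hG.toRegular
  have hmem := hG.step_mem (1 / (2 * Lη)) x w
  refine RSRSG.norm_residual_sq_le hG.nonempty hG.compact.isClosed hK hLη hx _ _ ?_
  rw [← hG.step_eq, ← hG.inner_gradient_eq hu hP hx (hg x hx) hmem]
  exact le_add_inner_of_lipschitz_gradient hK hg hgL hx hmem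

end Game

/-! ### Measurability of partial gradients -/

section PartialGradMeasurable

variable {N : ℕ} {n : Fin N → ℕ}

/-- Each coordinate is a limit of measurable difference quotients. Point and sample vary together
because the iterates are random; the abstract domain `α` allows restriction to `X`, where
differentiability is known. -/
lemma measurable_partialGrad {α Ξ' : Type*} [MeasurableSpace α] [MeasurableSpace Ξ'] (i : Fin N)
    {f : Profile n → Ξ' → ℝ} (hf : Measurable (Function.uncurry f)) {x : α → Profile n} {s : α → Ξ'}
    (hx : Measurable x) (hs : Measurable s)
    (hd : ∀ a, DifferentiableAt ℝ (fun y => f (repl (x a) i y) (s a)) (x a i)) :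
    Measurable fun a => partialGrad i (fun z => f z (s a)) (x a) := by
  let e : Fin (n i) → Strat (n i) := fun j => EuclideanSpace.basisFun (Fin (n i)) ℝ j
  let t : ℕ → ℝ := fun k => 1 / ((k : ℝ) + 1)
  let D : ℕ → α → Strat (n i) := fun k a => WithLp.toLp 2 fun j =>
    (t k)⁻¹ * (f (x a + t k • WithLp.toLp 2 (Pi.single i (e j))) (s a) - f (x a) (s a))
  have hD : ∀ k, Measurable (D k) := by
    intro k
    refine (WithLp.measurable_toLp 2 _).comp (measurable_pi_lambda _ fun j => ?_)
    refine Measurable.const_mul (Measurable.sub ?_ ?_) _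
    · exact hf.comp ((hx.add_const _).prodMk hs)
    · exact hf.comp (hx.prodMk hs)
  refine measurable_of_tendsto_metrizable hD (tendsto_pi_nhds.2 fun a => ?_)
  have hseq : Filter.Tendsto t Filter.atTop (𝓝[≠] 0) :=
    tendsto_nhdsWithin_iff.2 ⟨tendsto_one_div_add_atTop_nhds_zero_nat,
      Filter.Eventually.of_forall fun k => (by positivity : (0 : ℝ) < 1 / ((k : ℝ) + 1)).ne'⟩
  set g := partialGrad i (fun z => f z (s a)) (x a)
  have hgr : HasGradientAt (fun y => f (repl (x a) i y) (s a)) g (x a i) :=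
    (hd a).hasGradientAt
  have hcoord : ∀ j, Filter.Tendsto (fun k => (D k a) j) Filter.atTop (𝓝 (g j)) := by
    intro j
    have h1 := (hgr.hasFDerivAt.hasLineDerivAt (e j)).tendsto_slope_zero.comp hseq
    have h2 : InnerProductSpace.toDual ℝ (Strat (n i)) g (e j) = g j := by
      rw [InnerProductSpace.toDual_apply_apply, real_inner_comm]
      simp [e, EuclideanSpace.inner_single_left]
    rw [h2] at h1
    refine h1.congr fun k => ?_
    have h3 : repl (x a) i (x a i + t k • e j) =
        (x a) + t k • WithLp.toLp 2 (Pi.single i (e j)) := by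
      rw [← sub_eq_iff_eq_add', repl_sub]
      ext l : 1
      by_cases h : l = i
      · subst h
        simp
      · simp [h]
    simp only [Function.comp, D, h3, repl_self, smul_eq_mul]
  have := ((PiLp.continuous_toLp 2 fun _ : Fin (n i) => ℝ).tendsto (fun j => g j)).comp
    (tendsto_pi_nhds.2 hcoord)
  exact this

end PartialGradMeasurable

/-! ### Variance of sums of independent vectors -/

section PairwiseOrthogonal

variable {Ω E : Type*} [MeasurableSpace Ω] {μ : Measure Ω} [NormedAddCommGroup E]
  [InnerProductSpace ℝ E] [CompleteSpace E] [MeasurableSpace E] [BorelSpace E]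

/-- The second moment of a sum of independent centered vectors. -/
lemma integral_norm_sum_sq_le [IsProbabilityMeasure μ] {ι : Type*} [Fintype ι] {Y : ι → Ω → E}
    (hind : Pairwise fun a b => IndepFun (Y a) (Y b) μ) (hL : ∀ a, MemLp (Y a) 2 μ)
    (h0 : ∀ a, ∫ ω, Y a ω ∂μ = 0) {c : ℝ} (hc : ∀ a, ∫ ω, ‖Y a ω‖ ^ 2 ∂μ ≤ c) :
    ∫ ω, ‖∑ a, Y a ω‖ ^ 2 ∂μ ≤ Fintype.card ι * c := by
  classical
  have hI : ∀ a, Integrable (Y a) μ := fun a => (hL a).integrable one_le_two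
  have hij : ∀ a b, Integrable (fun ω => inner ℝ (Y a ω) (Y b ω)) μ := by
    intro a b
    by_cases h : a = b
    · subst h
      simp_rw [real_inner_self_eq_norm_sq]
      exact (hL a).integrable_norm_pow two_ne_zero
    · exact (hind h).integrable_bilin (hI a) (hI b) (innerSL ℝ)
  have hpt : ∀ ω, ‖∑ a, Y a ω‖ ^ 2 = ∑ a, ∑ b, inner ℝ (Y a ω) (Y b ω) := fun ω => by
    rw [← real_inner_self_eq_norm_sq, sum_inner]
    simp_rw [inner_sum]
  simp_rw [hpt]
  rw [integral_finsetSum _ fun a _ => integrable_finsetSum _ fun b _ => hij a b]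
  have hrow : ∀ a, ∫ ω, ∑ b, inner ℝ (Y a ω) (Y b ω) ∂μ ≤ c := by
    intro a
    rw [integral_finsetSum _ fun b _ => hij a b, Finset.sum_eq_single a]
    · simp_rw [real_inner_self_eq_norm_sq]
      exact hc a
    · intro b _ hb
      have : ∫ ω, inner ℝ (Y a ω) (Y b ω) ∂μ = inner ℝ (∫ ω, Y a ω ∂μ) (∫ ω, Y b ω ∂μ) :=
        (hind hb.symm).integral_bilin (hI a) (hI b) (innerSL ℝ)
      rw [this, h0, inner_zero_left]
    · simp
  calc _ ≤ ∑ _a : ι, c := Finset.sum_le_sum fun a _ => hrow a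
    _ = _ := by simp

end PairwiseOrthogonal

/-! ### Second moments in inner product spaces -/

section Moments

variable {α E : Type*} [MeasurableSpace α] {ρ : Measure α} [NormedAddCommGroup E]
  [InnerProductSpace ℝ E]

lemma integral_norm_sub_integral_sq_le [CompleteSpace E] [IsProbabilityMeasure ρ] {A : α → E}
    (hA : MemLp A 2 ρ) {a : E} (ha : ∫ s, A s ∂ρ = a) :
    ∫ s, ‖A s - a‖ ^ 2 ∂ρ ≤ ∫ s, ‖A s‖ ^ 2 ∂ρ := by
  have hAI : Integrable A ρ := hA.integrable one_le_two
  have h1 : ∀ s, ‖A s - a‖ ^ 2 = ‖A s‖ ^ 2 + (‖a‖ ^ 2 - 2 * inner ℝ a (A s)) := fun s => by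
    rw [norm_sub_sq_real, real_inner_comm]
    ring
  have h2 : Integrable (fun s => ‖A s‖ ^ 2) ρ := hA.integrable_norm_pow two_ne_zero
  have h3 : Integrable (fun s => 2 * inner ℝ a (A s)) ρ := (hAI.const_inner a).const_mul 2
  have h4 : Integrable (fun s => ‖a‖ ^ 2 - 2 * inner ℝ a (A s)) ρ := (integrable_const _).sub h3
  simp_rw [h1]
  rw [integral_add h2 h4, integral_sub (integrable_const _) h3, integral_const_mul,
    integral_inner hAI, ha, real_inner_self_eq_norm_sq]
  simp only [integral_const, probReal_univ, one_smul]
  linarith [sq_nonneg ‖a‖]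

lemma moments_add_of_centered [IsFiniteMeasure ρ] {A B : α → E} (hA : MemLp A 2 ρ) (hB : MemLp B 2 ρ)
    (hA0 : ∫ s, A s ∂ρ = 0) (hB0 : ∫ s, B s ∂ρ = 0) :
    MemLp (fun s => A s + B s) 2 ρ ∧ ∫ s, A s + B s ∂ρ = 0 ∧
      ∫ s, ‖A s + B s‖ ^ 2 ∂ρ ≤ 2 * ∫ s, ‖A s‖ ^ 2 ∂ρ + 2 * ∫ s, ‖B s‖ ^ 2 ∂ρ := by
  have hAs : Integrable (fun s => ‖A s‖ ^ 2) ρ := hA.integrable_norm_pow two_ne_zero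
  have hBs : Integrable (fun s => ‖B s‖ ^ 2) ρ := hB.integrable_norm_pow two_ne_zero
  refine ⟨hA.add hB, ?_, ?_⟩
  · rw [integral_add (hA.integrable one_le_two) (hB.integrable one_le_two), hA0, hB0, add_zero]
  · rw [← integral_const_mul, ← integral_const_mul, ← integral_add (hAs.const_mul 2) (hBs.const_mul 2)]
    refine integral_mono_of_nonneg (Filter.Eventually.of_forall fun s => by positivity)
      ((hAs.const_mul 2).add (hBs.const_mul 2)) (Filter.Eventually.of_forall fun s => ?_)
    have := norm_add_le (A s) (B s)
    simp only
    nlinarith [norm_nonneg (A s + B s), sq_nonneg (‖A s‖ - ‖B s‖)]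

end Moments

/-! ### Bias and variance of the sampled gradient -/

namespace Game

variable {N : ℕ} {n : Fin N → ℕ} {Ξ : Type*} [MeasurableSpace Ξ] {G : Game n Ξ}
  {L : Fin N → ℝ≥0} {η : ℝ} {P : Profile n → ℝ}

lemma Regular.differentiableAt_mS (hG : G.Regular L η) (i : Fin N) {x : Profile n}
    (hx : x ∈ G.feas) (ξ : Ξ) :
    DifferentiableAt ℝ (fun y => G.mS i (repl x i y) ξ) (x i) := by
  obtain ⟨O, hO, hsub, hcd, -⟩ := hG.contDiff_m i x hx
  exact ((hcd ξ).contDiffAt (hO.mem_nhds (hsub (hx i)))).differentiableAt one_ne_zero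

lemma Regular.measurable_partialGrad_m (hG : G.Regular L η) (hu : G.Unbiased) (i : Fin N) :
    Measurable fun x : G.feas => partialGrad i (G.m i) x := by
  have := hG.prob
  have hm : Measurable (G.m i) :=
    (hG.meas_m i).stronglyMeasurable.integral_prod_right'.measurable
  -- A deterministic function is treated as one with a trivial random parameter.
  have hm' : Measurable (Function.uncurry fun (z : Profile n) (_ : Unit) => G.m i z) :=
    hm.comp measurable_fst
  exact measurable_partialGrad i hm' measurable_subtype_coe (measurable_const (a := ()))
    fun x => (hu i x x.2).1

lemma Admissible.measurable_smoothingGrad (hG : G.Admissible L η) (i : Fin N) :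
    Measurable fun x : G.feas => smoothingGrad η (G.h i) (x.1 i) := by
  obtain ⟨U, hU, hsub, -, -, hlip⟩ := hG.exists_lipschitzOn i
  obtain ⟨h', hL', he⟩ := hlip.extend_real
  have h1 : ∀ x : G.feas, smoothingGrad η (G.h i) (x.1 i) = smoothingGrad η h' (x.1 i) := fun x =>
    smoothingGrad_congr hG.eta_pos he (hsub _ (x.2 i))
  simp_rw [h1]
  have h2 : LipschitzWith (Real.toNNReal (L i * √(n i) / η)) (smoothingGrad η h') := by
    refine LipschitzWith.of_dist_le_mul fun x y => ?_
    have := hG.eta_pos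
    rw [dist_eq_norm, dist_eq_norm, Real.coe_toNNReal _ (by positivity)]
    exact norm_smoothingGrad_sub_le (hG.dim_pos i) hG.eta_pos hL' x y
  exact h2.continuous.measurable.comp (by fun_prop)

lemma Admissible.measurable_Fη (hG : G.Admissible L η) (hu : G.Unbiased) :
    Measurable fun x : G.feas => G.Fη η x := by
  have h : (fun x : G.feas => G.Fη η x) = fun x : G.feas =>
      WithLp.toLp 2 fun i => smoothingGrad η (G.h i) (x.1 i) + partialGrad i (G.m i) x := by
    funext x
    refine PiLp.ext fun i => ?_
    exact hG.Fη_apply hu x.2 i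
  rw [h]
  exact (WithLp.measurable_toLp 2 _).comp (measurable_pi_lambda _ fun i =>
    (hG.measurable_smoothingGrad i).add (hG.measurable_partialGrad_m hu i))

lemma Admissible.measurable_residual (hG : G.Admissible L η) (hu : G.Unbiased) (γ : ℝ) :
    Measurable fun x : G.feas => G.residual η γ x := by
  have h1 := hG.measurable_Fη hu
  have h2 := (continuous_proj hG.nonempty hG.compact.isClosed (convex_feas hG.toRegular)).measurable
  exact (measurable_subtype_coe.sub
    (h2.comp (measurable_subtype_coe.sub (h1.const_smul γ)))).const_smul (1 / γ)

/-- A point of `X` and a projection onto `X` are within the diameter; this boundedness gives all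
integrability of the residual along a run. -/
lemma Admissible.norm_residual_le (hG : G.Admissible L η) {γ : ℝ} (hγ : 0 < γ) {x : Profile n}
    (hx : x ∈ G.feas) : ‖G.residual η γ x‖ ≤ 1 / γ * Metric.diam G.feas := by
  rw [residual, norm_smul, Real.norm_of_nonneg (by positivity), ← dist_eq_norm]
  gcongr
  exact Metric.dist_le_diam_of_mem hG.compact.isBounded hx
    (proj_mem hG.nonempty hG.compact.isClosed (convex_feas hG.toRegular) _)

lemma sampleGrad_eq (η : ℝ) (x : Profile n) (i : Fin N) (s : Ξ × Strat (n i)) :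
    G.sampleGrad η x i s = twoPointGrad η (fun y => G.hS i y s.1) (x i) s.2 +
      partialGrad i (fun z => G.mS i z s.1) x := rfl

lemma Regular.measurable_twoPointGrad (hG : G.Regular L η) (i : Fin N) {α : Type*}
    [MeasurableSpace α] {y : α → Strat (n i)} {s : α → Ξ × Strat (n i)} (hy : Measurable y)
    (hs : Measurable s) :
    Measurable fun a => twoPointGrad η (fun z => G.hS i z (s a).1) (y a) (s a).2 := by
  have h1 : Measurable fun a => G.hS i (y a + (s a).2) (s a).1 :=
    (hG.meas_h i).comp ((hy.add hs.snd).prodMk hs.fst)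
  have h2 : Measurable fun a => G.hS i (y a - (s a).2) (s a).1 :=
    (hG.meas_h i).comp ((hy.sub hs.snd).prodMk hs.fst)
  have h3 : Measurable fun a => ‖(s a).2‖ := hs.snd.norm
  have h4 : Measurable fun a => (1 / ‖(s a).2‖) • (s a).2 := (h3.const_div 1).fun_smul hs.snd
  have h5 : Measurable fun a => (n i : ℝ) / (2 * η) *
      (G.hS i (y a + (s a).2) (s a).1 - G.hS i (y a - (s a).2) (s a).1) :=
    (h1.sub h2).const_mul ((n i : ℝ) / (2 * η))
  exact h5.fun_smul h4

lemma Regular.measurable_sampleGrad (hG : G.Regular L η) (i : Fin N) {α : Type*}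
    [MeasurableSpace α] {x : α → G.feas} {s : α → Ξ × Strat (n i)} (hx : Measurable x)
    (hs : Measurable s) : Measurable fun a => G.sampleGrad η (x a) i (s a) := by
  have h1 : Measurable fun a => (x a).1 i := by fun_prop
  have h3 : Measurable fun a => partialGrad i (fun z => G.mS i z (s a).1) (x a) :=
    measurable_partialGrad i (hG.meas_m i) (measurable_subtype_coe.comp hx) hs.fst
      fun a => hG.differentiableAt_mS i (x a).2 _
  exact (hG.measurable_twoPointGrad i h1 hs).fun_add h3

/-- Moments of the two-point estimate with a random function. -/
lemma Admissible.moments_twoPointGrad (hG : G.Admissible L η) (i : Fin N) {y : Strat (n i)}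
    (hy : y ∈ G.X i) {A : Ξ × Strat (n i) → Strat (n i)}
    (hA : A = fun s => twoPointGrad η (fun y => G.hS i y s.1) y s.2) (hAm : Measurable A) :
    MemLp A 2 (G.law.prod (sphereUnif (n i) η)) ∧
      ∫ s, A s ∂G.law.prod (sphereUnif (n i) η) = smoothingGrad η (G.h i) y ∧
      ∫ s, ‖A s‖ ^ 2 ∂G.law.prod (sphereUnif (n i) η) ≤ 16 * √(2 * Real.pi) * L i ^ 2 * n i := by
  have := hG.prob
  have hη := hG.eta_pos
  have hd := hG.dim_pos i
  have := isProbabilityMeasure_sphereUnif hd η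
  obtain ⟨U, hU, hsub, hlipS, hintS, hlip⟩ := hG.exists_lipschitzOn i
  have hxU := hsub _ hy
  have hAb : ∀ᵐ s ∂G.law.prod (sphereUnif (n i) η), ‖A s‖ ≤ n i * L i := by
    have h1 : ∀ᵐ s : Ξ × Strat (n i) ∂G.law.prod (sphereUnif (n i) η), ‖s.2‖ = |η| :=
      Measure.quasiMeasurePreserving_snd.ae (ae_norm_sphereUnif (n i) η)
    filter_upwards [h1] with s hs
    rw [abs_of_pos hη] at hs
    rw [hA]
    exact norm_twoPointGrad_le hη (hlipS s.1) hxU hs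
  have hAL : MemLp A 2 (G.law.prod (sphereUnif (n i) η)) :=
    MemLp.of_bound hAm.aestronglyMeasurable _ hAb
  refine ⟨hAL, ?_, ?_⟩
  -- Averaging over `ξ` first, at fixed `v`, turns the estimate for `h̃_i` into the one for `h_i`.
  -- The second moment uses the opposite order, as the bound holds for every `ξ`.
  · rw [integral_prod_symm _ (hAL.integrable one_le_two), ← integral_twoPointGrad hd hη hlip hxU]
    refine integral_congr_ae ?_
    filter_upwards [ae_norm_sphereUnif (n i) η] with v hv
    rw [abs_of_pos hη] at hv
    simp only [hA, twoPointGrad]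
    rw [integral_smul_const, integral_const_mul, integral_sub (hintS _ (hxU (by simp [hv])))
      (hintS _ (hxU (by simp [hv])))]
    rfl
  · rw [integral_prod _ (hAL.integrable_norm_pow two_ne_zero)]
    calc _ ≤ ∫ _ξ, 16 * √(2 * Real.pi) * (L i : ℝ) ^ 2 * n i ∂G.law := by
          refine integral_mono_of_nonneg (Filter.Eventually.of_forall fun ξ =>
            integral_nonneg fun v => by positivity) (integrable_const _)
            (Filter.Eventually.of_forall fun ξ => ?_)
          rw [hA]
          exact integral_norm_twoPointGrad_sq_le hd hη (hlipS ξ) hxU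
      _ = _ := by simp

/-- Moments of the sampled gradient. -/
lemma Admissible.moments_sampleGrad (hG : G.Admissible L η) (hu : G.Unbiased) {σm : ℝ}
    (hm : G.BoundedMoment σm) (i : Fin N) {x : Profile n} (hx : x ∈ G.feas) :
    MemLp (fun s => G.sampleGrad η x i s - G.Fη η x i) 2 (G.law.prod (sphereUnif (n i) η)) ∧
      ∫ s, G.sampleGrad η x i s - G.Fη η x i ∂G.law.prod (sphereUnif (n i) η) = 0 ∧
      ∫ s, ‖G.sampleGrad η x i s - G.Fη η x i‖ ^ 2 ∂G.law.prod (sphereUnif (n i) η) ≤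
        sigma n L σm ^ 2 := by
  have := hG.prob
  have := isProbabilityMeasure_sphereUnif (hG.dim_pos i) η
  have hAm : Measurable fun s : Ξ × Strat (n i) =>
      twoPointGrad η (fun y => G.hS i y s.1) (x i) s.2 :=
    hG.measurable_twoPointGrad i measurable_const measurable_id
  obtain ⟨A, hA⟩ : ∃ A : Ξ × Strat (n i) → Strat (n i),
    A = fun s => twoPointGrad η (fun y => G.hS i y s.1) (x i) s.2 := ⟨_, rfl⟩
  rw [← hA] at hAm
  obtain ⟨hAL, hAmean, hAsq⟩ := hG.moments_twoPointGrad i (hx i) hA hAm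
  have hF := hG.Fη_apply hu hx i
  obtain ⟨B, hB⟩ : ∃ B : Ξ → Strat (n i), B = fun ξ => partialGrad i (fun z => G.mS i z ξ) x :=
    ⟨_, rfl⟩
  have hsum : (fun s => G.sampleGrad η x i s - G.Fη η x i) = fun s =>
      (A s - smoothingGrad η (G.h i) (x i)) + (B s.1 - partialGrad i (G.m i) x) := by
    ext1 s
    rw [hF, sampleGrad_eq, hA, hB]
    abel
  have hBI : Integrable B G.law := hB ▸ (hu i x hx).2.1
  have hBmean : ∫ ξ, B ξ ∂G.law = partialGrad i (G.m i) x := hB ▸ (hu i x hx).2.2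
  have hBsqI : Integrable (fun ξ => ‖B ξ - partialGrad i (G.m i) x‖ ^ 2) G.law := hB ▸ (hm i x hx).1
  have hBsq : ∫ ξ, ‖B ξ - partialGrad i (G.m i) x‖ ^ 2 ∂G.law ≤ σm ^ 2 := hB ▸ (hm i x hx).2
  simp only [congrFun hsum]
  generalize smoothingGrad η (G.h i) (x i) = a at *
  generalize partialGrad i (G.m i) x = b at *
  have hBL : MemLp (fun ξ => B ξ - b) 2 G.law :=
    (memLp_two_iff_integrable_sq_norm (hBI.sub (integrable_const b)).aestronglyMeasurable).2 hBsqI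
  have hA0 : ∫ s, A s - a ∂G.law.prod (sphereUnif (n i) η) = 0 := by
    rw [integral_sub (hAL.integrable one_le_two) (integrable_const a), hAmean]
    simp
  have hB0 : ∫ s : Ξ × Strat (n i), B s.1 - b ∂G.law.prod (sphereUnif (n i) η) = 0 := by
    rw [integral_fun_fst (fun ξ => B ξ - b), integral_sub hBI (integrable_const b), hBmean]
    simp
  obtain ⟨h1, h2, h3⟩ := moments_add_of_centered (A := fun s => A s - a) (hAL.sub (memLp_const a))
    (hBL.comp_fst (sphereUnif (n i) η)) hA0 hB0
  refine ⟨h1, h2, h3.trans ?_⟩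
  rw [integral_fun_fst (fun ξ => ‖B ξ - b‖ ^ 2), probReal_univ, one_smul]
  have h4 := (integral_norm_sub_integral_sq_le hAL hAmean).trans hAsq
  have h5 := lmax_nonneg L
  have h6 : (0 : ℝ) ≤ nmax n := Nat.cast_nonneg _
  rw [sigma, Real.sq_sqrt (by positivity)]
  have h7 := le_lmax L i
  have h8 := le_nmax n i
  -- Doubling this bound and `σ_m²`, by the inequality for the sum of the two centered parts, gives
  -- exactly `σ²`.
  have h9 : 16 * √(2 * Real.pi) * L i ^ 2 * n i ≤
      16 * √(2 * Real.pi) * Lmax L ^ 2 * nmax n := by gcongr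
  linarith

end Game

/-! ### Freezing independent variables and the random output index -/

section Independence

variable {Ω α β : Type*} [MeasurableSpace Ω] [MeasurableSpace α] [MeasurableSpace β]
  {μ : Measure Ω} [IsProbabilityMeasure μ]

/-- Freezing: bounds on an expectation that hold for every value of an independent variable. -/
lemma lintegral_comp_le_of_indepFun {X : Ω → α} {W : Ω → β} (hX : Measurable X)
    (hW : Measurable W) (h : IndepFun X W μ) {g : α × β → ℝ≥0∞} (hg : Measurable g) {c : ℝ≥0∞}
    (hc : ∀ x, ∫⁻ ω, g (x, W ω) ∂μ ≤ c) : ∫⁻ ω, g (X ω, W ω) ∂μ ≤ c := by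
  have h1 := (indepFun_iff_map_prod_eq_prod_map_map hX.aemeasurable hW.aemeasurable).1 h
  have := Measure.isProbabilityMeasure_map (μ := μ) hX.aemeasurable
  have := Measure.isProbabilityMeasure_map (μ := μ) hW.aemeasurable
  rw [← lintegral_map hg (hX.prodMk hW), h1, lintegral_prod _ hg.aemeasurable]
  calc _ ≤ ∫⁻ _x, c ∂(μ.map X) := by
        refine lintegral_mono fun x => ?_
        rw [lintegral_map (f := fun w => g (x, w)) (hg.comp measurable_prodMk_left) hW]
        exact hc x
    _ = c := by simp

/-- The expectation at an independent, uniformly distributed index. -/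
lemma integral_comp_uniform_index {R : Ω → ℕ} {Z : Ω → α} {T : ℕ} (hT : 1 ≤ T)
    (hR : Measurable R)
    (hlaw : ∀ k ∈ Finset.Icc 1 T, μ.real {ω | R ω = k} = 1 / (T : ℝ))
    (hind : IndepFun R Z μ) {g : ℕ → α → ℝ} (hg : ∀ k, Measurable (g k))
    (hI : ∀ k, Integrable (fun ω => g k (Z ω)) μ) :
    ∫ ω, g (R ω) (Z ω) ∂μ = 1 / (T : ℝ) * ∑ k ∈ Finset.Icc 1 T, ∫ ω, g k (Z ω) ∂μ := by
  have hTR : (T : ℝ) ≠ 0 := by positivity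
  have hms : ∀ k, MeasurableSet {ω | R ω = k} := fun k => hR (measurableSet_singleton k)
  -- The `T` prescribed masses already sum to `1`, so other values of `R` are negligible.
  have hmem : ∀ᵐ ω ∂μ, R ω ∈ Finset.Icc 1 T := by
    have h1 : μ.real (R ⁻¹' (Finset.Icc 1 T : Finset ℕ)) = 1 := by
      have h2 : R ⁻¹' (Finset.Icc 1 T : Finset ℕ) = ⋃ k ∈ Finset.Icc 1 T, {ω | R ω = k} := by
        ext ω
        simp
      rw [h2, measureReal_biUnion_finset]
      · rw [Finset.sum_congr rfl hlaw]
        simp [hTR]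
      · intro a _ b _ hab
        refine Set.disjoint_left.2 fun ω ha hb => hab ?_
        exact (ha : R ω = a).symm.trans hb
      · exact fun k _ => hms k
    have h3 := (prob_compl_eq_zero_iff (hR (Finset.measurableSet (Finset.Icc 1 T)))).2
      ((ENNReal.toReal_eq_one_iff _).1 h1)
    exact h3
  let I : ℕ → ℕ → ℝ := fun k r => if r = k then 1 else 0
  have hIm : ∀ k, Measurable (I k) := fun k => measurable_from_top
  have hIR : ∀ k, ∫ ω, I k (R ω) ∂μ = μ.real {ω | R ω = k} := by
    intro k
    rw [← integral_indicator_one (hms k)]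
    refine integral_congr_ae (Filter.Eventually.of_forall fun ω => ?_)
    simp [I, Set.indicator_apply]
  have hIi : ∀ k, Integrable (fun ω => I k (R ω)) μ := fun k =>
    Integrable.of_bound ((hIm k).comp hR).aestronglyMeasurable 1
      (Filter.Eventually.of_forall fun ω => by simp only [I]; split_ifs <;> simp)
  have hind' : ∀ k, IndepFun (fun ω => I k (R ω)) (fun ω => g k (Z ω)) μ := fun k =>
    hind.comp (hIm k) (hg k)
  have hIg : ∀ k, Integrable (fun ω => I k (R ω) * g k (Z ω)) μ := fun k =>
    (hind' k).integrable_mul (hIi k) (hI k)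
  have h1 : ∫ ω, g (R ω) (Z ω) ∂μ =
      ∫ ω, ∑ k ∈ Finset.Icc 1 T, I k (R ω) * g k (Z ω) ∂μ := by
    refine integral_congr_ae ?_
    filter_upwards [hmem] with ω hω
    simp only [I, ite_mul, one_mul, zero_mul]
    rw [Finset.sum_ite_eq, if_pos hω]
  rw [h1, integral_finsetSum _ fun k _ => hIg k, Finset.mul_sum]
  refine Finset.sum_congr rfl fun k hk => ?_
  rw [← hlaw k hk, ← hIR k]
  exact (hind' k).integral_fun_mul_eq_mul_integral (hIi k).aestronglyMeasurable
    (hI k).aestronglyMeasurable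

lemma sq_integral_le_integral_sq {Y : Ω → ℝ} (hY : MemLp Y 2 μ) :
    (∫ ω, Y ω ∂μ) ^ 2 ≤ ∫ ω, Y ω ^ 2 ∂μ := by
  have := variance_nonneg Y μ
  rw [variance_eq_sub hY] at this
  simpa using this

end Independence

/-! ### The iteration: independence, batch error and expected residual -/

namespace Game

variable {N : ℕ} {n : Fin N → ℕ} {Ξ : Type*} [MeasurableSpace Ξ] {G : Game n Ξ}
  {L : Fin N → ℝ≥0} {η : ℝ} {P : Profile n → ℝ} {S : ℕ}

/-- The averaged sampled gradients of all players. -/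
noncomputable def batchGrad (G : Game n Ξ) (η : ℝ) (x : Profile n)
    (z : ∀ q : Fin N × Fin S, Ξ × Strat (n q.1)) : Profile n :=
  WithLp.toLp 2 fun i => (1 / (S : ℝ)) • ∑ l, G.sampleGrad η x i (z (i, l))

lemma iter_succ (η γ : ℝ) (x₀ : Profile n)
    (z : ∀ p : ℕ × Fin N × Fin S, Ξ × Strat (n p.2.1)) (k : ℕ) :
    G.iter η γ x₀ z (k + 1) =
      G.step γ (G.iter η γ x₀ z k) (G.batchGrad η (G.iter η γ x₀ z k) fun q => z (k, q)) := rfl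

lemma Admissible.iter_mem (hG : G.Admissible L η) (γ : ℝ) {x₀ : Profile n} (hx : x₀ ∈ G.feas)
    (z : ∀ p : ℕ × Fin N × Fin S, Ξ × Strat (n p.2.1)) (k : ℕ) : G.iter η γ x₀ z k ∈ G.feas := by
  cases k with
  | zero => exact hx
  | succ k =>
    rw [iter_succ]
    exact hG.step_mem γ _ _

/-- The `k`-th iterate uses only samples with time index below `k`; this is the source of its
independence from the current batch. -/
lemma iter_congr (η γ : ℝ) (x₀ : Profile n)
    {z z' : ∀ p : ℕ × Fin N × Fin S, Ξ × Strat (n p.2.1)} {k : ℕ}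
    (h : ∀ p, p.1 < k → z p = z' p) : G.iter η γ x₀ z k = G.iter η γ x₀ z' k := by
  induction k with
  | zero => rfl
  | succ k ih =>
    have h1 : (fun q : Fin N × Fin S => z (k, q)) = fun q => z' (k, q) :=
      funext fun q => h _ k.lt_succ_self
    rw [iter_succ, iter_succ, ih fun p hp => h p (hp.trans k.lt_succ_self), h1]

lemma Regular.measurable_batchGrad (hG : G.Regular L η) {α : Type*} [MeasurableSpace α]
    {x : α → G.feas} {z : α → ∀ q : Fin N × Fin S, Ξ × Strat (n q.1)} (hx : Measurable x)
    (hz : Measurable z) : Measurable fun a => G.batchGrad η (x a) (z a) := by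
  refine (WithLp.measurable_toLp 2 _).comp (measurable_pi_lambda _ fun i => ?_)
  have h : ∀ l, Measurable fun a => G.sampleGrad η (x a) i (z a (i, l)) := fun l =>
    hG.measurable_sampleGrad i hx ((measurable_pi_apply _).comp hz)
  exact (Finset.measurable_fun_sum _ fun l _ => h l).const_smul (1 / (S : ℝ))

/-- The iterates as points of the strategy space. -/
noncomputable def Admissible.iterFeas (hG : G.Admissible L η) (γ : ℝ) (x₀ : G.feas)
    (z : ∀ p : ℕ × Fin N × Fin S, Ξ × Strat (n p.2.1)) (k : ℕ) : G.feas :=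
  ⟨G.iter η γ x₀ z k, hG.iter_mem γ x₀.2 z k⟩

lemma Admissible.measurable_iterFeas (hG : G.Admissible L η) (γ : ℝ) (x₀ : G.feas) (k : ℕ) :
    Measurable fun z : ∀ p : ℕ × Fin N × Fin S, Ξ × Strat (n p.2.1) =>
      hG.iterFeas γ x₀ z k := by
  induction k with
  | zero => exact measurable_const (a := x₀)
  | succ k ih =>
    refine Measurable.subtype_mk ?_
    have hW : Measurable fun (z : ∀ p : ℕ × Fin N × Fin S, Ξ × Strat (n p.2.1))
        (q : Fin N × Fin S) => z (k, q) := measurable_pi_lambda _ fun q => measurable_pi_apply _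
    have h1 := hG.measurable_batchGrad ih hW
    have h2 := (continuous_proj hG.nonempty hG.compact.isClosed
      (convex_feas hG.toRegular)).measurable
    have h3 := h2.comp ((measurable_subtype_coe.comp ih).sub (h1.const_smul γ))
    have h4 : (fun z : ∀ p : ℕ × Fin N × Fin S, Ξ × Strat (n p.2.1) =>
        G.iter η γ x₀ z (k + 1)) = fun z => proj G.feas (hG.iterFeas γ x₀ z k -
          γ • G.batchGrad η (hG.iterFeas γ x₀ z k) fun q => z (k, q)) := by
      funext z
      rw [iter_succ, hG.step_eq]
      rfl
    rw [h4]
    exact h3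

section Run

variable {Ω : Type*} [MeasurableSpace Ω] {μ : Measure Ω} {T : ℕ}
  {Z : ∀ p : ℕ × Fin N × Fin S, Ω → Ξ × Strat (n p.2.1)} {R : Ω → ℕ}

/-- The current iterate is independent of the current batch. -/
lemma Admissible.indepFun_iterFeas (hG : G.Admissible L η) (γ : ℝ) (x₀ : G.feas)
    (hrun : G.IsRun η S T μ Z R) (k : ℕ) :
    IndepFun (fun ω => hG.iterFeas γ x₀ (fun p => Z p ω) k)
      (fun ω (q : Fin N × Fin S) => Z (k, q) ω) μ := by
  classical
  have := hrun.prob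
  obtain ⟨ω₀⟩ : Nonempty Ω := μ.nonempty_of_neZero
  let A : Finset (ℕ × Fin N × Fin S) := Finset.range k ×ˢ Finset.univ
  let B : Finset (ℕ × Fin N × Fin S) := {k} ×ˢ Finset.univ
  have hAB : Disjoint A B := by
    refine Finset.disjoint_left.2 fun p hp hp' => ?_
    simp only [A, B, Finset.mem_product, Finset.mem_range, Finset.mem_singleton] at hp hp'
    omega
  have h1 := hrun.indep_Z.indepFun_finset A B hAB hrun.meas_Z
  -- Past samples are padded to a full family by arbitrary constants, so that the iterate becomes a
  -- function of the past alone.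
  let ext : (∀ p : A, Ξ × Strat (n p.1.2.1)) → ∀ p : ℕ × Fin N × Fin S, Ξ × Strat (n p.2.1) :=
    fun r p => if h : p ∈ A then r ⟨p, h⟩ else Z p ω₀
  have hext : Measurable ext := by
    refine measurable_pi_lambda _ fun p => ?_
    by_cases h : p ∈ A
    · simp only [ext, h, dif_pos]
      exact measurable_pi_apply _
    · simp only [ext, h, dif_neg, not_false_eq_true]
      exact measurable_const
  let cur : (∀ p : B, Ξ × Strat (n p.1.2.1)) → ∀ q : Fin N × Fin S, Ξ × Strat (n q.1) :=
    fun r q => r ⟨(k, q), by simp [B]⟩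
  have hcur : Measurable cur := measurable_pi_lambda _ fun q => measurable_pi_apply _
  have h2 := h1.comp ((hG.measurable_iterFeas γ x₀ k).comp hext) hcur
  have h3 : (fun ω => hG.iterFeas γ x₀ (fun p => Z p ω) k) =
      fun ω => hG.iterFeas γ x₀ (ext fun p : A => Z p ω) k := by
    funext ω
    refine Subtype.ext (iter_congr η γ _ fun p hp => ?_)
    have : p ∈ A := by simpa [A] using hp
    simp [ext, this]
  rw [h3]
  exact h2

/-- At a fixed point the centered samples of each player are independent, so averaging divides the
variance by `S`; the factor `N` sums over players. -/
lemma Admissible.integral_norm_batchGrad_sub_sq_le (hG : G.Admissible L η) (hu : G.Unbiased)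
    {σm : ℝ} (hm : G.BoundedMoment σm) (hS : 0 < S) (hrun : G.IsRun η S T μ Z R) {x : Profile n}
    (hx : x ∈ G.feas) (k : ℕ) :
    Integrable (fun ω => ‖G.batchGrad η x (fun q => Z (k, q) ω) - G.Fη η x‖ ^ 2) μ ∧
      ∫ ω, ‖G.batchGrad η x (fun q => Z (k, q) ω) - G.Fη η x‖ ^ 2 ∂μ ≤
        N * (sigma n L σm ^ 2 / S) := by
  have := hrun.prob
  have hSR : (S : ℝ) ≠ 0 := by positivity
  let Y : ∀ i, Fin S → Ω → Strat (n i) := fun i l ω =>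
    G.sampleGrad η x i (Z (k, i, l) ω) - G.Fη η x i
  have hφ : ∀ i, Measurable fun s => G.sampleGrad η x i s - G.Fη η x i := fun i =>
    (hG.measurable_sampleGrad i (measurable_const (a := (⟨x, hx⟩ : G.feas)))
      measurable_id).sub_const _
  have hcomp : ∀ ω i, (G.batchGrad η x (fun q => Z (k, q) ω) - G.Fη η x) i =
      (1 / (S : ℝ)) • ∑ l, Y i l ω := by
    intro ω i
    have h1 : (1 / (S : ℝ)) • ∑ _l : Fin S, G.Fη η x i = G.Fη η x i := by
      rw [Finset.sum_const, Finset.card_univ, Fintype.card_fin, ← Nat.cast_smul_eq_nsmul ℝ S,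
        smul_smul, one_div, inv_mul_cancel₀ hSR, one_smul]
    simp only [Y, Finset.sum_sub_distrib]
    rw [smul_sub, h1, PiLp.sub_apply]
    rfl
  have hYL : ∀ i l, MemLp (Y i l) 2 μ := fun i l => by
    have h1 := (hG.moments_sampleGrad hu hm i hx).1
    rw [← hrun.law_Z (k, i, l)] at h1
    exact h1.comp_of_map (hrun.meas_Z _).aemeasurable
  have hY0 : ∀ i l, ∫ ω, Y i l ω ∂μ = 0 := fun i l => by
    have h1 := (hG.moments_sampleGrad hu hm i hx).2.1
    rw [← hrun.law_Z (k, i, l), integral_map (hrun.meas_Z _).aemeasurable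
      (hφ i).aestronglyMeasurable] at h1
    exact h1
  have hY2 : ∀ i l, ∫ ω, ‖Y i l ω‖ ^ 2 ∂μ ≤ sigma n L σm ^ 2 := fun i l => by
    have h1 := (hG.moments_sampleGrad hu hm i hx).2.2
    rw [← hrun.law_Z (k, i, l), integral_map (hrun.meas_Z _).aemeasurable
      ((hφ i).norm.pow_const 2).aestronglyMeasurable] at h1
    exact h1
  have hind : ∀ i, Pairwise fun a b => IndepFun (Y i a) (Y i b) μ := fun i a b hab =>
    (hrun.indep_Z.indepFun (i := (k, i, a)) (j := (k, i, b)) (by simpa using hab)).comp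
      (hφ i) (hφ i)
  have hnorm : ∀ ω, ‖G.batchGrad η x (fun q => Z (k, q) ω) - G.Fη η x‖ ^ 2 =
      ∑ i, (1 / (S : ℝ)) ^ 2 * ‖∑ l, Y i l ω‖ ^ 2 := by
    intro ω
    rw [PiLp.norm_sq_eq_of_L2]
    refine Finset.sum_congr rfl fun i _ => ?_
    rw [hcomp, norm_smul, mul_pow, Real.norm_of_nonneg (by positivity)]
  have hint : ∀ i, Integrable (fun ω => (1 / (S : ℝ)) ^ 2 * ‖∑ l, Y i l ω‖ ^ 2) μ := fun i =>
    ((memLp_finsetSum _ fun l _ => hYL i l).integrable_norm_pow two_ne_zero).const_mul _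
  simp_rw [hnorm]
  refine ⟨integrable_finsetSum _ fun i _ => hint i, ?_⟩
  rw [integral_finsetSum _ fun i _ => hint i]
  calc _ ≤ ∑ _i : Fin N, sigma n L σm ^ 2 / S := by
        refine Finset.sum_le_sum fun i _ => ?_
        rw [integral_const_mul]
        have h1 := integral_norm_sum_sq_le (hind i) (hYL i) (hY0 i) (hY2 i)
        rw [Fintype.card_fin] at h1
        calc _ ≤ (1 / (S : ℝ)) ^ 2 * (S * sigma n L σm ^ 2) := by gcongr
          _ = _ := by field_simp
    _ = _ := by simp

/-- The mean square error of the averaged sampled gradients at the iterates. -/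
lemma Admissible.integral_norm_batchGrad_iter_sub_sq_le (hG : G.Admissible L η)
    (hu : G.Unbiased) {σm : ℝ} (hm : G.BoundedMoment σm) (hS : 0 < S)
    (hrun : G.IsRun η S T μ Z R) (γ : ℝ) (x₀ : G.feas) (k : ℕ) {δ : Ω → ℝ}
    (hδ : ∀ ω, δ ω = ‖G.batchGrad η (hG.iterFeas γ x₀ (fun p => Z p ω) k)
      (fun q => Z (k, q) ω) - G.Fη η (hG.iterFeas γ x₀ (fun p => Z p ω) k)‖ ^ 2) :
    Integrable δ μ ∧ ∫ ω, δ ω ∂μ ≤ N * (sigma n L σm ^ 2 / S) := by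
  have := hrun.prob
  let g : G.feas × (∀ q : Fin N × Fin S, Ξ × Strat (n q.1)) → ℝ := fun a =>
    ‖G.batchGrad η a.1 a.2 - G.Fη η a.1‖ ^ 2
  have hg : Measurable g := ((hG.measurable_batchGrad measurable_fst measurable_snd).sub
    ((hG.measurable_Fη hu).comp measurable_fst)).norm.pow_const 2
  have hX : Measurable fun ω => hG.iterFeas γ x₀ (fun p => Z p ω) k :=
    (hG.measurable_iterFeas γ x₀ k).comp (measurable_pi_lambda _ hrun.meas_Z)
  have hW : Measurable fun ω (q : Fin N × Fin S) => Z (k, q) ω :=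
    measurable_pi_lambda _ fun q => hrun.meas_Z _
  have hc : (0 : ℝ) ≤ N * (sigma n L σm ^ 2 / S) := by positivity
  have hδg : δ = fun ω => g (hG.iterFeas γ x₀ (fun p => Z p ω) k, fun q => Z (k, q) ω) :=
    funext hδ
  have hδm : Measurable δ := by
    rw [hδg]
    exact hg.comp (hX.prodMk hW)
  have hδ0 : ∀ ω, 0 ≤ δ ω := fun ω => by rw [hδ]; positivity
  -- The extended nonnegative integral needs no prior integrability; finiteness and the bound come
  -- out together.
  have hle : ∫⁻ ω, ENNReal.ofReal (δ ω) ∂μ ≤ ENNReal.ofReal (N * (sigma n L σm ^ 2 / S)) := by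
    rw [hδg]
    refine lintegral_comp_le_of_indepFun hX hW (hG.indepFun_iterFeas γ x₀ hrun k)
      (g := fun a => ENNReal.ofReal (g a)) hg.ennreal_ofReal fun x => ?_
    obtain ⟨h1, h2⟩ := hG.integral_norm_batchGrad_sub_sq_le hu hm hS hrun x.2 k
    rw [← ofReal_integral_eq_lintegral_ofReal h1
      (Filter.Eventually.of_forall fun ω => by positivity)]
    exact ENNReal.ofReal_le_ofReal h2
  have hI : Integrable δ μ :=
    ⟨hδm.aestronglyMeasurable, (hasFiniteIntegral_iff_ofReal
      (Filter.Eventually.of_forall hδ0)).2 (hle.trans_lt ENNReal.ofReal_lt_top)⟩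
  refine ⟨hI, ?_⟩
  rw [← ofReal_integral_eq_lintegral_ofReal hI (Filter.Eventually.of_forall hδ0)] at hle
  exact (ENNReal.ofReal_le_ofReal_iff hc).1 hle

/-- The expected residual at the output of a run. -/
lemma Admissible.integral_norm_residual_iter_le (hG : G.Admissible L η) (hu : G.Unbiased)
    {σm : ℝ} (hm : G.BoundedMoment σm) (hP : G.IsPotential (G.fη η) (G.Pη η P)) {Lm0 : ℝ≥0}
    (hPm : LipschitzOnWith Lm0 (G.Pm P) G.feas) {Lη : ℝ} (hLη : 0 < Lη)
    (hs : IsSmoothOn Lη (G.Pη η P) G.feas) (hS : 0 < S) (hT : 1 ≤ T)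
    (hrun : G.IsRun η S T μ Z R) {x₀ : Profile n} (hx₀ : x₀ ∈ G.feas) :
    Integrable (fun ω => ‖G.residual η (1 / (2 * Lη))
        (G.iter η (1 / (2 * Lη)) x₀ (fun p => Z p ω) (R ω))‖) μ ∧
      (∫ ω, ‖G.residual η (1 / (2 * Lη))
        (G.iter η (1 / (2 * Lη)) x₀ (fun p => Z p ω) (R ω))‖ ∂μ) ^ 2 ≤
        16 * Lη * G.gap η P / T + 6 * (N * (sigma n L σm ^ 2 / S)) := by
  have := hrun.prob
  set γ := 1 / (2 * Lη) with hγ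
  have hγ0 : 0 < γ := by positivity
  let y₀ : G.feas := ⟨x₀, hx₀⟩
  obtain ⟨g, hgdef⟩ : ∃ g : ℕ → (∀ p : ℕ × Fin N × Fin S, Ξ × Strat (n p.2.1)) → ℝ,
    ∀ k z, g k z = ‖G.residual η γ (hG.iterFeas γ y₀ z k)‖ := ⟨_, fun _ _ => rfl⟩
  have hg : ∀ k, Measurable (g k) := fun k => by
    rw [funext (hgdef k)]
    exact ((hG.measurable_residual hu γ).comp (hG.measurable_iterFeas γ y₀ k)).norm
  have hg0 : ∀ k z, 0 ≤ g k z := fun k z => by rw [hgdef]; exact norm_nonneg _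
  have hgb : ∀ k z, g k z ≤ 1 / γ * Metric.diam G.feas := fun k z => by
    rw [hgdef]
    exact hG.norm_residual_le hγ0 (hG.iterFeas γ y₀ z k).2
  have hZ : Measurable fun ω p => Z p ω := measurable_pi_lambda _ hrun.meas_Z
  have hYm : Measurable fun ω => g (R ω) (fun p => Z p ω) := by
    have : Measurable (Function.uncurry g) := measurable_from_prod_countable_right hg
    exact this.comp (hrun.meas_R.prodMk hZ)
  have hYL : MemLp (fun ω => g (R ω) (fun p => Z p ω)) 2 μ :=
    MemLp.of_bound hYm.aestronglyMeasurable _ (Filter.Eventually.of_forall fun ω => by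
      rw [Real.norm_of_nonneg (hg0 _ _)]
      exact hgb _ _)
  have hgR : (fun ω => ‖G.residual η γ (G.iter η γ x₀ (fun p => Z p ω) (R ω))‖) =
      fun ω => g (R ω) (fun p => Z p ω) := funext fun ω => (hgdef _ _).symm
  rw [hgR]
  refine ⟨hYL.integrable one_le_two, (sq_integral_le_integral_sq hYL).trans ?_⟩
  have hgL : ∀ k, MemLp (fun ω => g k fun p => Z p ω) 2 μ := fun k =>
    MemLp.of_bound ((hg k).comp hZ).aestronglyMeasurable _ (Filter.Eventually.of_forall fun ω => by
      rw [Real.norm_of_nonneg (hg0 _ _)]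
      exact hgb _ _)
  have hgI : ∀ k, Integrable (fun ω => g k (fun p => Z p ω) ^ 2) μ := fun k =>
    (hgL k).integrable_sq
  have huni := integral_comp_uniform_index hT hrun.meas_R hrun.law_R hrun.indep_R
    (g := fun k z => g k z ^ 2) (fun k => (hg k).pow_const 2) hgI
  refine huni.trans_le ?_
  obtain ⟨δ, hδ⟩ : ∃ δ : ℕ → Ω → ℝ, ∀ k ω, δ k ω =
    ‖G.batchGrad η (hG.iterFeas γ y₀ (fun p => Z p ω) k) (fun q => Z (k, q) ω) -
      G.Fη η (hG.iterFeas γ y₀ (fun p => Z p ω) k)‖ ^ 2 := ⟨_, fun _ _ => rfl⟩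
  have hδI : ∀ k, Integrable (δ k) μ ∧ ∫ ω, δ k ω ∂μ ≤ N * (sigma n L σm ^ 2 / S) := fun k =>
    hG.integral_norm_batchGrad_iter_sub_sq_le hu hm hS hrun γ y₀ k (hδ k)
  have hpt : ∀ ω, ∑ k ∈ Finset.Icc 1 T, g k (fun p => Z p ω) ^ 2 ≤
      16 * Lη * G.gap η P + 6 * ∑ k ∈ Finset.Icc 1 T, δ k ω := by
    intro ω
    let x : ℕ → G.feas := fun k => hG.iterFeas γ y₀ (fun p => Z p ω) k
    have h1 : ∀ k, g k (fun p => Z p ω) ^ 2 ≤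
        16 * Lη * (G.Pη η P (x k) - G.Pη η P (x (k + 1))) + 6 * δ k ω := fun k => by
      have h := hG.norm_residual_sq_le hu hP hLη hs (x k).2
        (G.batchGrad η (x k) fun q => Z (k, q) ω)
      rw [← hγ] at h
      have hx : ((x (k + 1) : G.feas) : Profile n) =
          G.step γ (x k) (G.batchGrad η (x k) fun q => Z (k, q) ω) := iter_succ η γ x₀ _ k
      rw [hδ, hgdef, hx]
      exact h
    -- As `R` ranges over `1, …, T`, the sum starts at `x^1` and ends at `x^{T+1}`. This last
    -- iterate serves the analysis only and is not part of the `T` iterations.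
    have h2 : ∑ k ∈ Finset.Icc 1 T, (G.Pη η P (x k) - G.Pη η P (x (k + 1))) =
        G.Pη η P (x 1) - G.Pη η P (x (T + 1)) := by
      rw [← Finset.Ico_add_one_right_eq_Icc]
      have := Finset.sum_Ico_sub (fun k => - G.Pη η P (x k)) (show 1 ≤ T + 1 by omega)
      simp only [sub_neg_eq_add] at this
      rw [sub_eq_neg_add, ← this]
      exact Finset.sum_congr rfl fun k _ => by ring
    have h3 := hG.Pη_sub_le_gap hPm (x 1).2 (x (T + 1)).2
    calc _ ≤ ∑ k ∈ Finset.Icc 1 T,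
          (16 * Lη * (G.Pη η P (x k) - G.Pη η P (x (k + 1))) + 6 * δ k ω) :=
          Finset.sum_le_sum fun k _ => h1 k
      _ = 16 * Lη * (G.Pη η P (x 1) - G.Pη η P (x (T + 1))) +
          6 * ∑ k ∈ Finset.Icc 1 T, δ k ω := by
          rw [Finset.sum_add_distrib, ← Finset.mul_sum, ← Finset.mul_sum, h2]
      _ ≤ _ := by gcongr
  have hsum : ∑ k ∈ Finset.Icc 1 T, ∫ ω, g k (fun p => Z p ω) ^ 2 ∂μ ≤
      16 * Lη * G.gap η P + 6 * (T * (N * (sigma n L σm ^ 2 / S))) := by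
    have hIs : Integrable (fun ω => ∑ k ∈ Finset.Icc 1 T, δ k ω) μ :=
      integrable_finsetSum _ fun k _ => (hδI k).1
    rw [← integral_finsetSum _ fun k _ => hgI k]
    calc _ ≤ ∫ ω, 16 * Lη * G.gap η P + 6 * ∑ k ∈ Finset.Icc 1 T, δ k ω ∂μ :=
          integral_mono (integrable_finsetSum _ fun k _ => hgI k)
            ((integrable_const _).add (hIs.const_mul 6)) hpt
      _ = 16 * Lη * G.gap η P + 6 * ∑ k ∈ Finset.Icc 1 T, ∫ ω, δ k ω ∂μ := by
          rw [integral_add (integrable_const _) (hIs.const_mul 6), integral_const_mul 6,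
            integral_finsetSum _ fun k _ => (hδI k).1]
          simp
      _ ≤ _ := by
          gcongr
          calc _ ≤ ∑ _k ∈ Finset.Icc 1 T, (N * (sigma n L σm ^ 2 / S) : ℝ) :=
                Finset.sum_le_sum fun k _ => (hδI k).2
            _ = _ := by simp
  have hTR : (0 : ℝ) < T := by exact_mod_cast hT
  calc _ ≤ 1 / (T : ℝ) * (16 * Lη * G.gap η P + 6 * (T * (N * (sigma n L σm ^ 2 / S)))) := by
        gcongr
    _ = _ := by
        have hSR : (0 : ℝ) < S := by exact_mod_cast hS
        field_simp

end Run

end Game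

/-! ### Balancing the errors and complexity rates -/

section Rates

lemma budget_two_mul (M : ℕ) : budget (2 * M) M = M := by simp [budget]

lemma iterLimit_eq_floor (N S M₀ M₁ : ℕ) :
    iterLimit N S M₀ M₁ = ⌊budget M₀ M₁ / ((S : ℝ) * N)⌋₊ := by
  have h : Monotone fun x : ℝ => ⌊x / ((S : ℝ) * N)⌋₊ := fun x y hxy =>
    Nat.floor_mono (div_le_div_of_nonneg_right hxy (by positivity))
  exact (h.map_min (a := (M₀ : ℝ) / 2) (b := (M₁ : ℝ))).symm

/-- The batch size before rounding. -/
lemma batchSize_eq_ceil (σ : ℝ) {Lη gap : ℝ} (hL : 0 < Lη) (M₀ M₁ : ℕ) :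
    batchSize σ Lη gap M₀ M₁ = ⌈σ * √(6 * budget M₀ M₁) / (4 * √(Lη * gap))⌉₊ := by
  have h : Lη * √(gap / Lη) = √(Lη * gap) := by
    rw [show Lη * gap = Lη ^ 2 * (gap / Lη) by field_simp, Real.sqrt_mul (by positivity),
      Real.sqrt_sq hL.le]
  rw [batchSize, mul_assoc 4 Lη, h]

/-- A budget of order `ε⁻⁴` balances the two error terms of the scheme. -/
lemma error_le_sq {σ b N M ε S T : ℝ} (hσ : 0 < σ) (hb : 0 < b) (hN : 0 < N) (hM : 0 < M)
    (hS : σ * √(6 * M) / (4 * b) ≤ S) (hS' : S ≤ σ * √(6 * M) / (4 * b) + 1)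
    (hT : M / (S * N) ≤ 2 * T) (hM1 : 3456 * (N ^ 2 * (σ ^ 2 * b ^ 2)) ≤ M * ε ^ 4)
    (hM2 : 64 * (b ^ 2 * N) ≤ M * ε ^ 2) :
    16 * b ^ 2 / T + 6 * (N * (σ ^ 2 / S)) ≤ ε ^ 2 := by
  set w := √(6 * M) with hw
  have hw0 : 0 < w := by positivity
  have hw2 : w ^ 2 = 6 * M := Real.sq_sqrt (by positivity)
  have hS0 : 0 < S := lt_of_lt_of_le (by positivity) hS
  have hx : 0 < M / (S * N) := by positivity
  have hT0 : 0 < T := by linarith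
  -- The second summand is the price of rounding the batch size up by at most one.
  have h1 : 16 * b ^ 2 / T ≤ 48 * (N * σ * b) / w + 32 * (b ^ 2 * N) / M := by
    have h2 : 16 * b ^ 2 / T ≤ 16 * b ^ 2 / (M / (S * N) / 2) := by
      gcongr
      linarith
    have h3 : 16 * b ^ 2 / (M / (S * N) / 2) = 32 * (b ^ 2 * N) / M * S := by
      field_simp
      ring
    have h4 : 32 * (b ^ 2 * N) / M * S ≤ 32 * (b ^ 2 * N) / M * (σ * w / (4 * b) + 1) := by
      gcongr
    have h5 : 32 * (b ^ 2 * N) / M * (σ * w / (4 * b)) = 48 * (N * σ * b) / w := by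
      rw [show M = w ^ 2 / 6 by linarith]
      field_simp
      ring
    rw [mul_add, h5, mul_one] at h4
    linarith
  have h2 : 6 * (N * (σ ^ 2 / S)) ≤ 24 * (N * σ * b) / w := by
    calc _ ≤ 6 * (N * (σ ^ 2 / (σ * w / (4 * b)))) := by gcongr
      _ = _ := by
        field_simp
        ring
  -- Squared, with `w² = 6M`, this is the first budget condition: `144² / 6 = 3456`.
  have h3 : 72 * (N * σ * b) / w ≤ ε ^ 2 / 2 := by
    rw [div_le_iff₀ hw0]
    refine le_of_pow_le_pow_left₀ two_ne_zero (by positivity) ?_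
    nlinarith
  have h4 : 32 * (b ^ 2 * N) / M ≤ ε ^ 2 / 2 := by
    rw [div_le_iff₀ hM]
    linarith
  have h5 : 72 * (N * σ * b) / w = 48 * (N * σ * b) / w + 24 * (N * σ * b) / w := by ring
  linarith

/-- Sufficient size of the budget for one iteration. -/
lemma mul_le_of_budget {σ b N M S : ℝ} (hσ : 0 < σ) (hb : 0 < b) (hN : 0 < N) (hM : 0 < M)
    (hS' : S ≤ σ * √(6 * M) / (4 * b) + 1) (hM' : 2 * N + 3 * σ ^ 2 * N ^ 2 / (2 * b ^ 2) ≤ M) :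
    S * N ≤ M := by
  set w := √(6 * M) with hw
  have hw0 : 0 < w := by positivity
  have hw2 : w ^ 2 = 6 * M := Real.sq_sqrt (by positivity)
  have h1 : 3 * σ ^ 2 * N ^ 2 / (2 * b ^ 2) ≤ M := by linarith
  have h2 : 2 * N ≤ M := by
    have : 0 < 3 * σ ^ 2 * N ^ 2 / (2 * b ^ 2) := by positivity
    linarith
  have h3 : 3 * σ * N / b ≤ w := by
    refine le_of_pow_le_pow_left₀ two_ne_zero (by positivity) ?_
    have : (3 * σ * N / b) ^ 2 = 6 * (3 * σ ^ 2 * N ^ 2 / (2 * b ^ 2)) := by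
      field_simp
      ring
    rw [this, hw2]
    linarith
  have h4 : σ * w / (4 * b) * N ≤ M / 2 := by
    have : σ * w / (4 * b) * N = 3 * σ * N / b * w / 12 := by
      field_simp
      ring
    rw [this]
    nlinarith
  calc S * N ≤ (σ * w / (4 * b) + 1) * N := by gcongr
    _ ≤ M := by linarith

/-- The number of iterations afforded by a budget. -/
lemma div_sq_le {σ b N M S : ℝ} (hσ : 0 < σ) (hb : 0 < b) (hN : 0 < N) (hM : 0 < M)
    (hS : σ * √(6 * M) / (4 * b) ≤ S) :
    (M / (S * N)) ^ 2 ≤ 8 / 3 * (b ^ 2 * M / (σ ^ 2 * N ^ 2)) := by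
  set w := √(6 * M) with hw
  have hw0 : 0 < w := by positivity
  have hw2 : w ^ 2 = 6 * M := Real.sq_sqrt (by positivity)
  have hS0 : 0 < S := lt_of_lt_of_le (by positivity) hS
  calc (M / (S * N)) ^ 2 ≤ (M / (σ * w / (4 * b) * N)) ^ 2 := by gcongr
    _ = 16 * M ^ 2 * b ^ 2 / (σ ^ 2 * w ^ 2 * N ^ 2) := by
        field_simp
        ring
    _ = _ := by
        rw [hw2]
        field_simp
        ring

variable {N : ℕ} {n : Fin N → ℕ} {L : Fin N → ℝ≥0} {ℓ : ℝ}

lemma le_sigma_sq (σm : ℝ) : Lmax L ^ 2 * nmax n ≤ sigma n L σm ^ 2 := by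
  have h1 := lmax_nonneg L
  have h2 : (0 : ℝ) ≤ nmax n := Nat.cast_nonneg _
  rw [sigma, Real.sq_sqrt (by positivity)]
  have h3 : 1 ≤ √(2 * Real.pi) := Real.one_le_sqrt.2 (by linarith [Real.pi_gt_three])
  have h4 : 0 ≤ Lmax L ^ 2 * nmax n := by positivity
  nlinarith [sq_nonneg σm]

lemma sigma_sq_le (σm : ℝ) (hℓ : 0 < ℓ) (hL : ℓ ≤ Lmax L) (hn : 1 ≤ nmax n) :
    sigma n L σm ^ 2 ≤ (32 * √(2 * Real.pi) + 2 * σm ^ 2 / ℓ ^ 2) * (Lmax L ^ 2 * nmax n) := by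
  have h2 : (0 : ℝ) ≤ nmax n := by linarith
  rw [sigma, Real.sq_sqrt (by positivity), add_mul]
  have h3 : ℓ ^ 2 * 1 ≤ Lmax L ^ 2 * nmax n := by gcongr
  have h4 : 2 * σm ^ 2 = 2 * σm ^ 2 / ℓ ^ 2 * (ℓ ^ 2 * 1) := by field_simp
  have h5 : 2 * σm ^ 2 / ℓ ^ 2 * (ℓ ^ 2 * 1) ≤ 2 * σm ^ 2 / ℓ ^ 2 * (Lmax L ^ 2 * nmax n) := by
    gcongr
  linarith

lemma smoothConst_mul_le {Lm0 Lm1 : ℝ≥0} {DX η ηbar : ℝ} (hDX : 0 ≤ DX) (hℓ : 0 < ℓ)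
    (hL : ℓ ≤ Lmax L) (hn : 1 ≤ nmax n) (hN : 1 ≤ (N : ℝ)) (hη : 0 < η) (hη' : η ≤ ηbar) :
    smoothConst n L Lm1 η * ((Lm0 + Lmax L * √(N : ℝ)) * DX) ≤
      ((Lm1 * ηbar / ℓ + 1) * ((Lm0 / ℓ + 1) * DX)) *
        (Lmax L ^ 2 * √(nmax n) * N / η) := by
  have hn' : 1 ≤ √(nmax n) := Real.one_le_sqrt.2 hn
  have hN' : 1 ≤ √(N : ℝ) := Real.one_le_sqrt.2 hN
  have hΛ : 0 < Lmax L := hℓ.trans_le hL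
  have hηb : 0 < ηbar := hη.trans_le hη'
  have h1 : smoothConst n L Lm1 η ≤
      (Lm1 * ηbar / ℓ + 1) * (Lmax L * √(nmax n) * √(N : ℝ) / η) := by
    have : (Lm1 : ℝ) ≤ Lm1 * ηbar / ℓ * (Lmax L * √(nmax n) * √(N : ℝ) / η) := by
      calc (Lm1 : ℝ) = Lm1 * ηbar / ℓ * (ℓ * 1 * 1 / ηbar) := by field_simp
        _ ≤ _ := by gcongr
    rw [smoothConst]
    linarith
  have h2 : (Lm0 + Lmax L * √(N : ℝ)) * DX ≤ (Lm0 / ℓ + 1) * DX * (Lmax L * √(N : ℝ)) := by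
    have : (Lm0 : ℝ) ≤ Lm0 / ℓ * (Lmax L * √(N : ℝ)) := by
      calc (Lm0 : ℝ) = Lm0 / ℓ * (ℓ * 1) := by field_simp
        _ ≤ _ := by gcongr
    nlinarith
  calc _ ≤ (Lm1 * ηbar / ℓ + 1) * (Lmax L * √(nmax n) * √(N : ℝ) / η) *
        ((Lm0 / ℓ + 1) * DX * (Lmax L * √(N : ℝ))) := by gcongr
    _ = (Lm1 * ηbar / ℓ + 1) * ((Lm0 / ℓ + 1) * DX) *
        (Lmax L ^ 2 * √(nmax n) * √(N : ℝ) ^ 2 / η) := by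
        field_simp
    _ = _ := by rw [Real.sq_sqrt (by positivity)]

lemma sampleRate_eq (n : Fin N → ℕ) (L : Fin N → ℝ≥0) (η ε : ℝ) :
    sampleRate n L η ε = Lmax L ^ 4 * √(nmax n) ^ 3 * (N : ℝ) ^ 3 / η / ε ^ 4 := by
  have h : nmax n ^ (3 / 2 : ℝ) = √(nmax n) ^ 3 := by
    have h0 : (0 : ℝ) ≤ nmax n := Nat.cast_nonneg _
    rw [Real.sqrt_eq_rpow, ← Real.rpow_natCast, ← Real.rpow_mul h0]
    norm_num
  rw [sampleRate, h]
  rfl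

/-- A positive lower bound independent of the game, used to absorb the rounding of the budget into a
constant. -/
lemma le_sampleRate {η ηbar ε εbar : ℝ} (hℓ : 0 < ℓ) (hL : ℓ ≤ Lmax L) (hn : 1 ≤ nmax n)
    (hN : 1 ≤ (N : ℝ)) (hη : 0 < η) (hη' : η ≤ ηbar) (hε : 0 < ε) (hε' : ε ≤ εbar) :
    ℓ ^ 4 / ηbar / εbar ^ 4 ≤ sampleRate n L η ε := by
  have hn' : 1 ≤ √(nmax n) := Real.one_le_sqrt.2 hn
  have hηb : 0 < ηbar := hη.trans_le hη'
  rw [sampleRate_eq]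
  calc _ = ℓ ^ 4 * 1 ^ 3 * 1 ^ 3 / ηbar / εbar ^ 4 := by ring
    _ ≤ _ := by gcongr

/-- The budget requirement of `error_le_sq` at the sample complexity rate. -/
lemma budget_conditions {A H η ε εbar σ b M : ℝ} (hH : 0 < H) (hℓ : 0 < ℓ)
    (hL : ℓ ≤ Lmax L) (hn : 1 ≤ nmax n) (hN : 1 ≤ (N : ℝ)) (hη : 0 < η) (hε : 0 < ε)
    (hε' : ε ≤ εbar) (hA : 0 < A) (hσA : σ ^ 2 ≤ A * (Lmax L ^ 2 * nmax n))
    (hbH : b ^ 2 ≤ H * (Lmax L ^ 2 * √(nmax n) * N / η))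
    (hM : (3456 * (A * H) + 64 * (H * εbar ^ 2 / ℓ ^ 2)) * sampleRate n L η ε ≤ M) :
    3456 * ((N : ℝ) ^ 2 * (σ ^ 2 * b ^ 2)) ≤ M * ε ^ 4 ∧ 64 * (b ^ 2 * N) ≤ M * ε ^ 2 := by
  have hn' : 1 ≤ √(nmax n) := Real.one_le_sqrt.2 hn
  have hΛ : 0 < Lmax L := hℓ.trans_le hL
  have hr2 : nmax n = √(nmax n) ^ 2 := (Real.sq_sqrt (by linarith)).symm
  have hB0 : 0 ≤ sampleRate n L η ε := by rw [sampleRate_eq]; positivity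
  have hεb : 0 < εbar := hε.trans_le hε'
  rw [add_mul] at hM
  have hc1 : 0 ≤ 3456 * (A * H) * sampleRate n L η ε := by positivity
  have hc2 : 0 ≤ 64 * (H * εbar ^ 2 / ℓ ^ 2) * sampleRate n L η ε := by positivity
  constructor
  · calc 3456 * ((N : ℝ) ^ 2 * (σ ^ 2 * b ^ 2)) ≤ 3456 * ((N : ℝ) ^ 2 *
          (A * (Lmax L ^ 2 * nmax n) * (H * (Lmax L ^ 2 * √(nmax n) * N / η)))) := by gcongr
      _ = 3456 * (A * H) * sampleRate n L η ε * ε ^ 4 := by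
          rw [sampleRate_eq, hr2, Real.sqrt_sq (by positivity)]
          field_simp
      _ ≤ M * ε ^ 4 := by
          gcongr
          linarith
  -- The rounding term needs only a budget of order `ε⁻²`; factors at least one, such as `L_max/ℓ`
  -- and `εbar/ε`, lift it to the sample rate.
  · calc 64 * (b ^ 2 * N) ≤ 64 * (H * (Lmax L ^ 2 * √(nmax n) * N / η) * N) := by gcongr
      _ = 64 * H / η * (Lmax L ^ 2 * √(nmax n) * (N : ℝ) ^ 2 * 1 * 1 * 1 * 1) := by ring
      _ ≤ 64 * H / η * (Lmax L ^ 2 * √(nmax n) * (N : ℝ) ^ 2 * (Lmax L / ℓ) ^ 2 *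
          √(nmax n) ^ 2 * N * (εbar / ε) ^ 2) := by
          have h1 : 1 ≤ Lmax L / ℓ := (one_le_div hℓ).2 hL
          have h2 : 1 ≤ εbar / ε := (one_le_div hε).2 hε'
          have h3 : 1 ≤ (Lmax L / ℓ) ^ 2 := one_le_pow₀ h1
          have h4 : 1 ≤ (εbar / ε) ^ 2 := one_le_pow₀ h2
          have h5 : 1 ≤ √(nmax n) ^ 2 := one_le_pow₀ hn'
          gcongr
      _ = 64 * (H * εbar ^ 2 / ℓ ^ 2) * sampleRate n L η ε * ε ^ 2 := by
          rw [sampleRate_eq]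
          field_simp
      _ ≤ M * ε ^ 2 := by
          gcongr
          linarith

/-- The number of iterations at a budget of the order of the sample complexity rate. -/
lemma div_le_iterRate {H C η ε σ b M S : ℝ} (hH : 0 < H) (hC : 0 < C) (hℓ : 0 < ℓ)
    (hL : ℓ ≤ Lmax L) (hn : 1 ≤ nmax n) (hN : 1 ≤ (N : ℝ)) (hη : 0 < η) (hε : 0 < ε)
    (hσ0 : 0 < σ) (hσ : Lmax L ^ 2 * nmax n ≤ σ ^ 2) (hb : 0 < b)
    (hbH : b ^ 2 ≤ H * (Lmax L ^ 2 * √(nmax n) * N / η)) (hM0 : 0 < M)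
    (hM : M ≤ C * sampleRate n L η ε) (hS : σ * √(6 * M) / (4 * b) ≤ S) :
    M / (S * N) ≤ (1 + 8 / 3 * (H * C / ℓ ^ 2)) * iterRate n L η ε := by
  have hn' : 1 ≤ √(nmax n) := Real.one_le_sqrt.2 hn
  have hn0 : 0 < nmax n := by linarith
  have hΛ : 0 < Lmax L := hℓ.trans_le hL
  have hN0 : (0 : ℝ) < N := by linarith
  have hr2 : √(nmax n) ^ 2 = nmax n := Real.sq_sqrt (by linarith)
  have hI0 : 0 ≤ iterRate n L η ε := by rw [iterRate]; positivity
  have hB0 : 0 ≤ sampleRate n L η ε := by rw [sampleRate_eq]; positivity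
  set κ := 8 / 3 * (H * C / ℓ ^ 2) with hκ
  have hκ0 : 0 < κ := by positivity
  -- The bounds give an iteration count of order `L_max² √n_max N / (η ε²)`; the further factor
  -- `L_max √n_max` of the rate is slack, paid for by `1/ℓ`.
  have h1 : (M / (S * N)) ^ 2 ≤ κ * iterRate n L η ε ^ 2 := by
    calc (M / (S * N)) ^ 2 ≤ 8 / 3 * (b ^ 2 * M / (σ ^ 2 * N ^ 2)) := div_sq_le hσ0 hb hN0 hM0 hS
      _ ≤ 8 / 3 * (H * (Lmax L ^ 2 * √(nmax n) * N / η) * (C * sampleRate n L η ε) /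
          (Lmax L ^ 2 * nmax n * N ^ 2)) := by gcongr
      _ = 8 / 3 * H * C * (Lmax L ^ 4 * nmax n * N ^ 2 / η ^ 2 / ε ^ 4 * 1 * 1) := by
          rw [sampleRate_eq, ← hr2]
          field_simp
          simp
      _ ≤ 8 / 3 * H * C * (Lmax L ^ 4 * nmax n * N ^ 2 / η ^ 2 / ε ^ 4 * (Lmax L / ℓ) ^ 2 *
          nmax n) := by
          have h2 : 1 ≤ (Lmax L / ℓ) ^ 2 := one_le_pow₀ ((one_le_div hℓ).2 hL)
          gcongr
      _ = _ := by
          rw [iterRate, hκ]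
          field_simp
  -- Using `κ ≤ (1 + κ)²` avoids a square root in the constant.
  refine le_of_pow_le_pow_left₀ two_ne_zero (by positivity) (h1.trans ?_)
  rw [mul_pow]
  gcongr
  nlinarith

/-- Budgets of the order of the sample complexity rate become arbitrarily large. -/
lemma exists_le_mul_sampleRate {η C : ℝ} (hC : 0 < C) (hL : 0 < Lmax L) (hn : 0 < nmax n)
    (hN : (0 : ℝ) < N) (hη : 0 < η) {M : ℝ} (hM : 0 < M) :
    ∃ ε₀ > 0, ∀ ε : ℝ, 0 < ε → ε ≤ ε₀ → M ≤ C * sampleRate n L η ε := by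
  set c := C * (Lmax L ^ 4 * √(nmax n) ^ 3 * (N : ℝ) ^ 3 / η) with hc
  have hc0 : 0 < c := by positivity
  refine ⟨min 1 (c / M), by positivity, fun ε hε hε' => ?_⟩
  have h1 : ε ^ 4 ≤ c / M := by
    calc ε ^ 4 ≤ ε ^ 1 := pow_le_pow_of_le_one hε.le (hε'.trans (min_le_left _ _)) (by norm_num)
      _ ≤ c / M := by
          rw [pow_one]
          exact hε'.trans (min_le_right _ _)
  rw [sampleRate_eq, ← mul_div_assoc, ← hc, le_div_iff₀ (by positivity)]
  rw [le_div_iff₀ hM] at h1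
  linarith

end Rates

end RSRSG

/-! ### The complexity theorem -/

theorem mainTheorem3 (Lm0 Lm1 : ℝ≥0) (σm DX ℓ ηbar εbar : ℝ) (hσm : 0 < σm) (hDX : 0 < DX)
    (hℓ : 0 < ℓ) (hηbar : 0 < ηbar) (hεbar : 0 < εbar) :
    ∃ C > 0, ∃ K > 0,
      ∀ (N : ℕ) (n : Fin N → ℕ) (Ξ : Type*) [MeasurableSpace Ξ] (G : RSRSG.Game n Ξ)
        (L : Fin N → ℝ≥0) (η : ℝ) (P : RSRSG.Profile n → ℝ),
        0 < η → η ≤ ηbar → ℓ ≤ RSRSG.Lmax L →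
        G.Regular L η → G.Unbiased → G.BoundedMoment σm →
        IsCompact G.feas → Metric.diam G.feas = DX →
        G.IsPotential (G.fη η) (G.Pη η P) →
        LipschitzOnWith Lm0 (G.Pm P) G.feas →
        RSRSG.IsSmoothOn Lm1 (G.Pm P) G.feas →
        0 < G.gap η P →
        RSRSG.IsSmoothOn (RSRSG.smoothConst n L Lm1 η) (G.Pη η P) G.feas ∧
        ∀ Lη : ℝ, 0 < Lη → Lη ≤ RSRSG.smoothConst n L Lm1 η →
          RSRSG.IsSmoothOn Lη (G.Pη η P) G.feas →
          let S : ℕ → ℕ → ℕ := RSRSG.batchSize (RSRSG.sigma n L σm) Lη (G.gap η P)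
          let T : ℕ → ℕ → ℕ := fun M₀ M₁ => RSRSG.iterLimit N (S M₀ M₁) M₀ M₁
          let γ : ℝ := 1 / (2 * Lη)
          (∀ ε : ℝ, 0 < ε → ε ≤ εbar →
            -- every budget of this order for which an iteration is affordable reaches accuracy `ε`
            (∀ M₀ M₁ : ℕ, C * RSRSG.sampleRate n L η ε ≤ RSRSG.budget M₀ M₁ → 1 ≤ T M₀ M₁ →
              ∀ (Ω : Type*) [MeasurableSpace Ω] (μ : Measure Ω)
                (Z : ∀ p : ℕ × Fin N × Fin (S M₀ M₁), Ω → Ξ × RSRSG.Strat (n p.2.1)) (R : Ω → ℕ),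
                G.IsRun η (S M₀ M₁) (T M₀ M₁) μ Z R → ∀ x₀ ∈ G.feas,
                Integrable
                  (fun ω => ‖G.residual η γ (G.iter η γ x₀ (fun p => Z p ω) (R ω))‖) μ ∧
                ∫ ω, ‖G.residual η γ (G.iter η γ x₀ (fun p => Z p ω) (R ω))‖ ∂μ ≤ ε) ∧
            -- the smallest such budget: numbers of oracle calls and of iterations
            (∀ M : ℕ, M = ⌈C * RSRSG.sampleRate n L η ε⌉₊ →
              2 * (S (2 * M) M * N * T (2 * M) M) ≤ 2 * M ∧
              S (2 * M) M * N * T (2 * M) M ≤ M ∧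
              (2 * M + M : ℝ) ≤ K * RSRSG.sampleRate n L η ε ∧
              (T (2 * M) M : ℝ) ≤ K * RSRSG.iterRate n L η ε)) ∧
          -- for small `ε` every budget of this order affords an iteration
          ∃ ε₀ > 0, ∀ ε : ℝ, 0 < ε → ε ≤ ε₀ → ∀ M₀ M₁ : ℕ,
            C * RSRSG.sampleRate n L η ε ≤ RSRSG.budget M₀ M₁ → 1 ≤ T M₀ M₁ := by
  have hA : 0 < 32 * √(2 * Real.pi) + 2 * σm ^ 2 / ℓ ^ 2 := by positivity
  set A := 32 * √(2 * Real.pi) + 2 * σm ^ 2 / ℓ ^ 2 with hAdef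
  have hH : 0 < (Lm1 * ηbar / ℓ + 1) * ((Lm0 / ℓ + 1) * DX) := by positivity
  set H := (Lm1 * ηbar / ℓ + 1) * ((Lm0 / ℓ + 1) * DX) with hHdef
  -- `A` and `H` are the constants in the bounds for `σ²` and `L(η) · gap`. The first summand pays
  -- for the balanced errors, the second for rounding the batch size.
  have hC : 0 < 3456 * (A * H) + 64 * (H * εbar ^ 2 / ℓ ^ 2) := by positivity
  set C := 3456 * (A * H) + 64 * (H * εbar ^ 2 / ℓ ^ 2) with hCdef
  have hB0 : 0 < ℓ ^ 4 / ηbar / εbar ^ 4 := by positivity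
  set B₀ := ℓ ^ 4 / ηbar / εbar ^ 4 with hB0def
  -- Since the rate is at least `B₀`, replacing `C` by `C + 1/B₀` absorbs the ceiling in `M`; the
  -- factor `3` is `M₀ + M₁ = 3M`.
  set K := max (3 * (C + 1 / B₀)) (1 + 8 / 3 * (H * (C + 1 / B₀) / ℓ ^ 2)) with hK
  refine ⟨C, hC, K, lt_max_of_lt_left (by positivity), ?_⟩
  intro N n Ξ _ G L η P hη hη' hL hreg hu hm hcpt hdiam hP hPm0 hPm1 hgap
  have hΛ : 0 < RSRSG.Lmax L := hℓ.trans_le hL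
  have hNpos : 1 ≤ N := by
    rcases Nat.eq_zero_or_pos N with rfl | h
    · simp [RSRSG.Lmax] at hΛ
    · exact h
  have hN : (1 : ℝ) ≤ N := by exact_mod_cast hNpos
  have hN0 : (0 : ℝ) < N := by linarith
  have hn : 1 ≤ RSRSG.nmax n :=
    le_trans (by exact_mod_cast hreg.dim_pos ⟨0, hNpos⟩) (RSRSG.le_nmax n ⟨0, hNpos⟩)
  -- Over an empty set `sSup` and `sInf` both default to `0`, which a positive gap excludes.
  have hne : G.feas.Nonempty := by
    by_contra h
    rw [Set.not_nonempty_iff_eq_empty] at h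
    simp [RSRSG.Game.gap, h] at hgap
  have hG : G.Admissible L η := ⟨hreg, hη, hcpt, hne⟩
  refine ⟨hG.isSmoothOn_Pη hNpos hPm1, fun Lη hLη hLη' hs => ?_⟩
  intro S T γ
  set σ := RSRSG.sigma n L σm with hσdef
  have hσL : RSRSG.Lmax L ^ 2 * RSRSG.nmax n ≤ σ ^ 2 := RSRSG.le_sigma_sq σm
  have hσU : σ ^ 2 ≤ A * (RSRSG.Lmax L ^ 2 * RSRSG.nmax n) := RSRSG.sigma_sq_le σm hℓ hL hn
  have hσ : 0 < σ := Real.sqrt_pos.2 (by positivity)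
  have hb : 0 < √(Lη * G.gap η P) := Real.sqrt_pos.2 (by positivity)
  have hb2 : √(Lη * G.gap η P) ^ 2 = Lη * G.gap η P := Real.sq_sqrt (by positivity)
  have hbH : √(Lη * G.gap η P) ^ 2 ≤
      H * (RSRSG.Lmax L ^ 2 * √(RSRSG.nmax n) * N / η) := by
    have h1 := hG.gap_le hPm0
    rw [hdiam] at h1
    rw [hb2]
    calc _ ≤ _ := mul_le_mul hLη' h1 hgap.le (hLη.le.trans hLη')
      _ ≤ _ := RSRSG.smoothConst_mul_le hDX.le hℓ hL hn hN hη hη'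
  set b := √(Lη * G.gap η P) with hbdef
  have hSceil : ∀ M₀ M₁, S M₀ M₁ = ⌈σ * √(6 * RSRSG.budget M₀ M₁) / (4 * b)⌉₊ := fun M₀ M₁ =>
    RSRSG.batchSize_eq_ceil σ hLη M₀ M₁
  have hTfloor : ∀ M₀ M₁, T M₀ M₁ = ⌊RSRSG.budget M₀ M₁ / ((S M₀ M₁ : ℝ) * N)⌋₊ := fun M₀ M₁ =>
    RSRSG.iterLimit_eq_floor N (S M₀ M₁) M₀ M₁
  have hSle : ∀ M₀ M₁, σ * √(6 * RSRSG.budget M₀ M₁) / (4 * b) ≤ S M₀ M₁ := fun M₀ M₁ => by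
    rw [hSceil]
    exact Nat.le_ceil _
  have hleS : ∀ M₀ M₁, (S M₀ M₁ : ℝ) ≤ σ * √(6 * RSRSG.budget M₀ M₁) / (4 * b) + 1 :=
    fun M₀ M₁ => by
      rw [hSceil]
      exact (Nat.ceil_lt_add_one (by positivity)).le
  have hSpos : ∀ M₀ M₁, 0 < RSRSG.budget M₀ M₁ → 0 < S M₀ M₁ := fun M₀ M₁ hM => by
    rw [hSceil]
    exact Nat.ceil_pos.2 (by positivity)
  have hB : ∀ ε : ℝ, 0 < ε → ε ≤ εbar → B₀ ≤ RSRSG.sampleRate n L η ε := fun ε hε hε' =>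
    RSRSG.le_sampleRate hℓ hL hn hN hη hη' hε hε'
  refine ⟨fun ε hε hε' => ⟨?_, ?_⟩, ?_⟩
  · intro M₀ M₁ hM hT Ω _ μ Z R hrun x₀ hx₀
    have hM0 : 0 < RSRSG.budget M₀ M₁ :=
      lt_of_lt_of_le (mul_pos hC (hB0.trans_le (hB ε hε hε'))) hM
    have hS0 := hSpos M₀ M₁ hM0
    obtain ⟨hI, hle⟩ :=
      hG.integral_norm_residual_iter_le hu hm hP hPm0 hLη hs hS0 hT hrun hx₀
    refine ⟨hI, le_of_pow_le_pow_left₀ two_ne_zero hε.le (hle.trans ?_)⟩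
    rw [mul_assoc 16 Lη, ← hb2]
    obtain ⟨hM1, hM2⟩ :=
      RSRSG.budget_conditions hH hℓ hL hn hN hη hε hε' hA hσU hbH hM
    refine RSRSG.error_le_sq hσ hb hN0 hM0 (hSle M₀ M₁) (hleS M₀ M₁) ?_ hM1 hM2
    -- Once `T ≥ 1`, rounding down loses at most a factor of two.
    have h1 := Nat.lt_floor_add_one (RSRSG.budget M₀ M₁ / ((S M₀ M₁ : ℝ) * N))
    rw [← hTfloor] at h1
    have h2 : (1 : ℝ) ≤ T M₀ M₁ := by exact_mod_cast hT
    linarith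
  · intro M hM
    have hBε := hB ε hε hε'
    have hBpos := hB0.trans_le hBε
    have hMR : (M : ℝ) ≤ (C + 1 / B₀) * RSRSG.sampleRate n L η ε := by
      have h1 : (M : ℝ) ≤ C * RSRSG.sampleRate n L η ε + 1 := by
        rw [hM]
        exact (Nat.ceil_lt_add_one (by positivity)).le
      have h2 : 1 ≤ 1 / B₀ * RSRSG.sampleRate n L η ε := by
        rw [one_div_mul_eq_div]
        exact (one_le_div hB0).2 hBε
      linarith
    have hMpos : (0 : ℝ) < M := by
      have : 0 < M := hM ▸ Nat.ceil_pos.2 (by positivity)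
      exact_mod_cast this
    have hbud := RSRSG.budget_two_mul M
    have hS0 : (0 : ℝ) < S (2 * M) M := by
      exact_mod_cast hSpos (2 * M) M (by rw [hbud]; exact hMpos)
    have hTle : (T (2 * M) M : ℝ) ≤ M / ((S (2 * M) M : ℝ) * N) := by
      rw [hTfloor, hbud]
      exact Nat.floor_le (by positivity)
    have hSNT : S (2 * M) M * N * T (2 * M) M ≤ M := by
      have h1 := (le_div_iff₀ (by positivity)).1 hTle
      have h2 : ((S (2 * M) M * N * T (2 * M) M : ℕ) : ℝ) ≤ M := by
        push_cast
        linarith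
      exact_mod_cast h2
    refine ⟨by omega, hSNT, ?_, hTle.trans ?_⟩
    · calc (2 * M + M : ℝ) ≤ 3 * (C + 1 / B₀) * RSRSG.sampleRate n L η ε := by linarith
        _ ≤ _ := by
          gcongr
          exact le_max_left _ _
    · have hS1 := hSle (2 * M) M
      rw [hbud] at hS1
      have hI0 : 0 ≤ RSRSG.iterRate n L η ε := by
        rw [RSRSG.iterRate]
        positivity
      refine (RSRSG.div_le_iterRate hH (by positivity) hℓ hL hn hN hη hε hσ hσL hb hbH hMpos hMR
        hS1).trans ?_
      gcongr
      exact le_max_right _ _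
  · obtain ⟨ε₀, hε₀, h⟩ := RSRSG.exists_le_mul_sampleRate (L := L) (n := n) hC hΛ
      (zero_lt_one.trans_le hn) hN0 hη
      (M := 2 * N + 3 * σ ^ 2 * (N : ℝ) ^ 2 / (2 * b ^ 2)) (by positivity)
    refine ⟨ε₀, hε₀, fun ε hε hε' M₀ M₁ hM => ?_⟩
    have hM' := (h ε hε hε').trans hM
    have hM0 : 0 < RSRSG.budget M₀ M₁ := lt_of_lt_of_le (by positivity) hM'
    have hS0 : (0 : ℝ) < S M₀ M₁ := by exact_mod_cast hSpos M₀ M₁ hM0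
    rw [hTfloor]
    refine Nat.le_floor ?_
    rw [Nat.cast_one, one_le_div (by positivity)]
    exact RSRSG.mul_le_of_budget hσ hb hN0 hM0 (hleS M₀ M₁) hM'
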